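/- Notation. All graphs are finite and simple. $P_m$ is the path on $m$ vertices, $K_m$ the complete graph on $m$ vertices, $G\cup H$ the disjoint union, $mG$ the disjoint union of $m$ copies of $G$, and $G\vee H$ the join (the disjoint union together with all edges between $G$ and $H$). $H\subseteq G$ means that $G$ has a subgraph isomorphic to $H$; $G=H$ means that $G$ and $H$ are isomorphic; $\delta(G)$ is the minimum degree. A cut vertex is a vertex whose removal increases the number of components. Moreover: - $S_{n,h}=K_h\vee\overline{K_{n-h}}$; - $L_{t_1,t_2,h,h+1}=K_1\vee(t_1K_h\cup t_2K_{h+1})$ for $t_1,t_2\ge 0$, whose center is the vertex of the $K_1$, and $L_{t,h}=L_{t,0,h,h+1}$; - $H_n^1$ (for $n\ge 6$) is the graph of order $n$ obtained from $S_{n-2,2}$ and $K_3$ by identifying one of the two vertices of the $K_2$ in $S_{n-2,2}=K_2\vee\overline{K_{n-4}}$ with a vertex of $K_3$; - $H_n^2$ (for $n\ge 8$) is the graph of order $n$ obtained from $H_{n-2}^1$ and a further $K_3$ by identifying the other vertex of that $K_2$ with a vertex of the new $K_3$; - $U_{3,h}$ is the graph of order $3h+3$ obtained from a triangle and three disjoint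 copies of $K_{h+1}$ by identifying each vertex of the triangle with a vertex of a different copy of $K_{h+1}$; - for $h\ge 2$, $F_{t_1,t_2,h,h+1}$ (respectively $T_{t_1,t_2,h,h+1}$) is obtained from the disjoint union of $L_{t_1,t_2,h,h+1}$ and one copy (respectively two copies) of $K_{h+1}$ by adding an edge from the center of $L_{t_1,t_2,h,h+1}$ to one vertex of the copy (respectively of each copy) of $K_{h+1}$. Theorem. Let $k\ge 0$, $a_1\ge\dots\ge a_k\ge 1$ and $b_1\ge b_2\ge 1$ be integers, let $$F=\Big(\bigcup_{i=1}^k P_{2a_i}\Big)\cup P_{2b_1+1}\cup P_{2b_2+1},\qquad h=\sum_{i=1}^k a_i+b_1+b_2-1,$$ and let $G$ be a connected graph of order $n\ge 2h+4$ with at least one cut vertex. (a) If $k=0$ and $\delta(G)\ge h\ge 1$, then $F\subseteq G$ unless one of the following holds: (i) $F=P_5\cup P_3$, and $G\subseteq H_n^1$ or $G\subseteq H_n^2$; (ii) $F=P_{2b_1+1}\cup P_{2b_1-1}$ and $G=L_{t,h}$ for some $t$ with $n=th+1$; (iii) $F=2P_{2b_1+1}$, $n=3h+3$ and $G=U_{3,h}$;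 (iv) $F=2P_{2b_1+1}$ and $G\subseteq L_{t_1,t_2,h,h+1}$ for some $t_1,t_2\ge 0$ with $n=t_1h+t_2(h+1)+1$; (v) $F=2P_{2b_1+1}$, $h\ge2$ and $G\subseteq F_{t_1,t_2,h,h+1}$ for some $t_1,t_2\ge 0$ with $n=t_1h+(t_2+1)(h+1)+1$; (vi) $F=2P_{2b_1+1}$, $h\ge2$ and $G\subseteq T_{t_1,t_2,h,h+1}$ for some $t_1,t_2\ge 0$ with $n=t_1h+(t_2+2)(h+1)+1$. (b) If $k\ge 1$ and $\delta(G)\ge h\ge 2$, then $F\subseteq G$ unless $F=P_2\cup 2P_{2b_1+1}$ and $G=L_{t,h}$ for some $t$ with $n=th+1$. -/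

import Mathlib

open SimpleGraph

/-- The disjoint union of a family of graphs. -/
def disjUnion {ι : Type*} {V : ι → Type*} (G : ∀ i, SimpleGraph (V i)) :
    SimpleGraph (Σ i, V i) where
  Adj x y := ∃ (i : ι) (u v : V i), x = ⟨i, u⟩ ∧ y = ⟨i, v⟩ ∧ (G i).Adj u v
  symm := ⟨by
    rintro _ _ ⟨i, u, v, rfl, rfl, h⟩
    exact ⟨i, v, u, rfl, rfl, h.symm⟩⟩
  loopless := ⟨by
    rintro _ ⟨i, u, v, rfl, h, huv⟩
    obtain rfl : u = v := by simpa using h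
    exact huv.ne rfl⟩

/-- `m` disjoint copies of `G`. -/
def copies (m : ℕ) {V : Type*} (G : SimpleGraph V) : SimpleGraph (Σ _ : Fin m, V) :=
  disjUnion fun _ => G

/-- The join of `G` and `H`: the disjoint union together with all edges between them. -/
def joinGraph {V W : Type*} (G : SimpleGraph V) (H : SimpleGraph W) : SimpleGraph (V ⊕ W) :=
  (G ⊕g H) ⊔ completeBipartiteGraph V W

/-- The graph obtained from disjoint `G` and `H` by identifying `u ∈ V(G)` with `v ∈ V(H)`
(the identified vertex is called `Sum.inl u`). -/
def identify {V W : Type*} (G : SimpleGraph V) (u : V) (H : SimpleGraph W) (v : W) :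
    SimpleGraph (V ⊕ {w : W // w ≠ v}) where
  Adj
    | .inl x, .inl y => G.Adj x y
    | .inr p, .inr q => H.Adj p q
    | .inl x, .inr q => x = u ∧ H.Adj v q
    | .inr p, .inl y => y = u ∧ H.Adj v p
  symm := ⟨by
    rintro (x | p) (y | q) h
    · exact G.adj_symm h
    · exact h
    · exact h
    · exact H.adj_symm h⟩
  loopless := ⟨by
    rintro (x | p) h
    · exact G.loopless.irrefl x h
    · exact H.loopless.irrefl p.1 h⟩

/-- A cut vertex: a vertex whose removal increases the number of components. -/
def IsCutVertex {V : Type*} (G : SimpleGraph V) (v : V) : Prop :=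
  Nat.card G.ConnectedComponent < Nat.card (G.induce ({v}ᶜ : Set V)).ConnectedComponent

/-- The linear forest `(⋃ᵢ P_{2aᵢ}) ∪ P_{2b₁+1} ∪ P_{2b₂+1}` (`P_m` has `m` vertices). -/
def linForest {k : ℕ} (a : Fin k → ℕ) (b₁ b₂ : ℕ) :
    SimpleGraph ((Σ i : Fin k, Fin (2 * a i)) ⊕ (Fin (2 * b₁ + 1) ⊕ Fin (2 * b₂ + 1))) :=
  disjUnion (fun i => pathGraph (2 * a i)) ⊕g (pathGraph (2 * b₁ + 1) ⊕g pathGraph (2 * b₂ + 1))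

/-- `S_{n,h} = K_h ∨ (complement of K_{n-h})`, for `h ≤ n`. -/
def graphS (n h : ℕ) : SimpleGraph (Fin h ⊕ Fin (n - h)) :=
  joinGraph ⊤ ⊥

/-- `L_{t₁,t₂,h,h+1} = K_1 ∨ (t₁ K_h ∪ t₂ K_{h+1})`. -/
def graphL2 (t₁ t₂ h : ℕ) :
    SimpleGraph (Fin 1 ⊕ ((Σ _ : Fin t₁, Fin h) ⊕ (Σ _ : Fin t₂, Fin (h + 1)))) :=
  joinGraph ⊤ (copies t₁ ⊤ ⊕g copies t₂ ⊤)

/-- `L_{t,h} = L_{t,0,h,h+1}`. -/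
abbrev graphL (t h : ℕ) := graphL2 t 0 h

/-- `H_n^1`, of order `n ≥ 6`: a vertex of maximum degree of `S_{n-2,2}` is identified with a
vertex of `K_3`. -/
def graphH1 (n : ℕ) : SimpleGraph ((Fin 2 ⊕ Fin (n - 2 - 2)) ⊕ {w : Fin 3 // w ≠ 0}) :=
  identify (graphS (n - 2) 2) (.inl 0) ⊤ 0

/-- `H_n^2`, of order `n ≥ 8`: the other vertex of the `K_2` of `S_{n-4,2}`, which has the second
largest degree in `H_{n-2}^1`, is identified with a vertex of a further `K_3`. -/
def graphH2 (n : ℕ) : SimpleGraph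
    (((Fin 2 ⊕ Fin (n - 2 - 2 - 2)) ⊕ {w : Fin 3 // w ≠ 0}) ⊕ {w : Fin 3 // w ≠ 0}) :=
  identify (graphH1 (n - 2)) (.inl (.inl 1)) ⊤ 0

/-- `U_{3,h}`: three disjoint copies of `K_{h+1}`, each vertex of a triangle being identified with
one vertex (the one numbered `0`) of one copy. -/
def graphU3 (h : ℕ) : SimpleGraph (Fin 3 × Fin (h + 1)) where
  Adj x y := x ≠ y ∧ (x.1 = y.1 ∨ (x.2 = 0 ∧ y.2 = 0))
  symm := ⟨by
    rintro x y ⟨h, h'⟩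
    exact ⟨h.symm, h'.imp Eq.symm And.symm⟩⟩
  loopless := ⟨fun _ h => h.1 rfl⟩

/-- `F_{t₁,t₂,h,h+1}`: `L_{t₁,t₂,h,h+1}` and `K_{h+1}` with an edge from the center of the former
to a vertex of the latter. -/
def graphF (t₁ t₂ h : ℕ) :
    SimpleGraph ((Fin 1 ⊕ ((Σ _ : Fin t₁, Fin h) ⊕ (Σ _ : Fin t₂, Fin (h + 1)))) ⊕
      Fin (h + 1)) :=
  (graphL2 t₁ t₂ h ⊕g ⊤) ⊔ edge (.inl (.inl 0)) (.inr 0)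

/-- `T_{t₁,t₂,h,h+1}`: `L_{t₁,t₂,h,h+1}` and two copies of `K_{h+1}` with an edge from the center
of the former to a vertex of each of the latter. -/
def graphT (t₁ t₂ h : ℕ) :
    SimpleGraph ((Fin 1 ⊕ ((Σ _ : Fin t₁, Fin h) ⊕ (Σ _ : Fin t₂, Fin (h + 1)))) ⊕
      (Fin (h + 1) ⊕ Fin (h + 1))) :=
  (graphL2 t₁ t₂ h ⊕g (⊤ ⊕g ⊤)) ⊔
    (edge (.inl (.inl 0)) (.inr (.inl 0)) ⊔ edge (.inl (.inl 0)) (.inr (.inr 0)))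

/-! A path on `2a` vertices can be cut off the beginning of a longer path, so all the even paths and
`P_{2b₁+1}` fit into a single path. It therefore suffices to find two disjoint paths with at least
`s₁ = 2(∑ aᵢ + b₁) + 1` and `s₂ = 2b₂ + 1` vertices. Here `s₁ + s₂ = 2h + 4`, so `s₂ ≤ h + 2`, and
`s₂` is odd. Both parts of the theorem are read off from `two_paths_or_exception`.

Call a component of `G - v` a lobe at `v`. A longest path from `v` into a lobe has all neighbours of
its last vertex on it. So it has at least `h` vertices besides `v`, and exactly `h` only if the lobe
together with `v` is a clique (`LongestRooted.isClique`). Two lobes joined through `v` thus give a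
path on `2h + 1` vertices, three short of what is needed.

If some vertex has three lobes (`three_lobes`), a path on `s₂` vertices inside one lobe is disjoint
from a path on `2h + 1 ≥ s₁` vertices through the other two. If no lobe has such a path, all lobes
are small and `G` is `L_{t,h}` or lies in some `L_{t₁,t₂,h,h+1}`.

Otherwise every cut vertex has exactly two lobes. Take a smallest lobe `C` of all, at `v` say, and
the other lobe `D` at `v`. If `D` contains no cut vertex, a rooted form of Dirac's theorem
(`LongestRooted.card_le`) says that a too short longest path from `v` would exhaust `D`, which is
too large for that. For `h ≤ 3` the length hypotheses of that lemma can fail, and separate lemmas on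
`D` produce the two paths or the graph with one triangle.

If `D` contains a cut vertex, there is a lobe `C₂` inside `D`, at some `u ≠ v`, without cut
vertices. A path from `C` through `v` and `u` into `C₂` has at least `2h + 2` vertices, and every
vertex between `v` and `u` lengthens it. Examining what is left of `G` (`two_lobes_of_two_centres`)
leaves only the triangle graphs and `U_{3,h}`. -/

namespace LinForest

/-! ### Paths as lists of vertices, and connected sets. -/

variable {V : Type*} {G : SimpleGraph V}

/-- The vertices of `l`, in this order, form a path of `G`. -/
def IsPathList (G : SimpleGraph V) (l : List V) : Prop := l.IsChain G.Adj ∧ l.Nodup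

/-- `G` has disjoint paths with at least `s` and at least `t` vertices. -/
def HasTwoPaths (G : SimpleGraph V) (s t : ℕ) : Prop :=
  ∃ l₁ l₂ : List V, IsPathList G l₁ ∧ IsPathList G l₂ ∧ l₁.Disjoint l₂ ∧
    s ≤ l₁.length ∧ t ≤ l₂.length

/-- The path `l` has all its vertices in `S` and leads from `x` to `y`. -/
def IsPathFromTo (G : SimpleGraph V) (S : Finset V) (x y : V) (l : List V) : Prop :=
  IsPathList G l ∧ l.head? = some x ∧ l.getLast? = some y ∧ ∀ z ∈ l, z ∈ S

/-- `S` induces a connected subgraph (or is empty). -/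
def ConnSet (G : SimpleGraph V) (S : Finset V) : Prop :=
  ∀ A ⊆ S, A.Nonempty → (∀ x ∈ A, ∀ y ∈ S, G.Adj x y → y ∈ A) → S ⊆ A

theorem isPathList_append {l₁ l₂ : List V} :
    IsPathList G (l₁ ++ l₂) ↔ IsPathList G l₁ ∧ IsPathList G l₂ ∧ l₁.Disjoint l₂ ∧
      ∀ x ∈ l₁.getLast?, ∀ y ∈ l₂.head?, G.Adj x y := by
  unfold IsPathList
  rw [List.isChain_append, List.nodup_append']
  tauto

theorem IsPathList.reverse {l : List V} (hl : IsPathList G l) : IsPathList G l.reverse := by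
  refine ⟨?_, List.nodup_reverse.2 hl.2⟩
  rw [List.isChain_reverse]
  exact hl.1.imp fun _ _ h => h.symm

theorem isPathList_singleton (x : V) : IsPathList G [x] := ⟨by simp, by simp⟩

theorem isPathList_cons {x : V} {l : List V} :
    IsPathList G (x :: l) ↔ x ∉ l ∧ IsPathList G l ∧ ∀ y ∈ l.head?, G.Adj x y := by
  unfold IsPathList
  rw [List.isChain_cons, List.nodup_cons]
  tauto

theorem IsPathList.take {l : List V} (hl : IsPathList G l) (n : ℕ) : IsPathList G (l.take n) :=
  ⟨hl.1.take n, hl.2.sublist (List.take_sublist _ _)⟩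

theorem IsPathList.drop {l : List V} (hl : IsPathList G l) (n : ℕ) : IsPathList G (l.drop n) :=
  ⟨hl.1.drop n, hl.2.sublist (List.drop_sublist _ _)⟩

theorem IsPathList.tail {x : V} {l : List V} (hl : IsPathList G (x :: l)) : IsPathList G l :=
  (isPathList_cons.1 hl).2.1

theorem HasTwoPaths.of_isPathList {l : List V} (hl : IsPathList G l) {s t : ℕ}
    (hst : s + t ≤ l.length) : HasTwoPaths G s t := by
  refine ⟨l.take s, l.drop s, hl.take s, hl.drop s, List.disjoint_take_drop hl.2 le_rfl, ?_, ?_⟩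
  · simp; omega
  · simp; omega

theorem IsPathFromTo.mono {S T : Finset V} (hST : S ⊆ T) {x y : V} {l : List V}
    (hl : IsPathFromTo G S x y l) : IsPathFromTo G T x y l :=
  ⟨hl.1, hl.2.1, hl.2.2.1, fun z hz => hST (hl.2.2.2 z hz)⟩

theorem IsPathFromTo.two_le_length {S : Finset V} {x y : V} {l : List V}
    (hl : IsPathFromTo G S x y l) (hxy : x ≠ y) : 2 ≤ l.length := by
  obtain ⟨-, h₁, h₂, -⟩ := hl
  rcases l with _ | ⟨a, _ | ⟨b, l⟩⟩
  · simp at h₁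
  · simp at h₁ h₂
    exact absurd (h₁.symm.trans h₂) hxy
  · simp

theorem IsPathFromTo.append {S T : Finset V} {x y z w : V} {l l' : List V}
    (hl : IsPathFromTo G S x y l) (hl' : IsPathFromTo G T z w l') (hST : Disjoint S T)
    (hyz : G.Adj y z) [DecidableEq V] : IsPathFromTo G (S ∪ T) x w (l ++ l') := by
  refine ⟨isPathList_append.2 ⟨hl.1, hl'.1, ?_, ?_⟩, ?_, ?_, ?_⟩
  · intro a ha hb
    exact Finset.disjoint_left.1 hST (hl.2.2.2 a ha) (hl'.2.2.2 a hb)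
  · simp [hl.2.2.1, hl'.2.1, hyz]
  · simp [List.head?_append, hl.2.1]
  · simp [List.getLast?_append, hl'.2.2.1]
  · intro a ha
    rcases List.mem_append.1 ha with h | h
    · exact Finset.mem_union_left _ (hl.2.2.2 a h)
    · exact Finset.mem_union_right _ (hl'.2.2.2 a h)

theorem isPathFromTo_singleton {S : Finset V} {x : V} (hx : x ∈ S) : IsPathFromTo G S x x [x] :=
  ⟨isPathList_singleton x, by simp, by simp, by simpa using hx⟩

/-- If `z` is already on the path, the path is cut off at `z`; otherwise `z` is appended. -/
theorem exists_isPathFromTo_step {S : Finset V} {x y z : V} {l : List V}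
    (hl : IsPathFromTo G S x y l) (hyz : G.Adj y z) (hz : z ∈ S) :
    ∃ l', IsPathFromTo G S x z l' := by
  by_cases h : z ∈ l
  · obtain ⟨A, B, rfl⟩ := List.append_of_mem h
    refine ⟨A ++ [z], ?_, ?_, by simp, ?_⟩
    · have := hl.1
      rw [← List.singleton_append, ← List.append_assoc] at this
      exact (isPathList_append.1 this).1
    · have := hl.2.1
      rw [List.head?_append] at this ⊢
      simpa using this
    · intro a ha
      apply hl.2.2.2
      simp at ha ⊢
      tauto
  · refine ⟨l ++ [z], isPathList_append.2 ⟨hl.1, isPathList_singleton z, ?_, ?_⟩, ?_, by simp, ?_⟩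
    · simpa using h
    · simp [hl.2.2.1, hyz]
    · simp [List.head?_append, hl.2.1]
    · intro a ha
      rcases List.mem_append.1 ha with h | h
      · exact hl.2.2.2 a h
      · simp at h; rwa [h]

theorem ConnSet.exists_isPathFromTo {S : Finset V} (hS : ConnSet G S) {x y : V} (hx : x ∈ S)
    (hy : y ∈ S) : ∃ l, IsPathFromTo G S x y l := by
  classical
  have := hS (S.filter fun z => ∃ l, IsPathFromTo G S x z l) (Finset.filter_subset _ _)
    ⟨x, by simp only [Finset.mem_filter]; exact ⟨hx, _, isPathFromTo_singleton hx⟩⟩ (by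
      intro a ha b hb hab
      simp only [Finset.mem_filter] at ha ⊢
      obtain ⟨-, l, hl⟩ := ha
      exact ⟨hb, exists_isPathFromTo_step hl hab hb⟩) hy
  simpa [hy] using this

/-- A smallest set that contains `x` and is closed under adjacency within `S` is connected: a closed
nonempty part of it that misses `x` could be removed, leaving a smaller such set. -/
theorem exists_component {S : Finset V} {x : V} (hx : x ∈ S) :
    ∃ K ⊆ S, x ∈ K ∧ ConnSet G K ∧ ∀ y ∈ K, ∀ z ∈ S, G.Adj y z → z ∈ K := by
  classical
  obtain ⟨K, hK, hmin⟩ := Finset.exists_min_image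
    (S.powerset.filter fun K => x ∈ K ∧ ∀ y ∈ K, ∀ z ∈ S, G.Adj y z → z ∈ K) Finset.card
    ⟨S, by simp [hx]; tauto⟩
  simp only [Finset.mem_filter, Finset.mem_powerset] at hK hmin
  obtain ⟨hKS, hxK, hcl⟩ := hK
  refine ⟨K, hKS, hxK, ?_, hcl⟩
  intro A hA hne hAcl
  by_cases hxA : x ∈ A
  · have := hmin A ⟨hA.trans hKS, hxA, fun y hy z hz hyz => hAcl y hy z (hcl y (hA hy) z hz hyz) hyz⟩
    rw [Finset.eq_of_subset_of_card_le hA this]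
  · exfalso
    have := hmin (K \ A) ⟨Finset.sdiff_subset.trans hKS, by simp [hxK, hxA], fun y hy z hz hyz => by
      simp only [Finset.mem_sdiff] at hy ⊢
      exact ⟨hcl y hy.1 z hz hyz, fun hzA => hy.2 (hAcl z hzA y hy.1 hyz.symm)⟩⟩
    obtain ⟨a, ha⟩ := hne
    have h2 : (K \ A).card < K.card :=
      Finset.card_lt_card ⟨Finset.sdiff_subset, fun h => by
        have := h (hA ha); simp [ha] at this⟩
    omega

/-! ### Components of `G - v` and cut vertices. -/

/-- `C` is the vertex set of a component of `G - v`. -/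
structure IsLobe (G : SimpleGraph V) (v : V) (C : Finset V) : Prop where
  notMem : v ∉ C
  nonempty : C.Nonempty
  closed : ∀ x ∈ C, ∀ y, G.Adj x y → y = v ∨ y ∈ C
  conn : ConnSet G C

/-- `G - u` is connected. -/
def NotCut (G : SimpleGraph V) (u : V) : Prop :=
  ∀ A : Finset V, A.Nonempty → u ∉ A → (∀ x ∈ A, ∀ y, G.Adj x y → y = u ∨ y ∈ A) →
    ∀ z, z ≠ u → z ∈ A

/-- The graph obtained by removing any vertex has at most two components. -/
def AtMostTwoLobes (G : SimpleGraph V) : Prop :=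
  ∀ v C C', IsLobe G v C → IsLobe G v C' → C ≠ C' → ∀ x, x = v ∨ x ∈ C ∨ x ∈ C'

/-- Every vertex of `C` has degree at least `h` in `G`. -/
def MinDegOn (G : SimpleGraph V) (C : Finset V) (h : ℕ) : Prop :=
  ∀ x ∈ C, ∀ S : Finset V, (∀ y, G.Adj x y → y ∈ S) → h ≤ S.card

/-- Every vertex has degree at least `h`. -/
def MinDegGE (G : SimpleGraph V) (h : ℕ) : Prop :=
  ∀ x (S : Finset V), (∀ y, G.Adj x y → y ∈ S) → h ≤ S.card

theorem MinDegGE.on {h : ℕ} (hdeg : MinDegGE G h) (C : Finset V) : MinDegOn G C h :=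
  fun x _ => hdeg x

theorem IsLobe.eq_of_mem {v : V} {C C' : Finset V} (hC : IsLobe G v C) (hC' : IsLobe G v C')
    {x : V} (hx : x ∈ C) (hx' : x ∈ C') : C = C' := by
  classical
  have key : ∀ {C C' : Finset V}, IsLobe G v C → IsLobe G v C' → x ∈ C → x ∈ C' → C ⊆ C' := by
    intro C C' hC hC' hx hx'
    have := hC.conn (C ∩ C') Finset.inter_subset_left ⟨x, by simp [hx, hx']⟩ (by
      intro a ha b hb hab
      simp only [Finset.mem_inter] at ha ⊢
      rcases hC'.closed a ha.2 b hab with rfl | h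
      · exact absurd hb hC.notMem
      · exact ⟨hb, h⟩)
    exact this.trans Finset.inter_subset_right
  exact Finset.Subset.antisymm (key hC hC' hx hx') (key hC' hC hx' hx)

theorem IsLobe.disjoint {v : V} {C C' : Finset V} (hC : IsLobe G v C) (hC' : IsLobe G v C')
    (hne : C ≠ C') : Disjoint C C' :=
  Finset.disjoint_left.2 fun _ h h' => hne (hC.eq_of_mem hC' h h')

/-- A connected set that avoids `v` and meets a component of `G - v` lies in it. -/
theorem IsLobe.subset_of_connSet {v : V} {C K : Finset V} (hC : IsLobe G v C) (hK : ConnSet G K)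
    (hv : v ∉ K) {x : V} (hx : x ∈ C) (hxK : x ∈ K) : K ⊆ C := by
  classical
  refine (hK (K ∩ C) Finset.inter_subset_left ⟨x, by simp [hx, hxK]⟩ ?_).trans
    Finset.inter_subset_right
  intro a ha b hb hab
  simp only [Finset.mem_inter] at ha ⊢
  rcases hC.closed a ha.2 b hab with rfl | h
  · exact absurd hb hv
  · exact ⟨hb, h⟩

section Fintype
variable [Fintype V]

theorem exists_isLobe {v x : V} (hx : x ≠ v) : ∃ C, IsLobe G v C ∧ x ∈ C := by
  classical
  obtain ⟨K, hK, hxK, hconn, hcl⟩ := exists_component (G := G) (S := Finset.univ.erase v) (x := x)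
    (by simp [hx])
  refine ⟨K, ⟨fun h => by simpa using hK h, ⟨x, hxK⟩, ?_, hconn⟩, hxK⟩
  intro a ha b hab
  by_cases hb : b = v
  · exact Or.inl hb
  · exact Or.inr (hcl a ha b (by simp [hb]) hab)

/-- In a connected graph, every component of `G - v` is joined to `v`. -/
theorem IsLobe.exists_adj (hG : ConnSet G Finset.univ) {v : V} {C : Finset V} (hC : IsLobe G v C) :
    ∃ x ∈ C, G.Adj v x := by
  by_contra! hcon
  refine hC.notMem (hG C (Finset.subset_univ _) hC.nonempty ?_ (Finset.mem_univ v))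
  intro a ha b _ hab
  rcases hC.closed a ha b hab with rfl | h
  · exact absurd hab.symm (hcon a ha)
  · exact h

/-- If `A` is closed in `G - u` and misses `z ≠ u`, a lobe that meets `A` stays inside `A` and so
differs from the lobe of `z`. -/
theorem not_notCut_iff {u : V} : ¬ NotCut G u ↔ ∃ C C', IsLobe G u C ∧ IsLobe G u C' ∧ C ≠ C' := by
  classical
  constructor
  · intro h
    simp only [NotCut, not_forall] at h
    obtain ⟨A, ⟨x, hx⟩, huA, hcl, z, hzu, hzA⟩ := h
    obtain ⟨C, hC, hxC⟩ := exists_isLobe (G := G) (v := u) (x := x) (by rintro rfl; exact huA hx)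
    obtain ⟨C', hC', hzC'⟩ := exists_isLobe (G := G) (v := u) (x := z) hzu
    refine ⟨C, C', hC, hC', ?_⟩
    rintro rfl
    have := hC.conn (C ∩ A) Finset.inter_subset_left ⟨x, by simp [hxC, hx]⟩ (by
      intro a ha b hb hab
      simp only [Finset.mem_inter] at ha ⊢
      rcases hcl a ha.2 b hab with rfl | h
      · exact absurd hb hC.notMem
      · exact ⟨hb, h⟩) hzC'
    simp [hzA] at this
  · rintro ⟨C, C', hC, hC', hne⟩ hcut
    obtain ⟨z, hz⟩ := hC'.nonempty
    have := hcut C hC.nonempty hC.notMem hC.closed z (by rintro rfl; exact hC'.notMem hz)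
    exact Finset.disjoint_left.1 (hC.disjoint hC' hne) this hz

theorem IsLobe.ssubset_of_mem (hG : ConnSet G Finset.univ) {u z : V} {C C' : Finset V}
    (hC : IsLobe G u C) (hz : z ∈ C)
    (hC' : IsLobe G z C') (hu : u ∉ C') : C' ⊂ C := by
  obtain ⟨x, hx, hzx⟩ := hC'.exists_adj hG
  have hxC : x ∈ C := by
    rcases hC.closed z hz x hzx with rfl | h
    · exact absurd hx hu
    · exact h
  exact ⟨hC.subset_of_connSet hC'.conn hu hxC hx, fun h => hC'.notMem (h hz)⟩

/-- Inside a component `C` of `G - u` there is one, `C'` of `G - u'`, that contains no cut vertex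
of `G`. -/
theorem IsLobe.exists_end (hG : ConnSet G Finset.univ) {u : V} {C : Finset V} (hC : IsLobe G u C) :
    ∃ u' C', IsLobe G u' C' ∧ C' ⊆ C ∧ (u' = u ∨ u' ∈ C) ∧ ∀ z ∈ C', NotCut G z := by
  induction hn : C.card using Nat.strong_induction_on generalizing u C with
  | _ n ih =>
    subst hn
    by_cases hall : ∀ z ∈ C, NotCut G z
    · exact ⟨u, C, hC, subset_rfl, Or.inl rfl, hall⟩
    · push Not at hall
      obtain ⟨z, hz, hcut⟩ := hall
      obtain ⟨C₁, C₂, h₁, h₂, hne⟩ := not_notCut_iff.1 hcut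
      -- Of the lobes at a cut vertex `z` inside `C`, one misses `u`. It lies strictly inside `C`,
      -- so the descent terminates.
      have : ∃ C', IsLobe G z C' ∧ u ∉ C' := by
        by_cases h : u ∈ C₁
        · exact ⟨C₂, h₂, Finset.disjoint_left.1 (h₁.disjoint h₂ hne) h⟩
        · exact ⟨C₁, h₁, h⟩
      obtain ⟨C', hC', huC'⟩ := this
      have hss := hC.ssubset_of_mem hG hz hC' huC'
      obtain ⟨u', C'', ha, hb, hc, hd⟩ := ih _ (Finset.card_lt_card hss) hC' rfl
      refine ⟨u', C'', ha, hb.trans hss.1, ?_, hd⟩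
      rcases hc with rfl | hc
      · exact Or.inr hz
      · exact Or.inr (hss.1 hc)

end Fintype

/-! ### Longest paths from a vertex into a lobe. -/

/-- `v :: l` is a path whose vertices other than `v` lie in `C`. -/
def RootedPath (G : SimpleGraph V) (v : V) (C : Finset V) (l : List V) : Prop :=
  IsPathList G (v :: l) ∧ ∀ x ∈ l, x ∈ C

def LongestRooted (G : SimpleGraph V) (v : V) (C : Finset V) (l : List V) : Prop :=
  RootedPath G v C l ∧ ∀ l', RootedPath G v C l' → l'.length ≤ l.length

theorem RootedPath.length_le {v : V} {C : Finset V} {l : List V} (hl : RootedPath G v C l) :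
    l.length ≤ C.card := by
  classical
  rw [← List.toFinset_card_of_nodup hl.1.tail.2]
  exact Finset.card_le_card fun x hx => hl.2 x (by simpa using hx)

theorem exists_longestRooted (G : SimpleGraph V) (v : V) (C : Finset V) :
    ∃ l, LongestRooted G v C l := by
  have h0 : RootedPath G v C [] := ⟨isPathList_singleton v, by simp⟩
  obtain ⟨m, ⟨l, hl, hlm⟩, hmax⟩ : ∃ m, (∃ l, RootedPath G v C l ∧ l.length = m) ∧
      ∀ l', RootedPath G v C l' → l'.length ≤ m := by
    have hb : BddAbove {m | ∃ l, RootedPath G v C l ∧ l.length = m} :=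
      ⟨C.card, by rintro _ ⟨l, hl, rfl⟩; exact hl.length_le⟩
    have hne : {m | ∃ l, RootedPath G v C l ∧ l.length = m}.Nonempty := ⟨0, [], h0, rfl⟩
    have hmem := Nat.sSup_mem hne hb
    exact ⟨_, hmem, fun l' hl' => le_csSup hb ⟨l', hl', rfl⟩⟩
  exact ⟨l, hl, by rw [hlm]; exact hmax⟩

/-- The path can be left at position `i` and continued along `Q`. Position `0` is `v`, so `i`
vertices of `l` are kept, and maximality bounds `i + Q.length`. -/
theorem LongestRooted.splice_end {v : V} {C : Finset V} {l Q : List V}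
    (hl : LongestRooted G v C l) (hvC : v ∉ C) (hQ : IsPathList G Q) (hQC : ∀ x ∈ Q, x ∈ C)
    (hd : Q.Disjoint l) {a : V} (ha : Q.head? = some a) {i : ℕ} (hi : i < (v :: l).length)
    (hia : G.Adj ((v :: l)[i]) a) : i + Q.length ≤ l.length := by
  have hp : IsPathList G ((v :: l).take (i + 1) ++ Q) := by
    refine isPathList_append.2 ⟨hl.1.1.take _, hQ, ?_, ?_⟩
    · intro x hx hxQ
      rcases List.mem_cons.1 (List.mem_of_mem_take hx) with rfl | h
      · exact hvC (hQC _ hxQ)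
      · exact hd hxQ h
    · intro x hx y hy
      rw [ha] at hy
      rw [List.getLast?_take] at hx
      simp only [Nat.add_eq_zero_iff, one_ne_zero, and_false, if_false, Nat.add_sub_cancel] at hx
      rw [List.getElem?_eq_getElem hi] at hx
      simp at hx hy
      rw [← hx, ← hy]; exact hia
  have := hl.2 (l.take i ++ Q) ⟨by simpa using hp, by
    intro x hx
    rcases List.mem_append.1 hx with h | h
    · exact hl.1.2 x (List.mem_of_mem_take h)
    · exact hQC x h⟩
  simp at this hi
  omega

/-- Replacing the `j - i - 1` vertices strictly between positions `i` and `j` by `Q` must not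
lengthen the path. -/
theorem LongestRooted.splice {v : V} {C : Finset V} {l Q : List V}
    (hl : LongestRooted G v C l) (hvC : v ∉ C) (hQ : IsPathList G Q) (hQC : ∀ x ∈ Q, x ∈ C)
    (hd : Q.Disjoint l) {a b : V} (ha : Q.head? = some a) (hb : Q.getLast? = some b)
    {i j : ℕ} (hij : i < j) (hj : j < (v :: l).length)
    (hia : G.Adj ((v :: l)[i]) a) (hjb : G.Adj ((v :: l)[j]) b) : i + 1 + Q.length ≤ j := by
  have hi : i < (v :: l).length := by omega
  have hp : IsPathList G ((v :: l).take (i + 1) ++ (Q ++ (v :: l).drop j)) := by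
    refine isPathList_append.2 ⟨hl.1.1.take _, isPathList_append.2 ⟨hQ, hl.1.1.drop _, ?_, ?_⟩,
      ?_, ?_⟩
    · intro x hxQ hx
      rcases List.mem_cons.1 (List.mem_of_mem_drop hx) with rfl | h
      · exact hvC (hQC _ hxQ)
      · exact hd hxQ h
    · intro x hx y hy
      rw [hb] at hx
      rw [List.head?_drop, List.getElem?_eq_getElem hj] at hy
      simp only [Option.mem_def, Option.some.injEq] at hx hy
      rw [← hx, ← hy]; exact hjb.symm
    · intro x hx hx'
      rcases List.mem_append.1 hx' with hxQ | hxd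
      · rcases List.mem_cons.1 (List.mem_of_mem_take hx) with rfl | h
        · exact hvC (hQC _ hxQ)
        · exact hd hxQ h
      · exact List.disjoint_take_drop hl.1.1.2 (by omega : i + 1 ≤ j) hx hxd
    · intro x hx y hy
      rw [List.head?_append, ha] at hy
      rw [List.getLast?_take] at hx
      simp only [Nat.add_eq_zero_iff, one_ne_zero, and_false, if_false, Nat.add_sub_cancel] at hx
      rw [List.getElem?_eq_getElem hi] at hx
      simp at hx hy
      rw [← hx, ← hy]; exact hia
  obtain ⟨j, rfl⟩ : ∃ k, j = k + 1 := ⟨j - 1, by omega⟩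
  have := hl.2 (l.take i ++ (Q ++ l.drop j)) ⟨by simpa using hp, by
    intro x hx
    rcases List.mem_append.1 hx with h | h
    · exact hl.1.2 x (List.mem_of_mem_take h)
    · rcases List.mem_append.1 h with h | h
      · exact hQC x h
      · exact hl.1.2 x (List.mem_of_mem_drop h)⟩
  simp at this hi hj
  omega

/-- The neighbours of the last vertex of a longest path from `v` lie on it. -/
theorem LongestRooted.mem_of_adj_getLast {v : V} {C : Finset V} {l : List V}
    (hC : IsLobe G v C) (hl : LongestRooted G v C l) {q y : V} (hq : l.getLast? = some q)
    (hqy : G.Adj q y) : y ∈ v :: l := by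
  by_contra hy
  simp only [List.mem_cons, not_or] at hy
  have hql : q ∈ l := List.mem_of_getLast? hq
  have hlen : 0 < l.length := List.length_pos_of_mem hql
  have hyC : y ∈ C := (hC.closed q (hl.1.2 q hql) y hqy).resolve_left hy.1
  have hlast : (v :: l)[l.length] = q := by
    rw [List.getLast?_eq_getElem?] at hq
    obtain ⟨m, hm⟩ : ∃ m, l.length = m + 1 := ⟨l.length - 1, by omega⟩
    simp only [hm, List.getElem_cons_succ]
    rw [hm, Nat.add_sub_cancel, List.getElem?_eq_getElem (by omega)] at hq
    simpa using hq
  have := hl.splice_end hC.notMem (isPathList_singleton y) (by simpa using hyC)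
    (by simpa using hy.2) (a := y) (by simp) (i := l.length) (by simp) (by rw [hlast]; exact hqy)
  simp at this

section Fintype
variable [Fintype V]

theorem LongestRooted.ne_nil (hG : ConnSet G Finset.univ) {v : V} {C : Finset V} {l : List V}
    (hC : IsLobe G v C) (hl : LongestRooted G v C l) : l ≠ [] := by
  rintro rfl
  obtain ⟨x, hx, hvx⟩ := hC.exists_adj hG
  have := hl.2 [x] ⟨isPathList_cons.2 ⟨by simp; rintro rfl; exact hC.notMem hx,
    isPathList_singleton x, by simpa using hvx⟩, by simpa using hx⟩
  simp at this

/-- All neighbours of the last vertex are among the other vertices of `v :: l`, and there are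
`l.length` of these. -/
theorem LongestRooted.le_length (hG : ConnSet G Finset.univ) {h : ℕ}
    {v : V} {C : Finset V} (hdeg : MinDegOn G C h) {l : List V}
    (hC : IsLobe G v C) (hl : LongestRooted G v C l) : h ≤ l.length := by
  classical
  obtain ⟨q, hq⟩ : ∃ q, l.getLast? = some q := by
    rcases hq : l.getLast? with _ | q
    · exact absurd (List.getLast?_eq_none_iff.1 hq) (hl.ne_nil hG hC)
    · exact ⟨q, rfl⟩
  have hql : q ∈ l := List.mem_of_getLast? hq
  have := hdeg q (hl.1.2 q hql) ((v :: l).toFinset.erase q) (fun y hy => by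
    have := hl.mem_of_adj_getLast hC hq hy
    rw [Finset.mem_erase, List.mem_toFinset]
    exact ⟨hy.ne', this⟩)
  rw [Finset.card_erase_of_mem (by simp [hql]), List.toFinset_card_of_nodup hl.1.1.2] at this
  simpa using this

/-- If every path from `v` into `C` has at most `h` further vertices, then `C ∪ {v}` is a clique
on `h + 1` vertices. -/
theorem LongestRooted.isClique (hG : ConnSet G Finset.univ) {h : ℕ}
    {v : V} {C : Finset V} (hdeg : MinDegOn G C h) {l : List V}
    (hC : IsLobe G v C) (hl : LongestRooted G v C l) (hh : l.length ≤ h) :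
    C.card = h ∧ ∀ x ∈ C, ∀ y, y = v ∨ y ∈ C → x ≠ y → G.Adj x y := by
  classical
  have hlen : l.length = h := le_antisymm hh (hl.le_length hG hdeg hC)
  -- The last vertex of any longest path on this vertex set has only `h` possible neighbours, so it
  -- is adjacent to all of them. It remains to see that every vertex of `l` is the last vertex of
  -- such a path.
  have hends : ∀ l', LongestRooted G v C l' → l'.toFinset = l.toFinset → ∀ q,
      l'.getLast? = some q → ∀ y, q ≠ y → (G.Adj q y ↔ y ∈ v :: l) := by
    intro l' hl' hll q hq y hqy
    have hiff : ∀ y, y ∈ v :: l' ↔ y ∈ v :: l := by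
      intro y
      have := congrArg (y ∈ ·) hll
      simp only [List.mem_toFinset] at this
      simp only [List.mem_cons, this]
    have hsub : ∀ y, G.Adj q y → y ∈ v :: l := fun y hy =>
      (hiff y).1 (hl'.mem_of_adj_getLast hC hq hy)
    refine ⟨hsub y, fun hy => ?_⟩
    by_contra hnot
    have := hdeg q (hl'.1.2 q (List.mem_of_getLast? hq)) (((v :: l).toFinset.erase q).erase y) (fun z hz => by
      rw [Finset.mem_erase, Finset.mem_erase, List.mem_toFinset]
      exact ⟨by rintro rfl; exact hnot hz, hz.ne', hsub z hz⟩)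
    have hql : q ∈ (v :: l).toFinset := by
      rw [List.mem_toFinset, ← hiff]; exact List.mem_cons_of_mem _ (List.mem_of_getLast? hq)
    rw [Finset.card_erase_of_mem (by rw [Finset.mem_erase, List.mem_toFinset]; exact ⟨hqy.symm, hy⟩),
      Finset.card_erase_of_mem hql, List.toFinset_card_of_nodup hl.1.1.2] at this
    have h0 := List.length_pos_of_ne_nil (hl.ne_nil hG hC)
    simp at this
    omega
  obtain ⟨q, hq⟩ : ∃ q, l.getLast? = some q := by
    rcases hq : l.getLast? with _ | q
    · exact absurd (List.getLast?_eq_none_iff.1 hq) (hl.ne_nil hG hC)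
    · exact ⟨q, rfl⟩
  have hall : ∀ z ∈ l, ∀ y, z ≠ y → (G.Adj z y ↔ y ∈ v :: l) := by
    intro z hz
    by_cases hzq : z = q
    · subst hzq; exact hends l hl rfl z hq
    obtain ⟨A, B, rfl⟩ := List.append_of_mem hz
    have hBne : B ≠ [] := by
      rintro rfl
      simp at hq
      exact hzq hq
    have hBq : B.getLast? = some q := by
      rw [List.getLast?_append, List.getLast?_cons_of_ne_nil hBne] at hq
      rcases hb : B.getLast? with _ | b
      · exact absurd (List.getLast?_eq_none_iff.1 hb) hBne
      · rw [hb] at hq; simpa using hq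
    -- Reversing the part from `z` on makes `z` the last vertex. The new edge exists because `q` is
    -- adjacent to everything on the path, in particular to the predecessor of `z`.
    refine hends (A ++ (z :: B).reverse) ⟨⟨?_, ?_⟩, ?_⟩ ?_ z ?_
    · have hp := hl.1.1
      rw [← List.cons_append] at hp ⊢
      obtain ⟨h1, h2, h3, h4⟩ := isPathList_append.1 hp
      refine isPathList_append.2 ⟨h1, h2.reverse, ?_, ?_⟩
      · intro x hx hx'
        exact h3 hx (by simpa [or_comm] using hx')
      · intro x hx y hy
        have hyq : y = q := by
          simp [hBq] at hy
          exact hy.symm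
        subst hyq
        have hx' : x ∈ v :: (A ++ z :: B) := by
          have := List.mem_of_getLast? hx
          rw [← List.cons_append]
          exact List.mem_append_left _ this
        refine ((hends _ hl rfl y hq x ?_).2 hx').symm
        rintro rfl
        exact h3 (List.mem_of_getLast? hx) (List.mem_cons_of_mem _ (List.mem_of_getLast? hBq))
    · intro x hx
      apply hl.1.2
      simp at hx ⊢
      tauto
    · intro l' hl'
      have := hl.2 l' hl'
      simp at this ⊢
      omega
    · ext x; simp
    · simp
  have hCl : C = l.toFinset := by
    refine (hC.conn l.toFinset (fun x hx => hl.1.2 x (by simpa using hx)) ⟨q, ?_⟩ ?_).antisymm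
      (fun x hx => hl.1.2 x (by simpa using hx))
    · simpa using List.mem_of_getLast? hq
    · intro x hx y hy hxy
      have := (hall x (by simpa using hx) y hxy.ne).1 hxy
      rcases List.mem_cons.1 this with rfl | h
      · exact absurd hy hC.notMem
      · simpa using h
  refine ⟨by rw [hCl, List.toFinset_card_of_nodup hl.1.1.tail.2, hlen], ?_⟩
  intro x hx y hy hxy
  refine (hall x (by simpa [hCl] using hx) y hxy).2 ?_
  simpa [hCl] using hy

end Fintype

/-! ### A Dirac-type theorem for longest paths with a prescribed end. -/

/-- A finite set of naturals without consecutive elements, all of whose elements have distance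
more than `r` from `i`. -/
theorem card_spaced_le {J : Finset ℕ} {i r N : ℕ} (hr : 1 ≤ r) (hJ : J.Nonempty)
    (hJN : ∀ j ∈ J, j ≤ N) (hiN : i ≤ N) (hgap : ∀ j ∈ J, i + r < j ∨ j + r < i)
    (hsp : ∀ j ∈ J, j + 1 ∉ J) : 2 * J.card + r ≤ N + 1 := by
  -- `J`, its translate by one and an interval of `r + 1` numbers are disjoint in `{0, …, N + 1}`.
  -- The interval is `[i, i + r]` if `J` has an element beyond `i`, and `[i + 1 - r, i + 1]`
  -- otherwise.
  have hmain : ∀ s t : ℕ, t + 1 = s + (r + 1) → t ≤ N + 1 →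
      (∀ j ∈ J, (j < s ∨ t < j) ∧ (j + 1 < s ∨ t < j + 1)) → 2 * J.card + r ≤ N + 1 := by
    intro s t hst htN hd
    have h1 : Disjoint J (J.image (· + 1)) := by
      rw [Finset.disjoint_left]
      intro x hx hx'
      obtain ⟨y, hy, rfl⟩ := Finset.mem_image.1 hx'
      exact hsp y hy hx
    have h2 : Disjoint (J ∪ J.image (· + 1)) (Finset.Icc s t) := by
      rw [Finset.disjoint_left]
      intro x hx hx'
      rw [Finset.mem_Icc] at hx'
      rcases Finset.mem_union.1 hx with h | h
      · have := hd x h; omega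
      · obtain ⟨y, hy, rfl⟩ := Finset.mem_image.1 h
        have := hd y hy; omega
    have h3 : ((J ∪ J.image (· + 1)) ∪ Finset.Icc s t) ⊆ Finset.range (N + 2) := by
      intro x hx
      rw [Finset.mem_range]
      rcases Finset.mem_union.1 hx with h | h
      · rcases Finset.mem_union.1 h with h | h
        · have := hJN x h; omega
        · obtain ⟨y, hy, rfl⟩ := Finset.mem_image.1 h
          have := hJN y hy; omega
      · rw [Finset.mem_Icc] at h; omega
    have h4 := Finset.card_le_card h3
    rw [Finset.card_union_of_disjoint h2, Finset.card_union_of_disjoint h1,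
      Finset.card_image_of_injective _ (add_left_injective 1), Nat.card_Icc,
      Finset.card_range] at h4
    omega
  by_cases hex : ∃ j ∈ J, i + r < j
  · obtain ⟨j, hj, hij⟩ := hex
    have := hJN j hj
    refine hmain i (i + r) (by omega) (by omega) fun k hk => ?_
    have := hgap k hk
    omega
  · push Not at hex
    obtain ⟨j, hj⟩ := hJ
    have h1 := hgap j hj
    have h2 := hex j hj
    refine hmain (i + 1 - r) (i + 1) (by omega) (by omega) fun k hk => ?_
    have := hgap k hk
    have := hex k hk
    omega

theorem exists_getLast?_cons (x : V) (l : List V) : ∃ q, (x :: l).getLast? = some q ∧ q ∈ x :: l :=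
  ⟨(x :: l).getLast (by simp), by rw [List.getLast?_eq_getLast_of_ne_nil], List.getLast_mem _⟩

theorem LongestRooted.not_adj_of_notMem {w : V} {S : Finset V} {l : List V}
    (hl : LongestRooted G w S l) {q z : V} (hq : (w :: l).getLast? = some q) (hzS : z ∈ S)
    (hz : z ∉ w :: l) : ¬ G.Adj q z := by
  intro hqz
  have := hl.2 (l ++ [z]) ⟨by
    rw [← List.cons_append]
    refine isPathList_append.2 ⟨hl.1.1, isPathList_singleton z, by simpa using hz, ?_⟩
    rw [hq]
    simpa using hqz, by
    intro x hx
    rcases List.mem_append.1 hx with h | h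
    · exact hl.1.2 x h
    · simp at h; rwa [h]⟩
  simp at this

/-- Where the components of `C` minus a longest path from `v` can be attached to that path. -/
theorem LongestRooted.attach_le {h : ℕ}
    {v : V} {C K : Finset V} (hdeg : MinDegOn G C h) {l : List V} (hvC : v ∉ C) (hl : LongestRooted G v C l)
    (hKC : K ⊆ C) (hKl : ∀ x ∈ K, x ∉ l)
    (hKcl : ∀ x ∈ K, ∀ z, G.Adj x z → z ∈ K ∨ z ∈ v :: l)
    (hm : l.length + 2 ≤ 2 * h) {w : V} (hw : w ∈ K) {i : ℕ} (hi : i < (v :: l).length)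
    (hiw : G.Adj ((v :: l)[i]) w) : i + h ≤ l.length := by
  classical
  -- If a longest path `Q` in `K` from `w` has at least `h` vertices, `splice_end` gives the claim.
  -- If not, its other end `q` has fewer than `h` neighbours on `Q` and must have many on `v :: l`,
  -- at the positions `J`.
  obtain ⟨Q', hQ'⟩ := exists_longestRooted G w (K.erase w)
  obtain ⟨q, hq, hqQ⟩ := exists_getLast?_cons w Q'
  have hQK : ∀ x ∈ w :: Q', x ∈ K := by
    intro x hx
    rcases List.mem_cons.1 hx with rfl | h
    · exact hw
    · exact Finset.mem_of_mem_erase (hQ'.1.2 x h)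
  have hQp := hQ'.1.1
  set Q := w :: Q' with hQdef
  have hQC : ∀ x ∈ Q, x ∈ C := fun x hx => hKC (hQK x hx)
  have hd : Q.Disjoint l := fun x hx => hKl x (hQK x hx)
  have hQC' : ∀ x ∈ Q.reverse, x ∈ C := fun x hx => hQC x (by simpa using hx)
  have hd' : Q.reverse.Disjoint l := fun x hx => hKl x (hQK x (by simpa using hx))
  have hhead : Q.head? = some w := by simp [hQdef]
  have hhead' : Q.reverse.head? = some q := by simp [hq]
  have hlast' : Q.reverse.getLast? = some w := by simp [hhead]
  by_contra hcon
  have hir := hl.splice_end hvC hQp hQC hd hhead hi hiw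
  set J := (Finset.range (l.length + 1)).filter
    fun j => ∃ hj : j < (v :: l).length, G.Adj ((v :: l)[j]) q with hJ
  have hJmem : ∀ j ∈ J, ∃ hj : j < (v :: l).length, G.Adj ((v :: l)[j]) q := by
    intro j hj
    exact (Finset.mem_filter.1 hj).2
  have hJend : ∀ j ∈ J, j + Q.length ≤ l.length := by
    intro j hj
    obtain ⟨hj, hadj⟩ := hJmem j hj
    simpa using hl.splice_end hvC hQp.reverse hQC' hd' hhead' hj hadj
  have hcard := hdeg q (hQC q hqQ) (Q.toFinset.erase q ∪ J.image (fun j => (v :: l).getD j v)) (by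
    intro z hz
    rcases hKcl q (hQK q hqQ) z hz with hzK | hzl
    · refine Finset.mem_union_left _ (Finset.mem_erase.2 ⟨hz.ne', List.mem_toFinset.2 ?_⟩)
      by_contra hzQ
      refine hQ'.not_adj_of_notMem hq (Finset.mem_erase.2 ⟨?_, hzK⟩) hzQ hz
      rintro rfl
      exact hzQ (by simp [hQdef])
    · refine Finset.mem_union_right _ ?_
      obtain ⟨j, hj, rfl⟩ := List.mem_iff_getElem.1 hzl
      refine Finset.mem_image.2 ⟨j, Finset.mem_filter.2 ⟨?_, hj, hz.symm⟩, ?_⟩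
      · simpa using hj
      · simp [List.getElem?_eq_getElem hj])
  have hc1 := (hcard.trans (Finset.card_union_le _ _)).trans
    (Nat.add_le_add_left Finset.card_image_le _)
  rw [Finset.card_erase_of_mem (List.mem_toFinset.2 hqQ),
    List.toFinset_card_of_nodup hQp.2] at hc1
  have hQpos : 1 ≤ Q.length := by simp [hQdef]
  have hJ1 : J.card ≤ (J.erase i).card + 1 := by
    have := Finset.pred_card_le_card_erase (s := J) (a := i)
    omega
  -- Splicing in `{q}` shows that no two positions in `J` are consecutive; splicing in `Q` keeps
  -- them, apart from `i` itself, more than `Q.length` away from `i`. With `h ≤ Q.length + (J.erase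
  -- i).card` the count yields `2h ≤ l.length + 1`, against `hm`.
  have hkey := card_spaced_le (J := J.erase i) (i := i) (r := Q.length)
    (N := l.length - Q.length) hQpos (Finset.card_pos.1 (by omega))
    (fun j hj => by have := hJend j (Finset.mem_of_mem_erase hj); omega) (by omega)
    (by
      intro j hj
      obtain ⟨hne, hjJ⟩ := Finset.mem_erase.1 hj
      obtain ⟨hj', hadj⟩ := hJmem j hjJ
      rcases lt_or_gt_of_ne hne with hlt | hgt
      · have := hl.splice hvC hQp.reverse hQC' hd' hhead' hlast' hlt hi hadj hiw
        rw [List.length_reverse] at this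
        omega
      · have := hl.splice hvC hQp hQC hd hhead hq hgt hj' hiw hadj
        omega)
    (by
      intro j hj hj1
      obtain ⟨hj', hadj⟩ := hJmem j (Finset.mem_of_mem_erase hj)
      obtain ⟨hj1', hadj1⟩ := hJmem (j + 1) (Finset.mem_of_mem_erase hj1)
      have := hl.splice hvC (isPathList_singleton q) (by simpa using hQC q hqQ)
        (by simpa using hKl q (hQK q hqQ)) (a := q) (b := q) (by simp) (by simp)
        (Nat.lt_succ_self j) hj1' hadj hadj1
      simp at this)
  omega

/-- A component of `C` minus a path from `v`, where `C` contains no cut vertex, is attached to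
the path at two different positions. -/
theorem exists_two_attachments {v : V} {C K : Finset V} {l : List V}
    (hC : IsLobe G v C) (hl : RootedPath G v C l) (hne : l ≠ []) (hnc : ∀ u ∈ C, NotCut G u)
    (hKC : K ⊆ C) (hKne : K.Nonempty) (hKl : ∀ x ∈ K, x ∉ l)
    (hKcl : ∀ x ∈ K, ∀ z, G.Adj x z → z ∈ K ∨ z ∈ v :: l) :
    ∃ w ∈ K, ∃ w' ∈ K, ∃ i j : ℕ, ∃ (hi : i < (v :: l).length) (hj : j < (v :: l).length),
      i < j ∧ G.Adj ((v :: l)[i]) w ∧ G.Adj ((v :: l)[j]) w' := by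
  classical
  have h1 : ∃ w ∈ K, ∃ x ∈ l, G.Adj w x := by
    by_contra! hcon
    have := hC.conn K hKC hKne (by
      intro x hx y hy hxy
      rcases hKcl x hx y hxy with h | h
      · exact h
      · rcases List.mem_cons.1 h with rfl | h
        · exact absurd hy hC.notMem
        · exact absurd hxy (hcon x hx y h))
    obtain ⟨x, hx⟩ := List.exists_mem_of_ne_nil l hne
    exact hKl x (this (hl.2 x hx)) hx
  obtain ⟨w, hw, x, hx, hwx⟩ := h1
  -- If `x` were the only vertex of the path attached to `K`, it would separate `K` from `v`.
  have h2 : ∃ w' ∈ K, ∃ x' ∈ v :: l, x' ≠ x ∧ G.Adj w' x' := by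
    by_contra! hcon
    have := hnc x (hl.2 x hx) K hKne (fun h => hKl x h hx) (by
      intro a ha b hab
      rcases hKcl a ha b hab with h | h
      · exact Or.inr h
      · by_contra hb
        push Not at hb
        exact hcon a ha b h hb.1 hab) v (by rintro rfl; exact hC.notMem (hl.2 _ hx))
    exact hC.notMem (hKC this)
  obtain ⟨w', hw', x', hx', hne', hwx'⟩ := h2
  obtain ⟨i, hi, rfl⟩ := List.mem_iff_getElem.1 (List.mem_cons_of_mem v hx)
  obtain ⟨j, hj, rfl⟩ := List.mem_iff_getElem.1 hx'
  have hij : i ≠ j := by rintro rfl; exact hne' rfl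
  rcases lt_or_gt_of_ne hij with h | h
  · exact ⟨w, hw, w', hw', i, j, hi, hj, h, hwx.symm, hwx'.symm⟩
  · exact ⟨w', hw', w, hw, j, i, hj, hi, h, hwx'.symm, hwx.symm⟩

section Fintype
variable [Fintype V]

/-- A variant of Dirac's theorem for longest paths with a prescribed end. -/
theorem LongestRooted.card_le (hG : ConnSet G Finset.univ) {h : ℕ}
    {v : V} {C : Finset V} (hdeg : MinDegOn G C h) {l : List V} (hC : IsLobe G v C) (hl : LongestRooted G v C l)
    (hnc : ∀ u ∈ C, NotCut G u) (hm : l.length + 2 ≤ 2 * h) (hm2 : l.length ≤ h + 2) :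
    C.card ≤ l.length := by
  classical
  by_contra hcon
  obtain ⟨y, hy⟩ : (C \ l.toFinset).Nonempty := by
    rw [← Finset.card_pos]
    have := Finset.le_card_sdiff l.toFinset C
    rw [List.toFinset_card_of_nodup hl.1.1.tail.2] at this
    omega
  obtain ⟨K, hKS, hyK, hKconn, hKcl⟩ := exists_component (G := G) hy
  have hKC : K ⊆ C := hKS.trans Finset.sdiff_subset
  have hKl : ∀ x ∈ K, x ∉ l := fun x hx => by
    have := hKS hx
    simp at this
    exact this.2
  replace hKcl : ∀ x ∈ K, ∀ z, G.Adj x z → z ∈ K ∨ z ∈ v :: l := by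
    intro x hx z hz
    by_cases hzl : z ∈ v :: l
    · exact Or.inr hzl
    · simp only [List.mem_cons, not_or] at hzl
      refine Or.inl (hKcl x hx z ?_ hz)
      simp [hzl.2, (hC.closed x (hKC hx) z hz).resolve_left hzl.1]
  have hatt : ∀ w ∈ K, ∀ (i : ℕ) (hi : i < (v :: l).length), G.Adj ((v :: l)[i]) w →
      i + h ≤ l.length := fun w hw i hi hiw =>
    hl.attach_le hdeg hC.notMem hKC hKl hKcl hm hw hi hiw
  -- As `l.length ≤ h + 2`, attachments occur at positions at most `2`. Two of them need room for a
  -- path of `K` in between, hence are `0` and `2`, with a single vertex of `K` between them.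
  have htwo : ∀ w ∈ K, ∀ w' ∈ K, ∀ (i j : ℕ) (hi : i < (v :: l).length)
      (hj : j < (v :: l).length), i < j → G.Adj ((v :: l)[i]) w → G.Adj ((v :: l)[j]) w' →
      i = 0 ∧ j = 2 ∧ w = w' := by
    intro w hw w' hw' i j hi hj hij hiw hjw
    obtain ⟨p, hp⟩ := hKconn.exists_isPathFromTo hw hw'
    have h1 := hl.splice hC.notMem hp.1 (fun x hx => hKC (hp.2.2.2 x hx))
      (fun x hx => hKl x (hp.2.2.2 x hx)) hp.2.1 hp.2.2.1 hij hj hiw hjw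
    have h2 := hatt w' hw' j hj hjw
    have h3 : 1 ≤ p.length := List.length_pos_of_mem (List.mem_of_getLast? hp.2.2.1)
    refine ⟨by omega, by omega, ?_⟩
    by_contra hne
    have := hp.two_le_length hne
    omega
  obtain ⟨w, hw, w', hw', i, j, hi, hj, hij, hiw, hjw⟩ :=
    exists_two_attachments hC hl.1 (hl.ne_nil hG hC) hnc hKC ⟨y, hyK⟩ hKl hKcl
  obtain ⟨rfl, rfl, rfl⟩ := htwo w hw w' hw' i j hi hj hij hiw hjw
  have huniq : ∀ w' ∈ K, ∀ z ∈ v :: l, G.Adj w' z →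
      w' = w ∧ z ∈ ({(v :: l)[0], (v :: l)[2]} : Finset V) := by
    intro w' hw' z hz hwz
    obtain ⟨k, hk, rfl⟩ := List.mem_iff_getElem.1 hz
    rcases lt_trichotomy k 0 with hk0 | rfl | hk0
    · omega
    · exact ⟨(htwo w' hw' w hw 0 2 hk hj (by omega) hwz.symm hjw).2.2, by simp⟩
    · obtain ⟨-, rfl, rfl⟩ := htwo w hw w' hw' 0 k hi hk hk0 hiw hwz.symm
      exact ⟨rfl, by simp⟩
  have h2 := hatt w hw 2 hj hjw
  -- Position `2` being an attachment forces `h + 2 ≤ l.length ≤ 2h - 2`, so `h ≥ 4`, and `w` cannot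
  -- have just two neighbours. But then `w` separates the rest of `K` from `v`.
  have hne : (K.erase w).Nonempty := by
    by_contra hemp
    rw [Finset.not_nonempty_iff_eq_empty] at hemp
    have hK : ∀ x ∈ K, x = w := by
      intro x hx
      by_contra hxw
      have : x ∈ K.erase w := Finset.mem_erase.2 ⟨hxw, hx⟩
      rw [hemp] at this
      simp at this
    have := hdeg w (hKC hw) {(v :: l)[0], (v :: l)[2]} (by
      intro z hz
      rcases hKcl w hw z hz with h | h
      · exact absurd (hK z h) hz.ne'
      · exact (huniq w hw z h hz).2)
    have := this.trans Finset.card_le_two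
    omega
  have := hnc w (hKC hw) (K.erase w) hne (by simp) (by
    intro x hx z hz
    obtain ⟨hxw, hxK⟩ := Finset.mem_erase.1 hx
    by_cases hzw : z = w
    · exact Or.inl hzw
    · rcases hKcl x hxK z hz with h | h
      · exact Or.inr (Finset.mem_erase.2 ⟨hzw, h⟩)
      · exact absurd (huniq x hxK z h hz).1 hxw) v (by rintro rfl; exact hC.notMem (hKC hw))
  exact hC.notMem (hKC (Finset.mem_of_mem_erase this))

end Fintype

/-! ### Gluing paths, and Dirac's theorem inside a connected set. -/

theorem RootedPath.join {v : V} {C : Finset V} {l p : List V} (hl : RootedPath G v C l)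
    (hp : IsPathList G p) (hv : p.head? = some v) (hd : ∀ x ∈ p, x ∉ C) :
    IsPathList G (l.reverse ++ p) := by
  refine isPathList_append.2 ⟨hl.1.tail.reverse, hp, ?_, ?_⟩
  · intro x hx hxp
    exact hd x hxp (hl.2 x (by simpa using hx))
  · intro x hx y hy
    rw [hv] at hy
    rw [List.getLast?_reverse] at hx
    simp only [Option.mem_def, Option.some.injEq] at hy
    subst hy
    exact ((isPathList_cons.1 hl.1).2.2 x hx).symm

theorem IsPathFromTo.append_rooted {S C : Finset V} {x u : V} {p l : List V}
    (hp : IsPathFromTo G S x u p) (hl : RootedPath G u C l) (hd : Disjoint S C) :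
    IsPathList G (p ++ l) := by
  refine isPathList_append.2 ⟨hp.1, hl.1.tail, ?_, ?_⟩
  · intro z hz hzl
    exact Finset.disjoint_left.1 hd (hp.2.2.2 z hz) (hl.2 z hzl)
  · intro z hz y hy
    rw [hp.2.2.1] at hz
    simp only [Option.mem_def, Option.some.injEq] at hz
    subst hz
    exact (isPathList_cons.1 hl.1).2.2 y hy

theorem RootedPath.take {v : V} {C : Finset V} {l : List V} (hl : RootedPath G v C l) (n : ℕ) :
    RootedPath G v C (l.take n) :=
  ⟨by simpa using hl.1.take (n + 1), fun x hx => hl.2 x (List.mem_of_mem_take hx)⟩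

/-- A cycle can be opened at the neighbour of an outside vertex, giving a path with one vertex more
than the cycle. -/
theorem isPathList_of_cycle {c : List V} (hc : IsPathList G c)
    (hcl : ∀ x ∈ c.getLast?, ∀ y ∈ c.head?, G.Adj x y) {y z : V} (hy : y ∉ c) (hz : z ∈ c)
    (hyz : G.Adj y z) : ∃ p, IsPathList G (y :: p) ∧ p.Perm c := by
  obtain ⟨A, B, rfl⟩ := List.append_of_mem hz
  obtain ⟨hA, hB, hAB, -⟩ := isPathList_append.1 hc
  have hp : IsPathList G (z :: B ++ A) := by
    refine isPathList_append.2 ⟨hB, hA, hAB.symm, ?_⟩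
    intro a ha b hb
    refine hcl a ?_ b ?_
    · have ha' : (z :: B).getLast? = some a := ha
      simp only [List.getLast?_append, ha', Option.some_or, Option.mem_def]
    · have hb' : A.head? = some b := hb
      simp only [List.head?_append, hb', Option.some_or, Option.mem_def]
  refine ⟨z :: B ++ A, isPathList_cons.2 ⟨?_, hp, by simpa using hyz⟩, List.perm_append_comm⟩
  simp at hy ⊢
  tauto

/-- Dirac: a connected set `C` with minimum degree at least `d` contains a path with
`min |C| (2 d + 1)` vertices. -/
theorem ConnSet.exists_long_path {C : Finset V} (hC : ConnSet G C) {d : ℕ}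
    (hdeg : ∀ x ∈ C, ∀ S : Finset V, (∀ y ∈ C, G.Adj x y → y ∈ S) → d ≤ S.card) :
    ∃ p, IsPathList G p ∧ (∀ x ∈ p, x ∈ C) ∧ (C.card ≤ p.length ∨ 2 * d + 1 ≤ p.length) := by
  classical
  by_contra! hcon
  obtain ⟨m, ⟨p, ⟨hp, hpC⟩, hpm⟩, hmax⟩ : ∃ m, (∃ p, (IsPathList G p ∧ ∀ x ∈ p, x ∈ C) ∧
      p.length = m) ∧ ∀ p', (IsPathList G p' ∧ ∀ x ∈ p', x ∈ C) → p'.length ≤ m := by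
    have hb : BddAbove {m | ∃ p, (IsPathList G p ∧ ∀ x ∈ p, x ∈ C) ∧ p.length = m} :=
      ⟨C.card, by rintro _ ⟨l, hl, rfl⟩; exact (hcon l hl.1 hl.2).1.le⟩
    have hne : {m | ∃ p, (IsPathList G p ∧ ∀ x ∈ p, x ∈ C) ∧ p.length = m}.Nonempty :=
      ⟨0, [], ⟨⟨by simp, by simp⟩, by simp⟩, rfl⟩
    have hmem := Nat.sSup_mem hne hb
    exact ⟨_, hmem, fun l' hl' => le_csSup hb ⟨l', hl', rfl⟩⟩
  subst hpm
  obtain ⟨hlt, hlt2⟩ := hcon p hp hpC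
  rcases p with _ | ⟨x, t⟩
  · obtain ⟨a, ha⟩ := Finset.card_pos.1 (by simpa using hlt)
    have := hmax [a] ⟨isPathList_singleton a, by simpa using ha⟩
    simp at this
  obtain ⟨z, hz, hzp⟩ := exists_getLast?_cons x t
  set p := x :: t with hpdef
  have hx : ∀ y ∈ C, G.Adj x y → y ∈ p := by
    intro y hy hxy
    by_contra hyp
    have := hmax (y :: p) ⟨isPathList_cons.2 ⟨hyp, hp, by simpa [hpdef] using hxy.symm⟩, by
      intro a ha
      rcases List.mem_cons.1 ha with rfl | h
      · exact hy
      · exact hpC a h⟩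
    simp at this
  have hz' : ∀ y ∈ C, G.Adj z y → y ∈ p := by
    intro y hy hzy
    by_contra hyp
    have := hmax (p ++ [y]) ⟨isPathList_append.2 ⟨hp, isPathList_singleton y, by simpa using hyp,
      by rw [hz]; simpa using hzy⟩, by
      intro a ha
      rcases List.mem_append.1 ha with h | h
      · exact hpC a h
      · simp at h; rwa [h]⟩
    simp at this
  have hlast : p[p.length - 1]'(by simp [hpdef]) = z := by
    rw [List.getLast?_eq_getElem?] at hz
    rw [List.getElem?_eq_getElem (by simp [hpdef])] at hz
    simpa using hz
  -- `I` and `J` each have at least `d` of the `p.length - 1 < 2 * d` indices. A common index `i`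
  -- gives crossing chords from `z` to `p[i]` and from `x` to `p[i + 1]`, which close `p` to a
  -- cycle. Connectedness then extends it to a path longer than `p`.
  set I := (Finset.range (p.length - 1)).filter
    fun i => ∃ hi : i < p.length, G.Adj z (p[i]) with hI
  set J := (Finset.range (p.length - 1)).filter
    fun i => ∃ hi : i + 1 < p.length, G.Adj x (p[i + 1]) with hJ
  have hIc : d ≤ I.card := by
    refine (hdeg z (hpC z hzp) (I.image fun i => p.getD i x) ?_).trans Finset.card_image_le
    intro y hy hzy
    obtain ⟨i, hi, rfl⟩ := List.mem_iff_getElem.1 (hz' y hy hzy)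
    refine Finset.mem_image.2 ⟨i, Finset.mem_filter.2 ⟨?_, hi, hzy⟩, ?_⟩
    · have : i ≠ p.length - 1 := by
        rintro rfl
        rw [hlast] at hzy
        exact hzy.ne rfl
      rw [Finset.mem_range]; omega
    · simp [List.getElem?_eq_getElem hi]
  have hJc : d ≤ J.card := by
    refine (hdeg x (hpC x (by simp [hpdef])) (J.image fun i => p.getD (i + 1) x) ?_).trans
      Finset.card_image_le
    intro y hy hxy
    obtain ⟨i, hi, rfl⟩ := List.mem_iff_getElem.1 (hx y hy hxy)
    obtain ⟨i, rfl⟩ : ∃ k, i = k + 1 := by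
      refine ⟨i - 1, ?_⟩
      have : i ≠ 0 := by
        rintro rfl
        exact hxy.ne (by simp [hpdef])
      omega
    refine Finset.mem_image.2 ⟨i, Finset.mem_filter.2 ⟨?_, hi, hxy⟩, ?_⟩
    · rw [Finset.mem_range]; omega
    · simp [List.getElem?_eq_getElem hi]
  have hinter : (I ∩ J).Nonempty := by
    rw [← Finset.card_pos]
    have h1 := Finset.card_union_add_card_inter I J
    have h2 : (I ∪ J).card ≤ p.length - 1 := by
      rw [← Finset.card_range (p.length - 1)]
      exact Finset.card_le_card (Finset.union_subset (Finset.filter_subset _ _)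
        (Finset.filter_subset _ _))
    have : 1 ≤ p.length := by simp [hpdef]
    by_contra hzero
    have h0 : d = 0 ∨ p.length - 1 < 2 * d := by omega
    rcases h0 with rfl | h0
    · omega
    · omega
  obtain ⟨i, hi⟩ := hinter
  obtain ⟨hiI, hiJ⟩ := Finset.mem_inter.1 hi
  obtain ⟨-, hi1, hzi⟩ := Finset.mem_filter.1 hiI
  obtain ⟨-, hi2, hxi⟩ := Finset.mem_filter.1 hiJ
  set c := p.take (i + 1) ++ (p.drop (i + 1)).reverse with hc
  have hcperm : c.Perm p := by
    rw [hc]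
    conv_rhs => rw [← List.take_append_drop (i + 1) p]
    exact (List.reverse_perm _).append_left _
  have hcp : IsPathList G c := by
    refine isPathList_append.2 ⟨hp.take _, (hp.drop _).reverse, ?_, ?_⟩
    · intro a ha hb
      exact List.disjoint_take_drop hp.2 le_rfl ha (by simpa using hb)
    · intro a ha b hb
      rw [List.getLast?_take] at ha
      simp only [Nat.add_eq_zero_iff, one_ne_zero, and_false, if_false, Nat.add_sub_cancel] at ha
      rw [List.getElem?_eq_getElem hi1] at ha
      rw [List.head?_reverse, List.getLast?_drop, if_neg (by omega), hz] at hb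
      simp at ha hb
      rw [← ha, ← hb]; exact hzi.symm
  have hcl : ∀ a ∈ c.getLast?, ∀ b ∈ c.head?, G.Adj a b := by
    intro a ha b hb
    have h1 : c.head? = some x := by simp [hc, hpdef]
    have h2 : c.getLast? = some (p[i + 1]) := by
      rw [hc, List.getLast?_append, List.getLast?_reverse, List.head?_drop,
        List.getElem?_eq_getElem hi2]
      simp
    rw [h2] at ha
    rw [h1] at hb
    simp at ha hb
    rw [← ha, ← hb]; exact hxi.symm
  obtain ⟨a, ha, b, hb, hbp, hab⟩ : ∃ a ∈ p, ∃ b ∈ C, b ∉ p ∧ G.Adj a b := by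
    by_contra! hno
    have := hC p.toFinset (fun a ha => hpC a (by simpa using ha)) ⟨x, by simp [hpdef]⟩ (by
      intro a ha b hb hab
      by_contra hbp
      exact hno a (by simpa using ha) b hb (by simpa using hbp) hab)
    have := Finset.card_le_card this
    rw [List.toFinset_card_of_nodup hp.2] at this
    omega
  obtain ⟨q, hq, hqp⟩ := isPathList_of_cycle hcp hcl (fun h => hbp (hcperm.mem_iff.1 h))
    (hcperm.mem_iff.2 ha) hab.symm
  have := hmax (b :: q) ⟨hq, by
    intro e he
    rcases List.mem_cons.1 he with rfl | h
    · exact hb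
    · exact hpC e (hcperm.mem_iff.1 (hqp.mem_iff.1 h))⟩
  have h1 := hqp.length_eq
  have h2 := hcperm.length_eq
  simp at this
  omega

theorem ConnSet.exists_adj_of_card {C : Finset V} (hC : ConnSet G C) {A : Finset V} (hA : A ⊆ C)
    (hne : A.Nonempty) (hcard : A.card < C.card) : ∃ x ∈ A, ∃ y ∈ C, y ∉ A ∧ G.Adj x y := by
  by_contra! hcon
  have := Finset.card_le_card (hC A hA hne (by
    intro x hx y hy hxy
    by_contra hyA
    exact hcon x hx y hy hyA hxy))
  omega

theorem ConnSet.exists_path_three {C : Finset V} (hC : ConnSet G C) (h3 : 3 ≤ C.card) :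
    ∃ x ∈ C, ∃ y ∈ C, ∃ z ∈ C, x ≠ z ∧ G.Adj x y ∧ G.Adj y z := by
  classical
  obtain ⟨a, ha⟩ := Finset.card_pos.1 (by omega : 0 < C.card)
  obtain ⟨x, hx, b, hb, hne, hab⟩ := hC.exists_adj_of_card (A := {a}) (by simpa using ha) (by simp)
    (by simp; omega)
  obtain rfl : x = a := by simpa using hx
  obtain ⟨y, hy, c, hc, hcn, hyc⟩ := hC.exists_adj_of_card (A := {x, b}) (by
    intro e he; simp at he; rcases he with rfl | rfl <;> assumption) (by simp)
    (lt_of_le_of_lt Finset.card_le_two (by omega))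
  simp at hy hcn
  rcases hy with rfl | rfl
  · exact ⟨c, hc, y, ha, b, hb, fun h => hcn.2 h, hyc.symm, hab⟩
  · exact ⟨x, ha, y, hb, c, hc, fun h => hcn.1 h.symm, hab, hyc⟩

theorem isPathList_three {x y z : V} (hxz : x ≠ z) (hxy : G.Adj x y) (hyz : G.Adj y z) :
    IsPathList G [x, y, z] :=
  ⟨by simp [hxy, hyz], by simp [hxz, hxy.ne, hyz.ne]⟩

/-! ### Three or more components at one vertex. -/

section Fintype
variable [Fintype V]

theorem exists_rootedPath_of_le (hG : ConnSet G Finset.univ) {h : ℕ} (hdeg : MinDegGE G h) {v : V}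
    {C : Finset V} (hC : IsLobe G v C) : ∃ l, RootedPath G v C l ∧ h ≤ l.length := by
  obtain ⟨l, hl⟩ := exists_longestRooted G v C
  exact ⟨l, hl.1, hl.le_length hG (hdeg.on C) hC⟩

theorem IsLobe.le_card (hG : ConnSet G Finset.univ) {h : ℕ} (hdeg : MinDegGE G h) {v : V}
    {C : Finset V} (hC : IsLobe G v C) : h ≤ C.card := by
  obtain ⟨l, hl, hle⟩ := exists_rootedPath_of_le hG hdeg hC
  exact hle.trans hl.length_le

/-- Two disjoint lobes at `v` contain, together with `v`, a path on `2 h + 1` vertices. -/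
theorem exists_path_through (hG : ConnSet G Finset.univ) {h : ℕ} (hdeg : MinDegGE G h) {v : V}
    {C C' : Finset V} (hC : IsLobe G v C) (hC' : IsLobe G v C') (hne : C ≠ C') :
    ∃ p, IsPathList G p ∧ 2 * h + 1 ≤ p.length ∧ ∀ x ∈ p, x = v ∨ x ∈ C ∨ x ∈ C' := by
  obtain ⟨l, hl, hle⟩ := exists_rootedPath_of_le hG hdeg hC
  obtain ⟨l', hl', hle'⟩ := exists_rootedPath_of_le hG hdeg hC'
  refine ⟨l.reverse ++ v :: l', hl.join hl'.1 (by simp) ?_, by simp; omega, ?_⟩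
  · intro x hx hxC
    rcases List.mem_cons.1 hx with rfl | h
    · exact hC.notMem hxC
    · exact Finset.disjoint_left.1 (hC.disjoint hC' hne) hxC (hl'.2 x h)
  · intro x hx
    simp at hx
    rcases hx with h | h | h
    · exact Or.inr (Or.inl (hl.2 x h))
    · exact Or.inl h
    · exact Or.inr (Or.inr (hl'.2 x h))

/-- The case of a vertex `v` for which `G - v` has at least three components. -/
theorem three_lobes (hG : ConnSet G Finset.univ) {h : ℕ} (hdeg : MinDegGE G h) (h1 : 1 ≤ h)
    {s₁ s₂ : ℕ} (hs : s₁ + s₂ = 2 * h + 4) (hle : s₂ ≤ s₁) (h3 : 3 ≤ s₂) (hodd : Odd s₂)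
    {v : V} {C₁ C₂ C₃ : Finset V} (hC₁ : IsLobe G v C₁) (hC₂ : IsLobe G v C₂)
    (hC₃ : IsLobe G v C₃) (h12 : C₁ ≠ C₂) (h13 : C₁ ≠ C₃) (h23 : C₂ ≠ C₃) :
    HasTwoPaths G s₁ s₂ ∨
    (s₂ = h + 1 ∧ ∀ C, IsLobe G v C → C.card = h ∧
      ∀ x ∈ C, ∀ y, y = v ∨ y ∈ C → x ≠ y → G.Adj x y) ∨
    (s₂ = h + 2 ∧ ∀ C, IsLobe G v C → C.card = h ∨ C.card = h + 1) := by
  -- Since `s₂ ≥ 3`, the path on `2h + 1` vertices through `v` and two further lobes is long enough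
  -- for `s₁`.
  by_cases hlong : ∃ C, IsLobe G v C ∧ ∃ p, IsPathList G p ∧ (∀ x ∈ p, x ∈ C) ∧ s₂ ≤ p.length
  · obtain ⟨C, hC, p, hp, hpC, hps⟩ := hlong
    obtain ⟨D, D', hD, hD', hDD', hCD, hCD'⟩ : ∃ D D', IsLobe G v D ∧ IsLobe G v D' ∧ D ≠ D' ∧
        C ≠ D ∧ C ≠ D' := by
      by_cases e1 : C = C₁
      · exact ⟨C₂, C₃, hC₂, hC₃, h23, e1 ▸ h12, e1 ▸ h13⟩
      · by_cases e2 : C = C₂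
        · exact ⟨C₁, C₃, hC₁, hC₃, h13, e1, e2 ▸ h23⟩
        · exact ⟨C₁, C₂, hC₁, hC₂, h12, e1, e2⟩
    obtain ⟨q, hq, hqlen, hqD⟩ := exists_path_through hG hdeg hD hD' hDD'
    refine Or.inl ⟨q, p, hq, hp, ?_, by omega, hps⟩
    intro x hx hxp
    rcases hqD x hx with rfl | h | h
    · exact hC.notMem (hpC _ hxp)
    · exact Finset.disjoint_left.1 (hC.disjoint hD hCD) (hpC x hxp) h
    · exact Finset.disjoint_left.1 (hC.disjoint hD' hCD') (hpC x hxp) h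
  · push Not at hlong
    right
    have hlt : ∀ C, IsLobe G v C → ∀ l, RootedPath G v C l → l.length < s₂ :=
      fun C hC l hl => hlong C hC l hl.1.tail hl.2
    obtain ⟨l₁, hl₁, hle₁⟩ := exists_rootedPath_of_le hG hdeg hC₁
    have := hlt C₁ hC₁ l₁ hl₁
    -- A lobe contains a path on `h` vertices, so `h < s₂`; and `s₂ ≤ s₁` gives `s₂ ≤ h + 2`.
    rcases (by omega : s₂ = h + 1 ∨ s₂ = h + 2) with e | e
    · left
      refine ⟨e, fun C hC => ?_⟩
      obtain ⟨l, hl⟩ := exists_longestRooted G v C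
      have := hlt C hC l hl.1
      exact hl.isClique hG (hdeg.on C) hC (by omega)
    · right
      refine ⟨e, fun C hC => ?_⟩
      have hge := hC.le_card hG hdeg
      by_contra hcon
      -- Dropping `v` leaves minimum degree `h - 1` in the lobe. Dirac's bound `2h - 1` reaches `h +
      -- 2` only for `h ≥ 3`; for `h = 2` the value `s₂ = 4` is not odd.
      rcases (by omega : h = 1 ∨ h = 2 ∨ 3 ≤ h) with rfl | rfl | hh
      · obtain ⟨x, hx, y, hy, z, hz, hxz, hxy, hyz⟩ := hC.conn.exists_path_three (by omega)
        have := hlong C hC [x, y, z] (isPathList_three hxz hxy hyz) (by simp [hx, hy, hz])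
        simp at this
        omega
      · subst e; exact absurd hodd (by decide)
      · obtain ⟨p, hp, hpC, hpl⟩ := hC.conn.exists_long_path (d := h - 1) (by
          classical
          intro x hx S hS
          have := hdeg x (insert v S) (fun y hy => by
            rcases hC.closed x hx y hy with rfl | hyC
            · simp
            · exact Finset.mem_insert_of_mem (hS y hyC hy))
          have := this.trans (Finset.card_insert_le _ _)
          omega)
        have := hlong C hC p hp hpC
        omega

end Fintype

/-! ### Lobes without cut vertices when the minimum degree is two or three. -/

theorem MinDegOn.adj_of_subset_pair {C : Finset V} (hdeg : MinDegOn G C 2) {x a b : V} (hx : x ∈ C)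
    (h : ∀ y, G.Adj x y → y = a ∨ y = b) : G.Adj x a ∧ G.Adj x b := by
  classical
  constructor
  · by_contra hn
    have := hdeg x hx {b} (fun y hy => by
      rcases h y hy with rfl | rfl
      · exact absurd hy hn
      · simp)
    simp at this
  · by_contra hn
    have := hdeg x hx {a} (fun y hy => by
      rcases h y hy with rfl | rfl
      · simp
      · exact absurd hy hn)
    simp at this

theorem rootedPath_four {v a b c d : V} {D : Finset V} (hvD : v ∉ D) (ha : a ∈ D) (hb : b ∈ D)
    (hc : c ∈ D) (hd : d ∈ D) (hva : G.Adj v a) (hab : G.Adj a b) (hbc : G.Adj b c)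
    (hcd : G.Adj c d) (hac : a ≠ c) (had : a ≠ d) (hbd : b ≠ d) :
    RootedPath G v D [a, b, c, d] := by
  have h1 : v ≠ c := fun h => hvD (h ▸ hc)
  have h2 : v ≠ d := fun h => hvD (h ▸ hd)
  have h3 : v ≠ b := fun h => hvD (h ▸ hb)
  refine ⟨⟨by simp [hva, hab, hbc, hcd], ?_⟩, by simp [ha, hb, hc, hd]⟩
  simp [hva.ne, h1, h2, h3, hab.ne, hac, had, hbc.ne, hbd, hcd.ne]

section Fintype
variable [Fintype V]

/-- If the vertices of `D` have degree at least two and no path from `v` has more than three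
vertices in `D`, then `v` and some `w` are the only neighbours of the other vertices of `D`. -/
theorem exists_second_hub (hG : ConnSet G Finset.univ) {v : V} {D : Finset V} (hD : IsLobe G v D)
    (hnc : ∀ u ∈ D, NotCut G u) (hdeg : MinDegOn G D 2) (h4 : 4 ≤ D.card)
    (hmax : ∀ l, RootedPath G v D l → l.length ≤ 3) :
    ∃ w ∈ D, ∀ y ∈ D, y ≠ w → G.Adj y v ∧ G.Adj y w ∧ ∀ z, G.Adj y z → z = v ∨ z = w := by
  classical
  have hno : ∀ a ∈ D, ∀ b ∈ D, ∀ c ∈ D, ∀ d ∈ D, G.Adj v a → G.Adj a b → G.Adj b c → G.Adj c d →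
      a ≠ c → a ≠ d → b ≠ d → False := by
    intro a ha b hb c hc d hd hva hab hbc hcd hac had hbd
    have := hmax _ (rootedPath_four hD.notMem ha hb hc hd hva hab hbc hcd hac had hbd)
    simp at this
  have hcl := hD.closed
  have hvne : ∀ x ∈ D, x ≠ v := fun x hx h => hD.notMem (h ▸ hx)
  -- Once both ends of a path `a, b, c` are adjacent to `v`, the middle vertex is the second hub:
  -- any other edge would start a path from `v` with four vertices in `D`.
  have main : ∀ a ∈ D, ∀ b ∈ D, ∀ c ∈ D, a ≠ c → G.Adj v a → G.Adj a b → G.Adj b c → G.Adj v c →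
      ∃ w ∈ D, ∀ y ∈ D, y ≠ w → G.Adj y v ∧ G.Adj y w ∧ ∀ z, G.Adj y z → z = v ∨ z = w := by
    intro a ha b hb c hc hac hva hab hbc hvc
    have hstep : ∀ y ∈ D, y ≠ a → y ≠ b → y ≠ c → G.Adj b y →
        G.Adj y v ∧ G.Adj y b ∧ ∀ z, G.Adj y z → z = v ∨ z = b := by
      intro y hy hya hyb hyc hby
      have hz : ∀ z, G.Adj y z → z = v ∨ z = b := by
        intro z hyz
        by_contra hcon
        push Not at hcon
        have hzD : z ∈ D := (hcl y hy z hyz).resolve_left hcon.1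
        by_cases hza : z = a
        · subst hza
          exact hno c hc b hb z ha y hy hvc hbc.symm hab.symm hyz.symm hac.symm hyc.symm hyb.symm
        · exact hno a ha b hb y hy z hzD hva hab hby hyz hya.symm (Ne.symm hza) hcon.2.symm
      have := hdeg.adj_of_subset_pair hy hz
      exact ⟨this.1, this.2, hz⟩
    have hall : ∀ y ∈ D, y = a ∨ y = b ∨ y = c ∨
        (G.Adj y v ∧ G.Adj y b ∧ ∀ z, G.Adj y z → z = v ∨ z = b) := by
      have := hD.conn (D.filter fun y => y = a ∨ y = b ∨ y = c ∨
        (G.Adj y v ∧ G.Adj y b ∧ ∀ z, G.Adj y z → z = v ∨ z = b)) (Finset.filter_subset _ _)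
        ⟨a, by simp [ha]⟩ (by
          intro x hx y hy hxy
          obtain ⟨hxD, hx⟩ := Finset.mem_filter.1 hx
          refine Finset.mem_filter.2 ⟨hy, ?_⟩
          by_cases hya : y = a
          · exact Or.inl hya
          by_cases hyb : y = b
          · exact Or.inr (Or.inl hyb)
          by_cases hyc : y = c
          · exact Or.inr (Or.inr (Or.inl hyc))
          refine Or.inr (Or.inr (Or.inr ?_))
          rcases hx with rfl | rfl | rfl | ⟨-, -, hx⟩
          · exact (hno c hc b hb x ha y hy hvc hbc.symm hab.symm hxy hac.symm (Ne.symm hyc)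
              (Ne.symm hyb)).elim
          · exact hstep y hy hya hyb hyc hxy
          · exact (hno a ha b hb x hc y hy hva hab hbc hxy hac (Ne.symm hya) (Ne.symm hyb)).elim
          · rcases hx y hxy with rfl | rfl
            · exact absurd rfl (hvne y hy)
            · exact absurd rfl hyb)
      intro y hy
      exact (Finset.mem_filter.1 (this hy)).2
    obtain ⟨y, hy, hyn⟩ : ∃ y ∈ D, y ∉ ({a, b, c} : Finset V) := by
      by_contra! hcon
      have := Finset.card_le_card (show D ⊆ {a, b, c} from hcon)
      have := this.trans Finset.card_le_three
      omega
    simp only [Finset.mem_insert, Finset.mem_singleton, not_or] at hyn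
    obtain ⟨hyv, hyb, -⟩ := (((hall y hy).resolve_left hyn.1).resolve_left hyn.2.1).resolve_left
      hyn.2.2
    have hac' : ¬ G.Adj a c := fun h => hno y hy b hb a ha c hc hyv.symm hyb hab.symm h hyn.1
      hyn.2.2 hbc.ne
    refine ⟨b, hb, fun x hx hxb => ?_⟩
    rcases hall x hx with rfl | rfl | rfl | h
    · refine ⟨hva.symm, hab, fun z hz => ?_⟩
      by_contra hcon
      push Not at hcon
      have hzD : z ∈ D := (hcl x hx z hz).resolve_left hcon.1
      refine hno c hc b hb x hx z hzD hvc hbc.symm hab.symm hz hac.symm ?_ hcon.2.symm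
      rintro rfl
      exact hac' hz
    · exact absurd rfl hxb
    · refine ⟨hvc.symm, hbc.symm, fun z hz => ?_⟩
      by_contra hcon
      push Not at hcon
      have hzD : z ∈ D := (hcl x hx z hz).resolve_left hcon.1
      refine hno a ha b hb x hx z hzD hva hab hbc hz hac ?_ hcon.2.symm
      rintro rfl
      exact hac' hz.symm
    · exact h
  obtain ⟨l, hl⟩ := exists_longestRooted G v D
  have hl3 := hmax l hl.1
  have hl3' : l.length = 3 := by
    by_contra hne
    have := (hl.isClique hG hdeg hD (by omega)).1
    omega
  obtain ⟨x₁, x₂, x₃, rfl⟩ := List.length_eq_three.1 hl3'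
  obtain ⟨⟨hch, hnd⟩, hmem⟩ := hl.1
  simp at hch hnd hmem
  obtain ⟨hv1, h12, h23⟩ := hch
  obtain ⟨hx₁, hx₂, hx₃⟩ := hmem
  have h13 : x₁ ≠ x₃ := hnd.2.1.2
  -- If `x₃` is not adjacent to `v`, its neighbours are exactly `x₁` and `x₂`, and the path may
  -- equally be run as `x₁, x₃, x₂`. If `x₂` is not adjacent to `v` either, then `x₁` separates
  -- `{x₂, x₃}` from `v`.
  by_cases hv3 : G.Adj v x₃
  · exact main x₁ hx₁ x₂ hx₂ x₃ hx₃ h13 hv1 h12 h23 hv3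
  have hN3 : ∀ z, G.Adj x₃ z → z = x₁ ∨ z = x₂ := by
    intro z hz
    by_contra hcon
    push Not at hcon
    have hzD : z ∈ D := (hcl x₃ hx₃ z hz).resolve_left (by rintro rfl; exact hv3 hz.symm)
    exact hno x₁ hx₁ x₂ hx₂ x₃ hx₃ z hzD hv1 h12 h23 hz h13 hcon.1.symm hcon.2.symm
  have h31 := (hdeg.adj_of_subset_pair hx₃ hN3).1
  by_cases hv2 : G.Adj v x₂
  · exact main x₁ hx₁ x₃ hx₃ x₂ hx₂ h12.ne hv1 h31.symm h23.symm hv2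
  exfalso
  have := hnc x₁ hx₁ {x₂, x₃} (by simp) (by simp [h12.ne, h13]) (by
    intro x hx y hxy
    simp only [Finset.mem_insert, Finset.mem_singleton] at hx ⊢
    rcases hx with rfl | rfl
    · by_contra hcon
      push Not at hcon
      have hyD : y ∈ D := (hcl x hx₂ y hxy).resolve_left (by rintro rfl; exact hv2 hxy.symm)
      exact hno x₁ hx₁ x₃ hx₃ x hx₂ y hyD hv1 h31.symm h23.symm hxy h12.ne hcon.1.symm
        hcon.2.2.symm
    · rcases hN3 y hxy with h | h
      · exact Or.inl h
      · exact Or.inr (Or.inl h)) v (hvne x₁ hx₁).symm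
  simp only [Finset.mem_insert, Finset.mem_singleton] at this
  rcases this with rfl | rfl
  · exact hD.notMem hx₂
  · exact hD.notMem hx₃

end Fintype

/-- The case that the longest paths from `v` have exactly four vertices in `D`. -/
theorem exists_five_or_two_three {v : V} {D : Finset V} (hD : IsLobe G v D)
    (hnc : ∀ u ∈ D, NotCut G u) (hdeg : MinDegOn G D 2) (h5 : 5 ≤ D.card) {l : List V}
    (hl : LongestRooted G v D l) (hl4 : l.length = 4) :
    (∃ p, IsPathList G p ∧ (∀ x ∈ p, x ∈ D) ∧ 5 ≤ p.length) ∨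
    ∃ a ∈ D, ∃ b ∈ D, ∃ x ∈ D, ∃ y ∈ D, ∃ z ∈ D, [a, b, x, y, z].Nodup ∧ G.Adj v a ∧ G.Adj a b ∧
      G.Adj x y ∧ G.Adj y z := by
  classical
  by_contra hcon
  push Not at hcon
  obtain ⟨hno5, hno23⟩ := hcon
  have hvne : ∀ x ∈ D, x ≠ v := fun x hx h => hD.notMem (h ▸ hx)
  have hcl := hD.closed
  have hattach : ∀ a ∈ D, ∀ b ∈ D, ∀ c ∈ D, ∀ d ∈ D, ∃ x ∈ D, x ≠ a ∧ x ≠ b ∧ x ≠ c ∧ x ≠ d ∧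
      (G.Adj a x ∨ G.Adj b x ∨ G.Adj c x ∨ G.Adj d x) := by
    intro a ha b hb c hc d hd
    obtain ⟨x, hx, y, hy, hyn, hxy⟩ := hD.conn.exists_adj_of_card (A := {a, b, c, d}) (by
      intro e he; simp at he; rcases he with rfl | rfl | rfl | rfl <;> assumption) (by simp)
      (lt_of_le_of_lt Finset.card_le_four (by omega))
    simp only [Finset.mem_insert, Finset.mem_singleton, not_or] at hx hyn
    refine ⟨y, hy, hyn.1, hyn.2.1, hyn.2.2.1, hyn.2.2.2, ?_⟩
    rcases hx with rfl | rfl | rfl | rfl <;> tauto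
  -- A fifth vertex attached at an end of the path extends it. Attached at an inner vertex, it forms
  -- a three-vertex path with that vertex and the end next to it, and the other two vertices are the
  -- pair reached from `v`.
  have main : ∀ a ∈ D, ∀ b ∈ D, ∀ c ∈ D, ∀ d ∈ D, [a, b, c, d].Nodup → G.Adj v a → G.Adj a b →
      G.Adj b c → G.Adj c d → G.Adj v d → False := by
    intro a ha b hb c hc d hd hnd hva hab hbc hcd hvd
    simp at hnd
    obtain ⟨x, hx, hxa, hxb, hxc, hxd, h⟩ := hattach a ha b hb c hc d hd
    rcases h with h | h | h | h
    · have := hno5 [x, a, b, c, d] ⟨by simp [h.symm, *], by simp [*]⟩ (by simp [*])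
      simp at this
    · refine hno23 d hd c hc a ha b hb x hx ?_ hvd hcd.symm hab h
      simp [hxa.symm, hxb.symm, hxc.symm, hxd.symm, hcd.ne', hab.ne, Ne.symm hnd.1.2.2,
        Ne.symm hnd.1.2.1, Ne.symm hnd.2.1.2, hbc.ne']
    · refine hno23 a ha b hb d hd c hc x hx ?_ hva hab hcd.symm h
      simp [hxa.symm, hxb.symm, hxc.symm, hxd.symm, hcd.ne', hab.ne, hnd.1.2.2,
        hnd.1.2.1, hnd.2.1.2, hbc.ne]
    · have := hno5 [a, b, c, d, x] ⟨by simp [*], by simp [*, Ne.symm hxa, Ne.symm hxb,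
        Ne.symm hxc, Ne.symm hxd]⟩ (by simp [*])
      simp at this
  have hcyc : ∀ a ∈ D, ∀ b ∈ D, ∀ c ∈ D, ∀ d ∈ D, [a, b, c, d].Nodup → G.Adj a b →
      G.Adj b c → G.Adj c d → G.Adj d a → False := by
    intro a ha b hb c hc d hd hnd hab hbc hcd hda
    obtain ⟨x, hx, hxa, hxb, hxc, hxd, h⟩ := hattach a ha b hb c hc d hd
    obtain ⟨z, hz, hxz⟩ : ∃ z ∈ [a, b, c, d], G.Adj x z := by
      rcases h with h | h | h | h
      · exact ⟨a, by simp, h.symm⟩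
      · exact ⟨b, by simp, h.symm⟩
      · exact ⟨c, by simp, h.symm⟩
      · exact ⟨d, by simp, h.symm⟩
    obtain ⟨p, hp, hpp⟩ := isPathList_of_cycle (c := [a, b, c, d]) ⟨by simp [*], hnd⟩
      (by simpa using hda) (y := x) (z := z) (by simp [*]) hz hxz
    have := hno5 _ hp (by
      intro e he
      rcases List.mem_cons.1 he with rfl | he
      · exact hx
      · have := hpp.mem_iff.1 he
        simp at this
        rcases this with rfl | rfl | rfl | rfl <;> assumption)
    have hlen := hpp.length_eq
    simp at this hlen
    omega
  obtain ⟨x₁, x₂, x₃, x₄, rfl⟩ : ∃ a b c d, l = [a, b, c, d] := by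
    rcases l with _ | ⟨a, _ | ⟨b, _ | ⟨c, _ | ⟨d, _ | ⟨e, l⟩⟩⟩⟩⟩ <;> simp at hl4
    exact ⟨a, b, c, d, rfl⟩
  obtain ⟨⟨hch, hnd⟩, hmem⟩ := hl.1
  have hnd' : [x₁, x₂, x₃, x₄].Nodup := (List.nodup_cons.1 hnd).2
  clear hnd
  simp at hch hmem
  obtain ⟨hv1, h12, h23, h34⟩ := hch
  obtain ⟨hx₁, hx₂, hx₃, hx₄⟩ := hmem
  have hend : ∀ a ∈ D, ∀ b ∈ D, ∀ c ∈ D, ∀ d ∈ D, [a, b, c, d].Nodup → G.Adj v a → G.Adj a b →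
      G.Adj b c → G.Adj c d → ∀ y, G.Adj d y → y = b ∨ y = c := by
    intro a ha b hb c hc d hd hnd hva hab hbc hcd y hdy
    have hnd2 := hnd
    simp at hnd2
    by_contra hcon
    push Not at hcon
    rcases hcl d hd y hdy with rfl | hy
    · exact main a ha b hb c hc d hd hnd hva hab hbc hcd hdy.symm
    by_cases hya : y = a
    · subst hya
      exact hcyc y ha b hb c hc d hd hnd hab hbc hcd hdy
    have := hl.2 [a, b, c, d, y] ⟨⟨by simp [*], by
      have := (hvne a ha).symm
      have := (hvne b hb).symm
      have := (hvne c hc).symm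
      have := (hvne d hd).symm
      have := (hvne y hy).symm
      have := hdy.ne
      simp [*, Ne.symm hya, Ne.symm hcon.1, Ne.symm hcon.2]⟩, by simp [*]⟩
    simp at this
  have hN4 := hend x₁ hx₁ x₂ hx₂ x₃ hx₃ x₄ hx₄ hnd' hv1 h12 h23 h34
  -- The edge `x₄ x₂` allows `x₃` and `x₄` to be exchanged. So neither has neighbours outside `{x₂,
  -- x₃, x₄}`, and `x₂` would be a cut vertex.
  have h42 := (hdeg.adj_of_subset_pair hx₄ hN4).1
  have hN3 := hend x₁ hx₁ x₂ hx₂ x₄ hx₄ x₃ hx₃ (by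
    simp at hnd' ⊢
    exact ⟨⟨hnd'.1.1, hnd'.1.2.2, hnd'.1.2.1⟩, ⟨hnd'.2.1.2, hnd'.2.1.1⟩, Ne.symm hnd'.2.2⟩)
    hv1 h12 h42.symm h34.symm
  have := hnc x₂ hx₂ {x₃, x₄} (by simp) (by simp [h23.ne, h42.ne']) (by
    intro x hx y hxy
    simp only [Finset.mem_insert, Finset.mem_singleton] at hx ⊢
    rcases hx with rfl | rfl
    · have := hN3 y hxy; tauto
    · have := hN4 y hxy; tauto) v (hvne x₂ hx₂).symm
  simp only [Finset.mem_insert, Finset.mem_singleton] at this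
  rcases this with rfl | rfl
  · exact hD.notMem hx₃
  · exact hD.notMem hx₄


/-- For minimum degree three, the case that the longest paths from `v` have exactly five vertices
in `D`. -/
theorem exists_paths_of_longest_five {v : V} {D : Finset V} (hD : IsLobe G v D)
    (hnc : ∀ u ∈ D, NotCut G u) (hdeg : MinDegOn G D 3) (h6 : 6 ≤ D.card) {l : List V}
    (hl : LongestRooted G v D l) (hl5 : l.length = 5) :
    (∃ a ∈ D, G.Adj v a ∧ ∃ p, IsPathList G p ∧ (∀ x ∈ p, x ∈ D ∧ x ≠ a) ∧ 5 ≤ p.length) ∧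
    ((∃ p, IsPathList G p ∧ (∀ x ∈ p, x = v ∨ x ∈ D) ∧ 7 ≤ p.length) ∨
      ∃ l p, RootedPath G v D l ∧ 3 ≤ l.length ∧ IsPathList G p ∧ (∀ x ∈ p, x ∈ D) ∧
        l.Disjoint p ∧ 3 ≤ p.length) := by
  classical
  by_cases hY : ∃ y ∈ D, y ∉ l ∧ G.Adj v y
  · obtain ⟨y, hy, hyl, hvy⟩ := hY
    refine ⟨⟨y, hy, hvy, l, hl.1.1.tail, fun x hx => ⟨hl.1.2 x hx, ?_⟩, hl5.ge⟩,
      Or.inl ⟨y :: v :: l, isPathList_cons.2 ⟨?_, hl.1.1, by simpa using hvy.symm⟩, ?_, by simp [hl5]⟩⟩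
    · rintro rfl
      exact hyl hx
    · simp [hvy.ne', hyl]
    · intro x hx
      simp at hx
      rcases hx with rfl | rfl | hx
      · exact Or.inr hy
      · exact Or.inl rfl
      · exact Or.inr (hl.1.2 x hx)
  push Not at hY
  obtain ⟨x₁, x₂, x₃, x₄, x₅, rfl⟩ : ∃ a b c d e, l = [a, b, c, d, e] := by
    rcases l with _ | ⟨a, _ | ⟨b, _ | ⟨c, _ | ⟨d, _ | ⟨e, _ | ⟨f, l⟩⟩⟩⟩⟩⟩ <;> simp at hl5
    exact ⟨a, b, c, d, e, rfl⟩
  obtain ⟨⟨hch, hnd⟩, hmem⟩ := hl.1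
  have hvl : v ∉ [x₁, x₂, x₃, x₄, x₅] := (List.nodup_cons.1 hnd).1
  have hx1 : x₁ ∉ [x₂, x₃, x₄, x₅] := (List.nodup_cons.1 (List.nodup_cons.1 hnd).2).1
  clear hnd
  simp at hch hmem
  obtain ⟨hv1, h12, h23, h34, h45⟩ := hch
  obtain ⟨hx₁, hx₂, hx₃, hx₄, hx₅⟩ := hmem
  set l := [x₁, x₂, x₃, x₄, x₅] with hldef
  have hend : ∀ Q, IsPathList G Q → (∀ x ∈ Q, x ∈ D ∧ x ∉ l) → ∀ a, Q.head? = some a →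
      ∀ (i : ℕ) (hi : i < (v :: l).length), G.Adj ((v :: l)[i]) a → i + Q.length ≤ 5 :=
    fun Q hQ hQD a ha i hi hia => hl.splice_end hD.notMem hQ (fun x hx => (hQD x hx).1)
      (fun x hx => (hQD x hx).2) ha hi hia
  have hsp : ∀ Q, IsPathList G Q → (∀ x ∈ Q, x ∈ D ∧ x ∉ l) → ∀ a b, Q.head? = some a →
      Q.getLast? = some b → ∀ (i j : ℕ) (hi : i < (v :: l).length) (hj : j < (v :: l).length),
      i < j → G.Adj ((v :: l)[i]) a → G.Adj ((v :: l)[j]) b → i + 1 + Q.length ≤ j :=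
    fun Q hQ hQD a b ha hb i j hi hj hij hia hjb => hl.splice hD.notMem hQ
      (fun x hx => (hQD x hx).1) (fun x hx => (hQD x hx).2) ha hb hij hj hia hjb
  have hpos : ∀ z ∈ v :: l, ∃ (i : ℕ) (hi : i < (v :: l).length), (v :: l)[i] = z :=
    fun z hz => List.mem_iff_getElem.1 hz
  have hpos1 : ∀ y ∈ D, y ∉ l → ∀ (i : ℕ) (hi : i < (v :: l).length), G.Adj ((v :: l)[i]) y →
      1 ≤ i := by
    intro y hy hyl i hi hiy
    rcases i with _ | i
    · exact absurd hiy (hY y hy hyl)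
    · omega
  -- Otherwise all neighbours of `y` are on the path at positions `1` to `4`, no two of them
  -- consecutive. That allows only two neighbours.
  have hnbr : ∀ y ∈ D, y ∉ l → ∃ z ∈ D, z ∉ l ∧ G.Adj y z := by
    intro y hy hyl
    by_contra! hcon
    have hQ : ∀ x ∈ [y], x ∈ D ∧ x ∉ l := by simp [hy, hyl]
    have hN : ∀ z, G.Adj y z → z ∈ ({x₁, x₂, x₃, x₄} : Finset V) := by
      intro z hz
      have hzl : z ∈ v :: l := by
        by_contra hzl
        simp only [List.mem_cons, not_or] at hzl
        exact hcon z ((hD.closed y hy z hz).resolve_left hzl.1) (by simp [l, hzl.2]) hz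
      obtain ⟨i, hi, rfl⟩ := hpos z hzl
      have h1 := hpos1 y hy hyl i hi hz.symm
      have h2 := hend [y] (isPathList_singleton y) hQ y (by simp) i hi hz.symm
      simp at h2
      interval_cases i <;> simp [l]
    have hnc2 : ∀ (i : ℕ) (hi : i + 1 < (v :: l).length), G.Adj ((v :: l)[i]) y →
        ¬ G.Adj ((v :: l)[i + 1]) y := by
      intro i hi h1 h2
      have := hsp [y] (isPathList_singleton y) hQ y y (by simp) (by simp) i (i + 1) (by omega) hi
        (by omega) h1 h2
      simp at this
    have n1 := hnc2 1 (by simp [l])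
    have n2 := hnc2 2 (by simp [l])
    have n3 := hnc2 3 (by simp [l])
    simp [l] at n1 n2 n3
    have hpair : ∀ a b, (∀ z, G.Adj y z → z = a ∨ z = b) → False := by
      intro a b hab
      have := (hdeg y hy {a, b} (fun z hz => by simpa using hab z hz)).trans Finset.card_le_two
      omega
    simp only [Finset.mem_insert, Finset.mem_singleton] at hN
    by_cases e1 : G.Adj x₁ y
    · by_cases e3 : G.Adj x₃ y
      · refine hpair x₁ x₃ fun z hz => ?_
        rcases hN z hz with rfl | rfl | rfl | rfl
        · exact Or.inl rfl
        · exact absurd hz.symm (n1 e1)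
        · exact Or.inr rfl
        · exact absurd hz.symm (n3 e3)
      · refine hpair x₁ x₄ fun z hz => ?_
        rcases hN z hz with rfl | rfl | rfl | rfl
        · exact Or.inl rfl
        · exact absurd hz.symm (n1 e1)
        · exact absurd hz.symm e3
        · exact Or.inr rfl
    · by_cases e2 : G.Adj x₂ y
      · refine hpair x₂ x₄ fun z hz => ?_
        rcases hN z hz with rfl | rfl | rfl | rfl
        · exact absurd hz.symm e1
        · exact Or.inl rfl
        · exact absurd hz.symm (n2 e2)
        · exact Or.inr rfl
      · refine hpair x₃ x₄ fun z hz => ?_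
        rcases hN z hz with rfl | rfl | rfl | rfl
        · exact absurd hz.symm e1
        · exact absurd hz.symm e2
        · exact Or.inl rfl
        · exact Or.inr rfl
  obtain ⟨y, hy⟩ : (D \ l.toFinset).Nonempty := by
    rw [← Finset.card_pos]
    have := Finset.le_card_sdiff l.toFinset D
    have h2 := List.toFinset_card_le l
    simp only [hl5] at h2
    omega
  obtain ⟨K, hKS, hyK, hKconn, hKcl⟩ := exists_component (G := G) hy
  have hKD : ∀ x ∈ K, x ∈ D ∧ x ∉ l := fun x hx => by
    have := hKS hx
    rw [Finset.mem_sdiff, List.mem_toFinset] at this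
    exact this
  replace hKcl : ∀ x ∈ K, ∀ z, G.Adj x z → z ∈ K ∨ z ∈ v :: l := by
    intro x hx z hz
    by_cases hzl : z ∈ v :: l
    · exact Or.inr hzl
    · rw [List.mem_cons, not_or] at hzl
      refine Or.inl (hKcl x hx z ?_ hz)
      rw [Finset.mem_sdiff, List.mem_toFinset]
      exact ⟨(hD.closed x (hKD x hx).1 z hz).resolve_left hzl.1, hzl.2⟩
  have hKnbr : ∀ x ∈ K, ∃ z ∈ K, G.Adj x z := by
    intro x hx
    obtain ⟨z, hz, hzl, hxz⟩ := hnbr x (hKD x hx).1 (hKD x hx).2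
    refine ⟨z, (hKcl x hx z hxz).resolve_right fun h => ?_, hxz⟩
    rcases List.mem_cons.1 h with rfl | h
    · exact hD.notMem hz
    · exact hzl h
  obtain ⟨w, hw, w', hw', i, j, hi, hj, hij, hiw, hjw⟩ :=
    exists_two_attachments hD hl.1 (by simp [l]) hnc (fun x hx => (hKD x hx).1) ⟨y, hyK⟩
      (fun x hx => (hKD x hx).2) hKcl
  have hi1 := hpos1 w (hKD w hw).1 (hKD w hw).2 i hi hiw
  have hp2 : ∀ a ∈ K, ∀ b ∈ K, G.Adj a b → IsPathList G [a, b] ∧ ∀ x ∈ [a, b], x ∈ D ∧ x ∉ l := by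
    intro a ha b hb hab
    exact ⟨⟨by simp [hab], by simp [hab.ne]⟩, by simp [hKD a ha, hKD b hb]⟩
  obtain ⟨z, hz, hwz⟩ := hKnbr w' hw'
  -- The edge `w' z` leaves the path at position `j`, which bounds `j` by `3`. Entering the path
  -- from `K` at `j` then gives five vertices without `x₁`.
  have hj3 := hend [w', z] (hp2 w' hw' z hz hwz).1 (hp2 w' hw' z hz hwz).2 w' (by simp) j hj hjw
  simp at hj3
  refine ⟨⟨x₁, hx₁, hv1, ?_⟩, Or.inr ?_⟩
  · have hw'D := hKD w' hw'
    have hzD := hKD z hz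
    simp [l] at hw'D hzD
    have hp2' : IsPathList G [x₂, x₃, x₄, x₅] := hl.1.1.drop 2
    have hmem : ∀ x ∈ [x₂, x₃, x₄, x₅], x ∈ D ∧ x ≠ x₁ := by
      intro x hx
      refine ⟨hl.1.2 x (List.mem_cons_of_mem _ hx), ?_⟩
      rintro rfl
      exact hx1 hx
    rcases (by omega : j = 2 ∨ j = 3) with rfl | rfl
    · simp [l] at hjw
      refine ⟨[w', x₂, x₃, x₄, x₅], isPathList_cons.2 ⟨by simp [hw'D], hp2',
        by simpa using hjw.symm⟩, ?_, by simp⟩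
      intro x hx
      rcases List.mem_cons.1 hx with rfl | hx
      · exact ⟨hw'D.1, hw'D.2.1⟩
      · exact hmem x hx
    · simp [l] at hjw
      refine ⟨[z, w', x₃, x₄, x₅], isPathList_cons.2 ⟨by simp [hzD, hwz.ne'], isPathList_cons.2
        ⟨by simp [hw'D], hp2'.tail, by simpa using hjw.symm⟩, by simpa using hwz.symm⟩, ?_, by simp⟩
      intro x hx
      rcases List.mem_cons.1 hx with rfl | hx
      · exact ⟨hzD.1, hzD.2.1⟩
      rcases List.mem_cons.1 hx with rfl | hx
      · exact ⟨hw'D.1, hw'D.2.1⟩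
      · exact hmem x (List.mem_cons_of_mem _ hx)
  · refine ⟨l.take 3, ?_⟩
    suffices h : ∃ p, IsPathList G p ∧ (∀ x ∈ p, x ∈ K) ∧ 3 ≤ p.length by
      obtain ⟨p, hp, hpK, hp3⟩ := h
      exact ⟨p, hl.1.take 3, by simp [l], hp, fun x hx => (hKD x (hpK x hx)).1,
        fun x hx hxp => (hKD x (hpK x hxp)).2 (List.mem_of_mem_take hx), hp3⟩
    -- Without a three-vertex path in `K`, the attachments are at positions `1` and `3` through a
    -- single vertex `w`, and a neighbour `z` of `w` in `K` can have no neighbour but `w`.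
    by_contra! hno
    obtain ⟨p, hp⟩ := hKconn.exists_isPathFromTo hw hw'
    have hpl := hsp p hp.1 (fun x hx => hKD x (hp.2.2.2 x hx)) w w' hp.2.1 hp.2.2.1 i j hi hj hij
      hiw hjw
    have hp1 : 1 ≤ p.length := List.length_pos_of_mem (List.mem_of_getLast? hp.2.2.1)
    obtain rfl : w = w' := by
      by_contra hne
      have := hp.two_le_length hne
      omega
    obtain rfl : i = 1 := by omega
    obtain rfl : j = 3 := by omega
    have hzN : ∀ u, G.Adj z u → u ∈ ({w} : Finset V) := by
      intro u hu
      rw [Finset.mem_singleton]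
      by_contra huw
      rcases hKcl z hz u hu with huK | hul
      · have := hno [w, z, u] (isPathList_three (Ne.symm huw) hwz hu) (by simp [hw, hz, huK])
        simp at this
      · obtain ⟨k, hk, rfl⟩ := hpos u hul
        have hk1 := hpos1 z (hKD z hz).1 (hKD z hz).2 k hk hu.symm
        have hzw := hp2 z hz w hw hwz.symm
        have hwz' := hp2 w hw z hz hwz
        have hk3 := hend [z, w] hzw.1 hzw.2 z (by simp) k hk hu.symm
        simp at hk3
        rcases (by omega : k = 1 ∨ 1 < k) with rfl | hk1'
        · have := hsp [z, w] hzw.1 hzw.2 z w (by simp) (by simp) 1 3 hk hj (by omega) hu.symm hjw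
          simp at this
        · have := hsp [w, z] hwz'.1 hwz'.2 w z (by simp) (by simp) 1 k hi hk hk1' hiw hu.symm
          simp at this
          omega
    have := hdeg z (hKD z hz).1 {w} hzN
    simp at this

/-! ### The exceptional configurations, and ways to produce two disjoint paths. -/

/-- `G` consists of a triangle `v, c, c'`, a further vertex `w`, and vertices whose neighbours are
`v` and `w`; the edge `v w` may be present. -/
def HasOneTriangle (G : SimpleGraph V) : Prop :=
  ∃ (v w c c' : V) (L : Finset V), [v, w, c, c'].Nodup ∧ (∀ y ∈ L, y ∉ [v, w, c, c']) ∧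
    (∀ z, z ∈ [v, w, c, c'] ∨ z ∈ L) ∧ G.Adj v c ∧ G.Adj v c' ∧ G.Adj c c' ∧
    (∀ z, G.Adj c z → z = v ∨ z = c') ∧ (∀ z, G.Adj c' z → z = v ∨ z = c) ∧
    (∀ y ∈ L, G.Adj y v ∧ G.Adj y w ∧ ∀ z, G.Adj y z → z = v ∨ z = w) ∧ 4 ≤ L.card

/-- `G` consists of triangles `v, c, c'` and `w, d, d'`, and vertices whose neighbours are
`v` and `w`; the edge `v w` may be present. -/
def HasTwoTriangles (G : SimpleGraph V) : Prop :=
  ∃ (v w c c' d d' : V) (L : Finset V), [v, w, c, c', d, d'].Nodup ∧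
    (∀ y ∈ L, y ∉ [v, w, c, c', d, d']) ∧ (∀ z, z ∈ [v, w, c, c', d, d'] ∨ z ∈ L) ∧
    G.Adj v c ∧ G.Adj v c' ∧ G.Adj c c' ∧ G.Adj w d ∧ G.Adj w d' ∧ G.Adj d d' ∧
    (∀ z, G.Adj c z → z = v ∨ z = c') ∧ (∀ z, G.Adj c' z → z = v ∨ z = c) ∧
    (∀ z, G.Adj d z → z = w ∨ z = d') ∧ (∀ z, G.Adj d' z → z = w ∨ z = d) ∧
    (∀ y ∈ L, G.Adj y v ∧ G.Adj y w ∧ ∀ z, G.Adj y z → z = v ∨ z = w) ∧ 2 ≤ L.card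

/-- `G` consists of three cliques on `h + 1` vertices and a triangle with a vertex in each of
them. -/
def HasCliqueTriangle (G : SimpleGraph V) (h : ℕ) : Prop :=
  ∃ (x : Fin 3 → V) (C : Fin 3 → Finset V), (∀ i, IsLobe G (x i) (C i)) ∧
    (∀ i, (C i).card = h) ∧ (∀ i, ∀ a ∈ C i, ∀ b, b = x i ∨ b ∈ C i → a ≠ b → G.Adj a b) ∧
    (∀ i j, i ≠ j → G.Adj (x i) (x j)) ∧ (∀ i j, x i ∉ C j) ∧
    (∀ i j, i ≠ j → Disjoint (C i) (C j)) ∧ ∀ z, ∃ i, z = x i ∨ z ∈ C i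

theorem RootedPath.join_isPathList {v : V} {C D : Finset V} {l l' : List V} (hvC : v ∉ C)
    (hd : Disjoint C D) (hl : RootedPath G v C l) (hl' : RootedPath G v D l') :
    IsPathList G (l.reverse ++ v :: l') := by
  refine hl.join hl'.1 (by simp) fun x hx hxC => ?_
  rcases List.mem_cons.1 hx with rfl | h
  · exact hvC hxC
  · exact Finset.disjoint_left.1 hd hxC (hl'.2 x h)

theorem hasTwoPaths_of_rooted {v : V} {C D : Finset V} {l l' : List V} {s t : ℕ} (hvC : v ∉ C)
    (hd : Disjoint C D) (hl : RootedPath G v C l) (hl' : RootedPath G v D l')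
    (hst : s + t ≤ l.length + 1 + l'.length) : HasTwoPaths G s t :=
  .of_isPathList (hl.join_isPathList hvC hd hl') (by simp; omega)

/-- A path through `v` that ends in `D`, and a path in the rest of `D`. -/
theorem hasTwoPaths_of_rooted_of_path {v : V} {C D : Finset V} {l l' p : List V} {s t : ℕ}
    (hvC : v ∉ C) (hvD : v ∉ D) (hd : Disjoint C D) (hl : RootedPath G v C l)
    (hl' : RootedPath G v D l') (hp : IsPathList G p) (hpD : ∀ x ∈ p, x ∈ D) (hlp : l'.Disjoint p)
    (hs : s ≤ l.length + 1 + l'.length) (ht : t ≤ p.length) : HasTwoPaths G s t := by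
  refine ⟨_, p, hl.join_isPathList hvC hd hl', hp, ?_, by simp; omega, ht⟩
  intro x hx hxp
  rcases List.mem_append.1 hx with h | h
  · exact Finset.disjoint_left.1 hd (hl.2 x (by simpa using h)) (hpD x hxp)
  · rcases List.mem_cons.1 h with rfl | h
    · exact hvD (hpD _ hxp)
    · exact hlp h hxp

theorem rootedPath_nil (v : V) (C : Finset V) : RootedPath G v C [] :=
  ⟨isPathList_singleton v, by simp⟩

theorem rootedPath_singleton {v a : V} {C : Finset V} (ha : a ∈ C) (hva : G.Adj v a) :
    RootedPath G v C [a] :=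
  ⟨⟨by simp [hva], by simp [hva.ne]⟩, by simpa using ha⟩

/-- With hubs `v` and `w` and three further vertices `a, b, c` of `D`, one path ends with `v, a` and
the other is `b, w, c`. -/
theorem hasTwoPaths_of_hub {v w : V} {C D : Finset V} {l : List V} {s : ℕ} (hvC : v ∉ C)
    (hvD : v ∉ D) (hd : Disjoint C D) (hl : RootedPath G v C l) (hw : w ∈ D)
    (hhub : ∀ y ∈ D, y ≠ w → G.Adj y v ∧ G.Adj y w ∧ ∀ z, G.Adj y z → z = v ∨ z = w)
    (h4 : 4 ≤ D.card) (hs : s ≤ l.length + 2) : HasTwoPaths G s 3 := by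
  classical
  obtain ⟨a, b, c, ha, hb, hc, hab, hac, hbc⟩ := Finset.two_lt_card_iff.1
    (show 2 < (D.erase w).card by rw [Finset.card_erase_of_mem hw]; omega)
  rw [Finset.mem_erase] at ha hb hc
  have hA := hhub a ha.2 ha.1
  have hB := hhub b hb.2 hb.1
  have hC := hhub c hc.2 hc.1
  exact hasTwoPaths_of_rooted_of_path hvC hvD hd hl (rootedPath_singleton ha.2 hA.1.symm)
    (isPathList_three hbc hB.2.1 hC.2.1.symm) (by simp [hb.2, hw, hc.2]) (by simp [hab, ha.1, hac])
    (by simpa using hs) (by simp)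

/-! ### Exactly two components, the larger one without cut vertices. -/

section Fintype
variable [Fintype V]

theorem exists_rootedPath_succ (hG : ConnSet G Finset.univ) {h : ℕ} (hdeg : MinDegGE G h) {v : V}
    {C : Finset V} (hC : IsLobe G v C) (hne : C.card ≠ h) :
    ∃ l, RootedPath G v C l ∧ h + 1 ≤ l.length := by
  obtain ⟨l, hl⟩ := exists_longestRooted G v C
  refine ⟨l, hl.1, ?_⟩
  by_contra hcon
  exact hne (hl.isClique hG (hdeg.on C) hC (by omega)).1

theorem IsLobe.isClique (hG : ConnSet G Finset.univ) {h : ℕ} (hdeg : MinDegGE G h) {v : V}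
    {C : Finset V} (hC : IsLobe G v C) (hcard : C.card = h) :
    ∀ x ∈ C, ∀ y, y = v ∨ y ∈ C → x ≠ y → G.Adj x y := by
  obtain ⟨l, hl⟩ := exists_longestRooted G v C
  exact (hl.isClique hG (hdeg.on C) hC (hcard ▸ hl.1.length_le)).2

/-- The neighbour of a vertex of degree one would be a cut vertex inside `D`; if that neighbour is
`v`, the vertex alone makes up the lobe. This lets `h = 1` be treated by the argument for degree
two. -/
theorem IsLobe.minDegOn_two {v : V} {D : Finset V} (hdeg : MinDegGE G 1) (hD : IsLobe G v D)
    (hnc : ∀ u ∈ D, NotCut G u) (h2 : 2 ≤ D.card) : MinDegOn G D 2 := by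
  classical
  intro x hx S hS
  obtain ⟨z, hxz⟩ : ∃ z, G.Adj x z := by
    by_contra! hcon
    have := hdeg x ∅ (fun y hy => absurd hy (hcon y))
    simp at this
  by_contra hlt
  have hz : ∀ y, G.Adj x y → y = z := fun y hy =>
    Finset.card_le_one.1 (by omega : S.card ≤ 1) y (hS y hy) z (hS z hxz)
  rcases hD.closed x hx z hxz with rfl | hzD
  · have := Finset.card_le_card (hD.conn {x} (by simpa using hx) (by simp) (by
      intro a ha b hb hab
      rw [Finset.mem_singleton] at ha
      subst ha
      rw [hz b hab] at hb
      exact absurd hb hD.notMem))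
    simp at this
    omega
  · have := hnc z hzD {x} (by simp) (by simpa using hxz.ne') (by
      intro a ha b hab
      rw [Finset.mem_singleton] at ha
      subst ha
      exact Or.inl (hz b hab)) v (by rintro rfl; exact hD.notMem hzD)
    rw [Finset.mem_singleton] at this
    subst this
    exact hD.notMem hx

/-- The case that `G - v` has two components, the larger of which contains no cut vertex. -/
theorem two_lobes_of_notCut (hG : ConnSet G Finset.univ) {h : ℕ} (hdeg : MinDegGE G h)
    (h1 : 1 ≤ h) {s₁ s₂ : ℕ} (hs : s₁ + s₂ = 2 * h + 4) (hle : s₂ ≤ s₁) (h3 : 3 ≤ s₂)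
    (hodd : Odd s₂) {v : V} {C D : Finset V} (hC : IsLobe G v C) (hD : IsLobe G v D)
    (hCD : C ≠ D) (hcov : ∀ x, x = v ∨ x ∈ C ∨ x ∈ D) (hcard : 2 * h + 3 ≤ C.card + D.card)
    (hCle : C.card ≤ D.card) (hnc : ∀ u ∈ D, NotCut G u) :
    HasTwoPaths G s₁ s₂ ∨ (s₁ = 5 ∧ s₂ = 3 ∧ HasOneTriangle G) := by
  classical
  have hd := hC.disjoint hD hCD
  have hCh := hC.le_card hG hdeg
  obtain ⟨l, hl⟩ := exists_longestRooted G v D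
  by_cases hc : C.card = h
  · obtain ⟨l₁, hl₁, hlen₁⟩ := exists_rootedPath_of_le hG hdeg hC
    by_cases hlong : h + 3 ≤ l.length
    · exact Or.inl (hasTwoPaths_of_rooted hC.notMem hd hl₁ hl.1 (by omega))
    -- Here `h + 3 ≤ D.card`, while `l.length ≤ h + 2`. `LongestRooted.card_le` also needs `l.length
    -- + 2 ≤ 2 * h`, which is automatic only from `h = 4` on.
    rcases (by omega : h = 1 ∨ h = 2 ∨ h = 3 ∨ 4 ≤ h) with rfl | rfl | rfl | h4
    · left
      obtain ⟨w, hw, hhub⟩ := exists_second_hub hG hD hnc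
        (hD.minDegOn_two hdeg hnc (by omega)) (by omega) (fun l' hl' => by
          have := hl.2 l' hl'; omega)
      obtain rfl : s₂ = 3 := by omega
      exact hasTwoPaths_of_hub hC.notMem hD.notMem hd hl₁ hw hhub (by omega) (by omega)
    · obtain rfl : s₂ = 3 := by obtain ⟨k, hk⟩ := hodd; omega
      obtain rfl : s₁ = 5 := by omega
      rcases (by omega : l.length = 4 ∨ l.length ≤ 3) with h4 | hl3
      · left
        rcases exists_five_or_two_three hD hnc (hdeg.on D) (by omega) hl h4 with
          ⟨p, hp, hpD, hp5⟩ | ⟨a, ha, b, hb, x, hx, y, hy, z, hz, hnd, hva, hab, hxy, hyz⟩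
        · refine ⟨p, v :: l₁, hp, hl₁.1, ?_, hp5, by simp; omega⟩
          intro x hx hxl
          rcases List.mem_cons.1 hxl with rfl | hxl
          · exact hD.notMem (hpD _ hx)
          · exact Finset.disjoint_left.1 hd (hl₁.2 x hxl) (hpD x hx)
        · simp at hnd
          have hvb : v ≠ b := fun h => hD.notMem (h ▸ hb)
          refine hasTwoPaths_of_rooted_of_path (l' := [a, b]) (p := [x, y, z]) hC.notMem hD.notMem
            hd hl₁ ⟨isPathList_three hvb hva hab, by simp [ha, hb]⟩
            (isPathList_three hnd.2.2.1.2 hxy hyz) (by simp [hx, hy, hz]) (by simp; tauto)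
            (by simp; omega) (by simp)
      · obtain ⟨w, hw, hhub⟩ := exists_second_hub hG hD hnc (hdeg.on D) (by omega)
          (fun l' hl' => (hl.2 l' hl').trans hl3)
        refine Or.inr ⟨rfl, rfl, ?_⟩
        obtain ⟨c, c', hcc, rfl⟩ := Finset.card_eq_two.1 hc
        have hcl := hC.isClique hG hdeg hc
        have hvc : v ≠ c := fun h => hC.notMem (by simp [h])
        have hvc' : v ≠ c' := fun h => hC.notMem (by simp [h])
        have hDc : ∀ y ∈ D, y ≠ c ∧ y ≠ c' := by
          intro y hy
          constructor <;> rintro rfl <;> exact Finset.disjoint_left.1 hd (by simp) hy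
        have hwv : v ≠ w := fun h => hD.notMem (h ▸ hw)
        refine ⟨v, w, c, c', D.erase w, ?_, ?_, ?_, (hcl c (by simp) v (by simp) hvc.symm).symm,
          (hcl c' (by simp) v (by simp) hvc'.symm).symm, hcl c (by simp) c' (by simp) hcc,
          ?_, ?_, ?_, ?_⟩
        · simp [hwv, hvc, hvc', hDc w hw, hcc]
        · intro y hy
          rw [Finset.mem_erase] at hy
          have : y ≠ v := fun h => hD.notMem (h ▸ hy.2)
          simp [this, hy.1, hDc y hy.2]
        · intro z
          have := hcov z
          simp only [Finset.mem_insert, Finset.mem_singleton] at this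
          simp only [List.mem_cons, List.not_mem_nil, or_false, Finset.mem_erase]
          tauto
        · intro z hz
          have := hC.closed c (by simp) z hz
          simp only [Finset.mem_insert, Finset.mem_singleton] at this
          have := hz.ne'
          tauto
        · intro z hz
          have := hC.closed c' (by simp) z hz
          simp only [Finset.mem_insert, Finset.mem_singleton] at this
          have := hz.ne'
          tauto
        · intro y hy
          rw [Finset.mem_erase] at hy
          exact hhub y hy.2 hy.1
        · rw [Finset.card_erase_of_mem hw]
          omega
    · left
      -- A path with at most four vertices in `D` would still be covered by `LongestRooted.card_le`,
      -- against `6 ≤ D.card`.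
      have hl5 : l.length = 5 := by
        by_contra hne
        have := hl.card_le hG (hdeg.on D) hD hnc (by omega) (by omega)
        omega
      obtain ⟨⟨a, ha, hva, p, hp, hpD, hp5⟩, h73⟩ :=
        exists_paths_of_longest_five hD hnc (hdeg.on D) (by omega) hl hl5
      rcases (by obtain ⟨k, hk⟩ := hodd; omega : s₂ = 5 ∨ s₂ = 3) with rfl | rfl
      · exact hasTwoPaths_of_rooted_of_path hC.notMem hD.notMem hd hl₁ (rootedPath_singleton ha hva)
          hp (fun x hx => (hpD x hx).1) (by simpa using fun h => (hpD a h).2 rfl)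
          (by simp; omega) hp5
      · rcases h73 with ⟨q, hq, hqD, hq7⟩ | ⟨l', q, hl', hl'3, hq, hqD, hlq, hq3⟩
        · refine ⟨q, l₁, hq, hl₁.1.tail, ?_, by omega, by omega⟩
          intro x hx hxl
          rcases hqD x hx with rfl | h
          · exact hC.notMem (hl₁.2 _ hxl)
          · exact Finset.disjoint_left.1 hd (hl₁.2 x hxl) h
        · exact hasTwoPaths_of_rooted_of_path hC.notMem hD.notMem hd hl₁ hl' hq hqD hlq
            (by omega) hq3
    · have := hl.card_le hG (hdeg.on D) hD hnc (by omega) (by omega)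
      omega
  · left
    -- Now `C` contributes `h + 1` vertices, so `h + 2` in `D` suffice, and the general argument
    -- already works for `h ≥ 3`.
    obtain ⟨l₁, hl₁, hlen₁⟩ := exists_rootedPath_succ hG hdeg hC hc
    by_cases hlong : h + 2 ≤ l.length
    · exact hasTwoPaths_of_rooted hC.notMem hd hl₁ hl.1 (by omega)
    rcases (by omega : h = 1 ∨ h = 2 ∨ 3 ≤ h) with rfl | rfl | hh
    · obtain ⟨x, hx, y, hy, z, hz, hxz, hxy, hyz⟩ := hD.conn.exists_path_three (by omega)
      exact hasTwoPaths_of_rooted_of_path hC.notMem hD.notMem hd hl₁ (rootedPath_nil v D)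
        (isPathList_three hxz hxy hyz) (by simp [hx, hy, hz]) (by simp) (by simp; omega)
        (by simp; omega)
    · obtain ⟨w, hw, hhub⟩ := exists_second_hub hG hD hnc (hdeg.on D) (by omega) (fun l' hl' => by
        have := hl.2 l' hl'; omega)
      obtain rfl : s₂ = 3 := by obtain ⟨k, hk⟩ := hodd; omega
      exact hasTwoPaths_of_hub hC.notMem hD.notMem hd hl₁ hw hhub (by omega) (by omega)
    · have := hl.card_le hG (hdeg.on D) hD hnc (by omega) (by omega)
      omega

end Fintype

/-! ### Two lobes at different cut vertices. -/

/-- Lobes `C₁` at `v` and `C₂` at `u` are linked by a path from `v` to `u`. -/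
theorem RootedPath.link {v u : V} {C₁ C₂ R : Finset V} {l₁ l₂ p : List V}
    (hl₁ : RootedPath G v C₁ l₁) (hp : IsPathFromTo G R v u p) (hl₂ : RootedPath G u C₂ l₂)
    (h12 : Disjoint C₁ C₂) (hR₁ : Disjoint R C₁) (hR₂ : Disjoint R C₂) :
    IsPathList G (l₁.reverse ++ (p ++ l₂)) := by
  refine hl₁.join (hp.append_rooted hl₂ hR₂) (by rw [List.head?_append, hp.2.1]; rfl) ?_
  intro x hx hxC
  rcases List.mem_append.1 hx with h | h
  · exact Finset.disjoint_left.1 hR₁ (hp.2.2.2 x h) hxC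
  · exact Finset.disjoint_left.1 h12 hxC (hl₂.2 x h)

theorem hasTwoTriangles_of_lobes {v u : V} {C₁ C₂ S : Finset V} (hC₁ : IsLobe G v C₁)
    (hC₂ : IsLobe G u C₂) (hvu : v ≠ u) (hv2 : v ∉ C₂) (hu1 : u ∉ C₁) (h12 : Disjoint C₁ C₂)
    (hc1 : C₁.card = 2) (hc2 : C₂.card = 2)
    (hcl1 : ∀ x ∈ C₁, ∀ y, y = v ∨ y ∈ C₁ → x ≠ y → G.Adj x y)
    (hcl2 : ∀ x ∈ C₂, ∀ y, y = u ∨ y ∈ C₂ → x ≠ y → G.Adj x y)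
    (hSmem : ∀ x, x ∈ S ↔ x ∉ C₁ ∧ x ∉ C₂ ∧ x ≠ u ∧ x ≠ v)
    (hall : ∀ z ∈ S, G.Adj z v ∧ G.Adj z u ∧ ∀ y, G.Adj z y → y = v ∨ y = u)
    (hScard : 2 ≤ S.card) : HasTwoTriangles G := by
  classical
  obtain ⟨c, c', hcc, rfl⟩ := Finset.card_eq_two.1 hc1
  obtain ⟨d, d', hdd, rfl⟩ := Finset.card_eq_two.1 hc2
  have hvC := hC₁.notMem
  have huC := hC₂.notMem
  simp only [Finset.mem_insert, Finset.mem_singleton, not_or] at hvC huC hv2 hu1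
  have hd1 := Finset.disjoint_left.1 h12
  simp only [Finset.mem_insert, Finset.mem_singleton] at hd1
  have hc := hd1 (Or.inl rfl)
  have hc' := hd1 (Or.inr rfl)
  simp only [not_or] at hc hc'
  have hnbr : ∀ {v c c' : V}, IsLobe G v {c, c'} → ∀ z, G.Adj c z → z = v ∨ z = c' := by
    intro v c c' hC z hz
    have := hC.closed c (by simp) z hz
    simp only [Finset.mem_insert, Finset.mem_singleton] at this
    exact this.imp_right fun h => h.resolve_left hz.ne'
  refine ⟨v, u, c, c', d, d', S, ?_, ?_, ?_, (hcl1 c (by simp) v (by simp) (Ne.symm hvC.1)).symm,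
    (hcl1 c' (by simp) v (by simp) (Ne.symm hvC.2)).symm, hcl1 c (by simp) c' (by simp) hcc,
    (hcl2 d (by simp) u (by simp) (Ne.symm huC.1)).symm,
    (hcl2 d' (by simp) u (by simp) (Ne.symm huC.2)).symm, hcl2 d (by simp) d' (by simp) hdd,
    hnbr hC₁, hnbr (Finset.pair_comm c c' ▸ hC₁), hnbr hC₂, hnbr (Finset.pair_comm d d' ▸ hC₂),
    hall, hScard⟩
  · simp [hvu, hvC, hv2, hu1, huC, hc, hc', hcc, hdd]
  · intro y hy
    have := (hSmem y).1 hy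
    simp only [Finset.mem_insert, Finset.mem_singleton, not_or] at this
    simp only [List.mem_cons, List.not_mem_nil, or_false, not_or]
    exact ⟨this.2.2.2, this.2.2.1, this.1.1, this.1.2, this.2.1.1, this.2.1.2⟩
  · intro z
    by_contra hcon
    simp only [hSmem, Finset.mem_insert, Finset.mem_singleton, List.mem_cons,
      List.not_mem_nil, or_false, not_or] at hcon
    obtain ⟨⟨z1, z2, z3, z4, z5, z6⟩, hz⟩ := hcon
    exact hz ⟨⟨z3, z4⟩, ⟨z5, z6⟩, z2, z1⟩

theorem hasCliqueTriangle_of_lobes {h : ℕ} {v u w : V} {C₁ C₂ T : Finset V} (hC₁ : IsLobe G v C₁)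
    (hC₂ : IsLobe G u C₂) (hT : IsLobe G w T) (hc1 : C₁.card = h) (hc2 : C₂.card = h)
    (hTh : T.card = h) (hcl1 : ∀ x ∈ C₁, ∀ y, y = v ∨ y ∈ C₁ → x ≠ y → G.Adj x y)
    (hcl2 : ∀ x ∈ C₂, ∀ y, y = u ∨ y ∈ C₂ → x ≠ y → G.Adj x y)
    (hclT : ∀ x ∈ T, ∀ y, y = w ∨ y ∈ T → x ≠ y → G.Adj x y)
    (hvu : G.Adj v u) (hvw : G.Adj v w) (huw : G.Adj u w) (hv2 : v ∉ C₂) (hvT : v ∉ T)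
    (hu1 : u ∉ C₁) (huT : u ∉ T) (hw1 : w ∉ C₁) (hw2 : w ∉ C₂) (h12 : Disjoint C₁ C₂)
    (hT1 : Disjoint C₁ T) (hT2 : Disjoint C₂ T)
    (hcov : ∀ z, (z = v ∨ z ∈ C₁) ∨ (z = u ∨ z ∈ C₂) ∨ (z = w ∨ z ∈ T)) :
    HasCliqueTriangle G h := by
  refine ⟨![v, u, w], ![C₁, C₂, T], ?_, ?_, ?_, ?_, ?_, ?_, ?_⟩
  · intro i; fin_cases i
    · exact hC₁
    · exact hC₂
    · exact hT
  · intro i; fin_cases i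
    · exact hc1
    · exact hc2
    · exact hTh
  · intro i; fin_cases i
    · exact hcl1
    · exact hcl2
    · exact hclT
  · intro i j; fin_cases i <;> fin_cases j <;> simp [hvu, hvu.symm, hvw, hvw.symm, huw, huw.symm]
  · intro i j; fin_cases i <;> fin_cases j <;> simp [hC₁.notMem, hC₂.notMem, hT.notMem, hv2, hu1,
      hw1, hw2, huT, hvT]
  · intro i j; fin_cases i <;> fin_cases j <;> simp [h12, h12.symm, hT1, hT2, hT1.symm, hT2.symm]
  · intro z
    rcases hcov z with h | h | h
    · exact ⟨0, h⟩
    · exact ⟨1, h⟩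
    · exact ⟨2, h⟩

section Fintype
variable [Fintype V]

theorem card_le_of_cover {v : V} {C D : Finset V} (hcov : ∀ x, x = v ∨ x ∈ C ∨ x ∈ D) :
    Fintype.card V ≤ C.card + D.card + 1 := by
  classical
  have : (Finset.univ : Finset V) ⊆ insert v (C ∪ D) := by
    intro x _
    have := hcov x
    simpa using this
  have h1 := Finset.card_le_card this
  have h2 := Finset.card_insert_le v (C ∪ D)
  have h3 := Finset.card_union_le C D
  rw [Finset.card_univ] at h1
  omega

set_option maxHeartbeats 1000000 in
/-- Two lobes with different centres, `C₂` containing no cut vertex. -/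
theorem two_lobes_of_two_centres (hG : ConnSet G Finset.univ) {h : ℕ} (hdeg : MinDegGE G h)
    (h1 : 1 ≤ h) {s₁ s₂ : ℕ} (hs : s₁ + s₂ = 2 * h + 4) (hle : s₂ ≤ s₁) (h3 : 3 ≤ s₂)
    (hodd : Odd s₂) (h2L : AtMostTwoLobes G) (hn : 2 * h + 4 ≤ Fintype.card V)
    {v u : V} {C₁ C₂ : Finset V} (hC₁ : IsLobe G v C₁) (hC₂ : IsLobe G u C₂) (hvu : v ≠ u)
    (hv2 : v ∉ C₂) (hu1 : u ∉ C₁) (h12 : Disjoint C₁ C₂) (hcard : C₁.card ≤ C₂.card)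
    (hnc : ∀ z ∈ C₂, NotCut G z) :
    HasTwoPaths G s₁ s₂ ∨ (s₁ = 5 ∧ s₂ = 3 ∧ (HasOneTriangle G ∨ HasTwoTriangles G)) ∨
      (s₂ = h + 2 ∧ HasCliqueTriangle G h) := by
  classical
  set R : Finset V := Finset.univ.filter fun x => x ∉ C₁ ∧ x ∉ C₂ with hR
  set S : Finset V := Finset.univ.filter fun x => x ∉ C₁ ∧ x ∉ C₂ ∧ x ≠ u ∧ x ≠ v with hS
  have hRmem : ∀ x, x ∈ R ↔ x ∉ C₁ ∧ x ∉ C₂ := by simp [hR]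
  have hSmem : ∀ x, x ∈ S ↔ x ∉ C₁ ∧ x ∉ C₂ ∧ x ≠ u ∧ x ≠ v := by simp [hS]
  have hSR : S ⊆ R := fun x hx => (hRmem x).2 ⟨((hSmem x).1 hx).1, ((hSmem x).1 hx).2.1⟩
  have hvR : v ∈ R := (hRmem v).2 ⟨hC₁.notMem, hv2⟩
  have huR : u ∈ R := (hRmem u).2 ⟨hu1, hC₂.notMem⟩
  have hR1 : Disjoint R C₁ := Finset.disjoint_left.2 fun x hx => ((hRmem x).1 hx).1
  have hR2 : Disjoint R C₂ := Finset.disjoint_left.2 fun x hx => ((hRmem x).1 hx).2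
  have hh1 := hC₁.le_card hG hdeg
  have hh2 := hC₂.le_card hG hdeg
  have hlink : ∀ l₁ l₂ p, RootedPath G v C₁ l₁ → RootedPath G u C₂ l₂ → IsPathFromTo G R v u p →
      2 * h + 4 ≤ l₁.length + p.length + l₂.length → HasTwoPaths G s₁ s₂ := by
    intro l₁ l₂ p hl₁ hl₂ hp hlen
    exact .of_isPathList (hl₁.link hp hl₂ h12 hR1 hR2) (by simp; omega)
  by_cases hSe : S = ∅
  · have hcov : ∀ x, x = u ∨ x = v ∨ x ∈ C₁ ∨ x ∈ C₂ := by
      intro x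
      by_contra hcon
      have : x ∈ S := (hSmem x).2 (by tauto)
      simp [hSe] at this
    obtain ⟨C', hC', hvC'⟩ := exists_isLobe (G := G) hvu
    have hne : C' ≠ C₂ := by rintro rfl; exact hv2 hvC'
    have hC'sub : C' ⊆ insert v C₁ := by
      intro x hx
      have h1 : x ∉ C₂ := fun h => Finset.disjoint_left.1 (hC'.disjoint hC₂ hne) hx h
      have h2 : x ≠ u := fun h => hC'.notMem (h ▸ hx)
      have := hcov x
      rw [Finset.mem_insert]
      tauto
    have hc' := (Finset.card_le_card hC'sub).trans (Finset.card_insert_le _ _)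
    have hcov' := h2L u C' C₂ hC' hC₂ hne
    have hn' := card_le_of_cover hcov'
    -- The lobe `C'` of `u` lies in `C₁ ∪ {v}`. If `C₁` has `h` vertices, the case of two lobes at
    -- the single vertex `u` applies; otherwise the path through the edge `v u` has `(h + 1) + 2 +
    -- (h + 1)` vertices.
    by_cases hc : C₁.card = h
    · rcases two_lobes_of_notCut hG hdeg h1 hs hle h3 hodd hC' hC₂ hne hcov' (by omega) (by omega)
        hnc with h | ⟨e1, e2, h⟩
      · exact Or.inl h
      · exact Or.inr (Or.inl ⟨e1, e2, Or.inl h⟩)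
    · left
      obtain ⟨l₁, hl₁, hlen₁⟩ := exists_rootedPath_succ hG hdeg hC₁ hc
      obtain ⟨l₂, hl₂, hlen₂⟩ := exists_rootedPath_succ hG hdeg hC₂ (by omega)
      have huv : G.Adj v u := by
        obtain ⟨x, hx, hux⟩ := hC'.exists_adj hG
        rcases Finset.mem_insert.1 (hC'sub hx) with rfl | hx1
        · exact hux.symm
        · rcases hC₁.closed x hx1 u hux.symm with h | h
          · exact absurd h.symm hvu
          · exact absurd h hu1
      exact hlink l₁ l₂ [v, u] hl₁ hl₂ ⟨⟨by simp [huv], by simp [hvu]⟩, by simp, by simp,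
        by simp [hvR, huR]⟩ (by simp; omega)
  -- components of `S`
  have hSnbr : ∀ x ∈ S, ∀ y, G.Adj x y → y ∈ S ∨ y = u ∨ y = v := by
    intro x hx y hxy
    have hx' := (hSmem x).1 hx
    by_contra hcon
    push Not at hcon
    have : y ∈ C₁ ∨ y ∈ C₂ := by
      by_contra h
      exact hcon.1 ((hSmem y).2 ⟨fun h' => h (Or.inl h'), fun h' => h (Or.inr h'), hcon.2⟩)
    rcases this with h | h
    · rcases hC₁.closed y h x hxy.symm with h | h
      · exact hx'.2.2.2 h
      · exact hx'.1 h
    · rcases hC₂.closed y h x hxy.symm with h | h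
      · exact hx'.2.2.1 h
      · exact hx'.2.1 h
  -- A component of `S` joined to only one of `u` and `v` would be a third lobe there.
  have hcomp : ∀ z ∈ S, ∃ K ⊆ S, z ∈ K ∧ ConnSet G K ∧
      (∀ x ∈ K, ∀ y, G.Adj x y → y ∈ K ∨ y = u ∨ y = v) ∧ (∃ a ∈ K, G.Adj v a) ∧
      ∃ b ∈ K, G.Adj u b := by
    intro z hz
    obtain ⟨K, hKS, hzK, hconn, hcl⟩ := exists_component (G := G) hz
    have hcl' : ∀ x ∈ K, ∀ y, G.Adj x y → y ∈ K ∨ y = u ∨ y = v := by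
      intro x hx y hxy
      rcases hSnbr x (hKS hx) y hxy with h | h
      · exact Or.inl (hcl x hx y h hxy)
      · exact Or.inr h
    have hKu : u ∉ K := fun h => ((hSmem u).1 (hKS h)).2.2.1 rfl
    have hKv : v ∉ K := fun h => ((hSmem v).1 (hKS h)).2.2.2 rfl
    refine ⟨K, hKS, hzK, hconn, hcl', ?_, ?_⟩
    · by_contra! hcon
      have hlobe : IsLobe G u K := ⟨hKu, ⟨z, hzK⟩, fun x hx y hxy => by
        rcases hcl' x hx y hxy with h | rfl | rfl
        · exact Or.inr h
        · exact Or.inl rfl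
        · exact absurd hxy.symm (hcon x hx), hconn⟩
      rcases h2L u K C₂ hlobe hC₂ (by rintro rfl; exact ((hSmem z).1 hz).2.1 hzK) v with h | h | h
      · exact hvu h
      · exact hKv h
      · exact hv2 h
    · by_contra! hcon
      have hlobe : IsLobe G v K := ⟨hKv, ⟨z, hzK⟩, fun x hx y hxy => by
        rcases hcl' x hx y hxy with h | rfl | rfl
        · exact Or.inr h
        · exact absurd hxy.symm (hcon x hx)
        · exact Or.inl rfl, hconn⟩
      rcases h2L v K C₁ hlobe hC₁ (by rintro rfl; exact ((hSmem z).1 hz).1 hzK) u with h | h | h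
      · exact hvu h.symm
      · exact hKu h
      · exact hu1 h
  have hthrough : ∀ K ⊆ S, ConnSet G K → ∀ a ∈ K, ∀ b ∈ K, G.Adj v a → G.Adj u b →
      ∃ p, IsPathFromTo G R v u p ∧ 3 ≤ p.length ∧ (a ≠ b → 4 ≤ p.length) := by
    intro K hKS hK a ha b hb hva hub
    obtain ⟨p, hp⟩ := hK.exists_isPathFromTo ha hb
    have h1 : IsPathFromTo G {v} v v [v] := isPathFromTo_singleton (by simp)
    have h2 : IsPathFromTo G {u} u u [u] := isPathFromTo_singleton (by simp)
    have h3 := (h1.append hp (by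
      rw [Finset.disjoint_singleton_left]
      exact fun h => ((hSmem v).1 (hKS h)).2.2.2 rfl) hva).append h2 (by
      rw [Finset.disjoint_singleton_right, Finset.mem_union, Finset.mem_singleton, not_or]
      exact ⟨hvu.symm, fun h => ((hSmem u).1 (hKS h)).2.2.1 rfl⟩) hub.symm
    have hp1 : 1 ≤ p.length := List.length_pos_of_mem (List.mem_of_getLast? hp.2.2.1)
    refine ⟨_, h3.mono ?_, by simp; omega, fun hab => ?_⟩
    · intro x hx
      simp only [Finset.mem_union, Finset.mem_singleton] at hx
      rcases hx with (rfl | hx) | rfl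
      · exact hvR
      · exact hSR (hKS hx)
      · exact huR
    · have := hp.two_le_length hab
      simp; omega
  -- The link through a component of `S` has at least three vertices, so one additional vertex from
  -- `C₁` or `C₂` already gives `2h + 4`.
  by_cases hcc : C₁.card = h ∧ C₂.card = h
  swap
  · left
    obtain ⟨z, hz⟩ := Finset.nonempty_iff_ne_empty.2 hSe
    obtain ⟨K, hKS, hzK, hconn, -, ⟨a, ha, hva⟩, ⟨b, hb, hub⟩⟩ := hcomp z hz
    obtain ⟨p, hp, hp3, -⟩ := hthrough K hKS hconn a ha b hb hva hub
    by_cases hc : C₁.card = h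
    · obtain ⟨l₁, hl₁, hlen₁⟩ := exists_rootedPath_of_le hG hdeg hC₁
      obtain ⟨l₂, hl₂, hlen₂⟩ := exists_rootedPath_succ hG hdeg hC₂ (fun h => hcc ⟨hc, h⟩)
      exact hlink l₁ l₂ p hl₁ hl₂ hp (by omega)
    · obtain ⟨l₁, hl₁, hlen₁⟩ := exists_rootedPath_succ hG hdeg hC₁ hc
      obtain ⟨l₂, hl₂, hlen₂⟩ := exists_rootedPath_of_le hG hdeg hC₂
      exact hlink l₁ l₂ p hl₁ hl₂ hp (by omega)
  obtain ⟨hc1, hc2⟩ := hcc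
  by_contra hgoal
  push Not at hgoal
  obtain ⟨hno, hnoT, hnoC⟩ := hgoal
  obtain ⟨l₁, hl₁, hlen₁⟩ := exists_rootedPath_of_le hG hdeg hC₁
  obtain ⟨l₂, hl₂, hlen₂⟩ := exists_rootedPath_of_le hG hdeg hC₂
  have hScard : 2 ≤ S.card := by
    have h1 : (Finset.univ : Finset V) ⊆ insert u (insert v (C₁ ∪ (C₂ ∪ S))) := by
      intro x _
      simp only [Finset.mem_insert, Finset.mem_union, hSmem]
      tauto
    have h2 := Finset.card_le_card h1
    have h3 := Finset.card_insert_le u (insert v (C₁ ∪ (C₂ ∪ S)))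
    have h4 := Finset.card_insert_le v (C₁ ∪ (C₂ ∪ S))
    have h5 := Finset.card_union_le C₁ (C₂ ∪ S)
    have h6 := Finset.card_union_le C₂ S
    rw [Finset.card_univ] at h2
    omega
  have hcomp' : ∀ z ∈ S, ∃ K w, K ⊆ S ∧ z ∈ K ∧ ConnSet G K ∧ w ∈ K ∧ G.Adj v w ∧ G.Adj u w ∧
      ∀ x ∈ K, ∀ y, G.Adj x y → y ∈ K ∨ x = w ∧ (y = u ∨ y = v) := by
    intro z hz
    obtain ⟨K, hKS, hzK, hconn, hcl, ⟨a, ha, hva⟩, ⟨b, hb, hub⟩⟩ := hcomp z hz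
    -- Distinct attachments would give a link with four vertices, and `h + 4 + h` is enough. So `u`
    -- and `v` see the same single vertex of `K`.
    have heq : ∀ a ∈ K, ∀ b ∈ K, G.Adj v a → G.Adj u b → a = b := by
      intro a ha b hb hva hub
      by_contra hab
      obtain ⟨p, hp, -, hp4⟩ := hthrough K hKS hconn a ha b hb hva hub
      exact hno (hlink l₁ l₂ p hl₁ hl₂ hp (by have := hp4 hab; omega))
    obtain rfl := heq a ha b hb hva hub
    refine ⟨K, a, hKS, hzK, hconn, ha, hva, hub, fun x hx y hxy => ?_⟩
    rcases hcl x hx y hxy with h | rfl | rfl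
    · exact Or.inl h
    · exact Or.inr ⟨(heq a ha x hx hva hxy.symm).symm, Or.inl rfl⟩
    · exact Or.inr ⟨heq x hx a ha hxy.symm hub, Or.inr rfl⟩
  have huv1 : u ∉ S := fun h => ((hSmem u).1 h).2.2.1 rfl
  have hvv1 : v ∉ S := fun h => ((hSmem v).1 h).2.2.2 rfl
  have hS1 : ∀ x ∈ S, x ∉ C₁ := fun x hx => ((hSmem x).1 hx).1
  have hS2 : ∀ x ∈ S, x ∉ C₂ := fun x hx => ((hSmem x).1 hx).2.1
  have hl₁mem : ∀ x ∈ v :: l₁, x = v ∨ x ∈ C₁ := fun x hx => by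
    rcases List.mem_cons.1 hx with h | h
    · exact Or.inl h
    · exact Or.inr (hl₁.2 x h)
  have hl₂mem : ∀ x ∈ u :: l₂, x = u ∨ x ∈ C₂ := fun x hx => by
    rcases List.mem_cons.1 hx with h | h
    · exact Or.inl h
    · exact Or.inr (hl₂.2 x h)
  have hd12 : ∀ x, x = v ∨ x ∈ C₁ → x = u ∨ x ∈ C₂ → False := by
    rintro x (rfl | h) (h' | h')
    · exact hvu h'
    · exact hv2 h'
    · exact hu1 (h' ▸ h)
    · exact Finset.disjoint_left.1 h12 h h'
  have hv1S : ∀ x ∈ S, ¬ (x = v ∨ x ∈ C₁) := by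
    rintro x hx (rfl | h)
    · exact hvv1 hx
    · exact hS1 x hx h
  have hu2S : ∀ x ∈ S, ¬ (x = u ∨ x ∈ C₂) := by
    rintro x hx (rfl | h)
    · exact huv1 hx
    · exact hS2 x hx h
  -- If `S` consists of vertices with neighbours `u` and `v` only, then `h ≤ 2`. For `h = 1` two of
  -- them start disjoint paths into `C₁` and `C₂`; for `h = 2` the lobes supply the two triangles.
  by_cases hall : ∀ z ∈ S, G.Adj z v ∧ G.Adj z u ∧ ∀ y, G.Adj z y → y = v ∨ y = u
  · obtain ⟨z, z', hz, hz', hzz'⟩ := Finset.one_lt_card_iff.1 (show 1 < S.card by omega)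
    have hh : h ≤ 2 := by
      have := hdeg z {v, u} (fun y hy => by
        have := (hall z hz).2.2 y hy
        simpa using this)
      exact this.trans Finset.card_le_two
    rcases (by omega : h = 1 ∨ h = 2) with rfl | rfl
    · refine hno ⟨z :: v :: l₁, z' :: u :: l₂, isPathList_cons.2 ⟨fun h => hv1S z hz (hl₁mem z h),
        hl₁.1, by simpa using (hall z hz).1⟩, isPathList_cons.2 ⟨fun h => hu2S z' hz' (hl₂mem z' h),
        hl₂.1, by simpa using (hall z' hz').2.1⟩, ?_, by simp; omega, by simp; omega⟩
      intro x hx hx'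
      rcases List.mem_cons.1 hx with rfl | hx
      · rcases List.mem_cons.1 hx' with h | hx'
        · exact hzz' h
        · exact hu2S x hz (hl₂mem x hx')
      · rcases List.mem_cons.1 hx' with rfl | hx'
        · exact hv1S x hz' (hl₁mem x hx)
        · exact hd12 x (hl₁mem x hx) (hl₂mem x hx')
    · obtain rfl : s₂ = 3 := by obtain ⟨k, hk⟩ := hodd; omega
      obtain rfl : s₁ = 5 := by omega
      refine (hnoT rfl rfl).2 ?_
      exact hasTwoTriangles_of_lobes hC₁ hC₂ hvu hv2 hu1 h12 hc1 hc2 (hC₁.isClique hG hdeg hc1)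
        (hC₂.isClique hG hdeg hc2) hSmem hall hScard
  -- some component of `S` has a vertex that is not attached to `u` and `v`
  obtain ⟨z₀, hz₀, hz₀'⟩ : ∃ z ∈ S, ¬ (G.Adj z v ∧ G.Adj z u ∧ ∀ y, G.Adj z y → y = v ∨ y = u) := by
    by_contra! hcon
    exact hall fun z hz => hcon z hz
  obtain ⟨K, w, hKS, hzK, hconn, hwK, hvw, huw, hKcl⟩ := hcomp' z₀ hz₀
  have hTne : (K.erase w).Nonempty := by
    by_contra hemp
    rw [Finset.not_nonempty_iff_eq_empty] at hemp
    have hK : ∀ x ∈ K, x = w := by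
      intro x hx
      by_contra hxw
      have : x ∈ K.erase w := Finset.mem_erase.2 ⟨hxw, hx⟩
      rw [hemp] at this
      simp at this
    obtain rfl := hK z₀ hzK
    refine hz₀' ⟨hvw.symm, huw.symm, fun y hy => ?_⟩
    rcases hKcl z₀ hzK y hy with h | ⟨-, h | h⟩
    · exact absurd (hK y h) hy.ne'
    · exact Or.inr h
    · exact Or.inl h
  have hwS : w ∈ S := hKS hwK
  have hvK : v ∉ K := fun h => hvv1 (hKS h)
  have huK : u ∉ K := fun h => huv1 (hKS h)
  have hTcl : ∀ x ∈ K.erase w, ∀ y, G.Adj x y → y = w ∨ y ∈ K.erase w := by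
    intro x hx y hxy
    obtain ⟨hxw, hxK⟩ := Finset.mem_erase.1 hx
    by_cases hyw : y = w
    · exact Or.inl hyw
    · rcases hKcl x hxK y hxy with h | h
      · exact Or.inr (Finset.mem_erase.2 ⟨hyw, h⟩)
      · exact absurd h.1 hxw
  have hsubT : ∀ T', IsLobe G w T' → ∀ x ∈ K.erase w, x ∈ T' → T' ⊆ K.erase w := by
    intro T' hT' x hx hxT
    refine (hT'.conn (T' ∩ K.erase w) Finset.inter_subset_left
      ⟨x, Finset.mem_inter.2 ⟨hxT, hx⟩⟩ ?_).trans Finset.inter_subset_right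
    intro a ha b hb hab
    rw [Finset.mem_inter] at ha ⊢
    refine ⟨hb, (hTcl a ha.2 b hab).resolve_left ?_⟩
    rintro rfl
    exact hT'.notMem hb
  -- The vertex `w` separates the rest of `K` from `v`. It has only two lobes, so the rest of `K` is
  -- a single lobe `T`, and `u` and `v` lie in the other one.
  obtain ⟨T', hT', hvT'⟩ := exists_isLobe (G := G) hvw.ne
  obtain ⟨t, ht⟩ := hTne
  obtain ⟨T, hT, htT⟩ := exists_isLobe (G := G) (v := w) (x := t) (Finset.ne_of_mem_erase ht)
  have hTsub := hsubT T hT t ht htT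
  have hTT' : T ≠ T' := by
    rintro rfl
    exact hvK (Finset.mem_of_mem_erase (hTsub hvT'))
  have hcovT := h2L w T T' hT hT' hTT'
  have hKT : ∀ x ∈ K, x = w ∨ x ∈ T := by
    intro x hx
    rcases hcovT x with h | h | h
    · exact Or.inl h
    · exact Or.inr h
    · by_cases hxw : x = w
      · exact Or.inl hxw
      · exact absurd (Finset.mem_of_mem_erase
          (hsubT T' hT' x (Finset.mem_erase.2 ⟨hxw, hx⟩) h hvT')) hvK
  have hTK : T ⊆ K := hTsub.trans (Finset.erase_subset _ _)
  have hTS : T ⊆ S := hTK.trans hKS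
  obtain ⟨lT, hlT, hlenT⟩ := exists_rootedPath_of_le hG hdeg hT
  have hlTS : ∀ x ∈ w :: lT, x ∈ S := by
    intro x hx
    rcases List.mem_cons.1 hx with rfl | h
    · exact hwS
    · exact hTS (hlT.2 x h)
  have hjoin : ∀ (u : V) (l : List V), G.Adj u w → IsPathList G (u :: l) →
      (∀ x ∈ u :: l, x ∉ S) → IsPathList G (lT.reverse ++ w :: u :: l) := by
    intro u l huw hul hulS
    refine hlT.join (isPathList_cons.2 ⟨fun h => hulS w h hwS, hul, by simpa using huw.symm⟩)
      (by simp) ?_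
    intro x hx hxT
    rcases List.mem_cons.1 hx with rfl | h
    · exact hT.notMem hxT
    · exact hulS x h (hTS hxT)
  have hmemjoin : ∀ (u : V) (l : List V), ∀ x ∈ lT.reverse ++ w :: u :: l, x ∈ K ∨ x ∈ u :: l := by
    intro u l x hx
    rcases List.mem_append.1 hx with h | h
    · exact Or.inl (hTK (hlT.2 x (by simpa using h)))
    · rcases List.mem_cons.1 h with rfl | h
      · exact Or.inl hwK
      · exact Or.inr h
  have hs1 : s₁ ≤ 2 * h + 1 := by omega
  -- The path through `T, w, u, C₂` has at least `2h + 2` vertices, and `v` with `C₁` gives `h + 1`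
  -- more. This leaves only `s₁ = s₂ = h + 2`.
  by_cases hs2 : s₂ ≤ h + 1
  · refine hno ⟨_, v :: l₁, hjoin u l₂ huw hl₂.1 (fun x hx hxS => hu2S x hxS (hl₂mem x hx)), hl₁.1,
      ?_, by simp; omega, by simp; omega⟩
    intro x hx hx'
    rcases hmemjoin u l₂ x hx with h | h
    · exact hv1S x (hKS h) (hl₁mem x hx')
    · exact hd12 x (hl₁mem x hx') (hl₂mem x h)
  obtain rfl : s₂ = h + 2 := by omega
  obtain rfl : s₁ = h + 2 := by omega
  have huT' : u ∈ T' := by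
    rcases hcovT u with h | h | h
    · exact absurd h huw.ne
    · exact absurd (hTK h) huK
    · exact h
  -- a path from `v` to `u` that avoids `K`
  obtain ⟨p, hp⟩ : ∃ p, IsPathFromTo G (R \ K) v u p := by
    obtain ⟨K', hK', hvK', hconn', hcl'⟩ := exists_component (G := G) (S := R \ K) (x := v)
      (Finset.mem_sdiff.2 ⟨hvR, hvK⟩)
    suffices h : u ∈ K' by
      obtain ⟨p, hp⟩ := hconn'.exists_isPathFromTo hvK' h
      exact ⟨p, hp.mono hK'⟩
    by_contra huK'
    have := hT'.conn (T' ∩ (K' ∪ C₁)) Finset.inter_subset_left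
      ⟨v, by simp [hvT', hvK']⟩ (by
        intro a ha b hb hab
        rw [Finset.mem_inter] at ha ⊢
        refine ⟨hb, ?_⟩
        rw [Finset.mem_union] at ha ⊢
        rcases ha.2 with haK | haC
        · have haR := Finset.mem_sdiff.1 (hK' haK)
          by_cases hb1 : b ∈ C₁
          · exact Or.inr hb1
          by_cases hb2 : b ∈ C₂
          · rcases hC₂.closed b hb2 a hab.symm with rfl | h
            · exact absurd haK huK'
            · exact absurd h ((hRmem a).1 haR.1).2
          by_cases hbK : b ∈ K
          · rcases hKT b hbK with rfl | h
            · exact absurd hb hT'.notMem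
            · exact absurd hb (Finset.disjoint_left.1 (hT.disjoint hT' hTT') h)
          · exact Or.inl (hcl' a haK b (Finset.mem_sdiff.2 ⟨(hRmem b).2 ⟨hb1, hb2⟩, hbK⟩) hab)
        · rcases hC₁.closed a haC b hab with rfl | h
          · exact Or.inl hvK'
          · exact Or.inr h) huT'
    rw [Finset.mem_inter, Finset.mem_union] at this
    rcases this.2 with h | h
    · exact huK' h
    · exact hu1 h
  -- If `T` has more than `h` vertices, `w` and `T` give a path on `h + 2`, disjoint from the path
  -- from `C₁` to `C₂` that avoids `K`.
  by_cases hTh : T.card = h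
  swap
  · obtain ⟨lT', hlT', hlenT'⟩ := exists_rootedPath_succ hG hdeg hT hTh
    refine hno ⟨w :: lT', _, hlT'.1, hl₁.link (hp.mono Finset.sdiff_subset) hl₂ h12 hR1 hR2, ?_,
      by simp; omega, by
        have := hp.two_le_length hvu
        simp; omega⟩
    intro x hx hx'
    have hxK : x ∈ K := by
      rcases List.mem_cons.1 hx with rfl | h
      · exact hwK
      · exact hTK (hlT'.2 x h)
    rcases List.mem_append.1 hx' with h | h
    · exact hS1 x (hKS hxK) (hl₁.2 x (by simpa using h))
    · rcases List.mem_append.1 h with h | h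
      · exact (Finset.mem_sdiff.1 (hp.2.2.2 x h)).2 hxK
      · exact hS2 x (hKS hxK) (hl₂.2 x h)
  -- If `K` is all of `S`, a path from `v` to `u` avoiding `K` can only be the edge `v u`, which
  -- closes the triangle `v, u, w`. A further component with attachment `w'` would give disjoint
  -- paths through `T, w, v, C₁` and `w', u, C₂`.
  by_cases hSK : S ⊆ K
  · refine hnoC rfl ?_
    have huvadj : G.Adj v u := by
      obtain ⟨⟨hch, hnd⟩, hhd, hlast, hmem⟩ := hp
      rcases p with _ | ⟨a, _ | ⟨b, q⟩⟩
      · simp at hhd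
      · simp at hhd hlast
        exact absurd (hhd.symm.trans hlast) hvu
      · obtain rfl : a = v := by simpa using hhd
        have hab : G.Adj a b := by simp at hch; exact hch.1
        have hb := Finset.mem_sdiff.1 (hmem b (by simp))
        have : b = u := by
          by_contra hbu
          exact hb.2 (hSK ((hSmem b).2 ⟨((hRmem b).1 hb.1).1, ((hRmem b).1 hb.1).2, hbu, hab.ne'⟩))
        exact this ▸ hab
    refine hasCliqueTriangle_of_lobes hC₁ hC₂ hT hc1 hc2 hTh (hC₁.isClique hG hdeg hc1)
      (hC₂.isClique hG hdeg hc2) (hT.isClique hG hdeg hTh) huvadj hvw huw hv2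
      (fun h => hvK (hTK h)) hu1 (fun h => huK (hTK h)) (hS1 w hwS) (hS2 w hwS) h12
      (Finset.disjoint_left.2 fun x hx hxT => hS1 x (hTS hxT) hx)
      (Finset.disjoint_left.2 fun x hx hxT => hS2 x (hTS hxT) hx) fun z => ?_
    by_cases hzS : z ∈ S
    · exact Or.inr (Or.inr (hKT z (hSK hzS)))
    · rw [hSmem] at hzS
      by_cases h1 : z = v ∨ z ∈ C₁
      · exact Or.inl h1
      · by_cases h2 : z = u ∨ z ∈ C₂
        · exact Or.inr (Or.inl h2)
        · rw [not_or] at h1 h2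
          exact absurd ⟨h1.2, h2.2, h2.1, h1.1⟩ hzS
  · obtain ⟨z', hz', hzK'⟩ := Finset.not_subset.1 hSK
    obtain ⟨K', w', hKS', hzK'', hconn', hwK', hvw', huw', hKcl'⟩ := hcomp' z' hz'
    have hw'K : w' ∉ K := by
      intro hw'
      have := hconn' (K' ∩ K) Finset.inter_subset_left ⟨w', Finset.mem_inter.2 ⟨hwK', hw'⟩⟩ (by
        intro a ha b hb hab
        rw [Finset.mem_inter] at ha ⊢
        refine ⟨hb, (hKcl a ha.2 b hab).resolve_right ?_⟩
        rintro ⟨-, rfl | rfl⟩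
        · exact huv1 (hKS' hb)
        · exact hvv1 (hKS' hb)) hzK''
      exact hzK' (Finset.mem_inter.1 this).2
    have hw'S := hKS' hwK'
    refine hno ⟨_, w' :: u :: l₂, hjoin v l₁ hvw hl₁.1 (fun x hx hxS => hv1S x hxS (hl₁mem x hx)),
      isPathList_cons.2 ⟨fun h => hu2S w' hw'S (hl₂mem w' h), hl₂.1, by simpa using huw'.symm⟩,
      ?_, by simp; omega, by simp; omega⟩
    intro x hx hx'
    rcases hmemjoin v l₁ x hx with h | h
    · rcases List.mem_cons.1 hx' with rfl | hx'
      · exact hw'K h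
      · exact hu2S x (hKS h) (hl₂mem x hx')
    · rcases List.mem_cons.1 hx' with rfl | hx'
      · exact hv1S x hw'S (hl₁mem x h)
      · exact hd12 x (hl₁mem x h) (hl₂mem x hx')

/-- The case that `G - v` has at most two components for every vertex `v`. -/
theorem two_lobes (hG : ConnSet G Finset.univ) {h : ℕ} (hdeg : MinDegGE G h)
    (h1 : 1 ≤ h) {s₁ s₂ : ℕ} (hs : s₁ + s₂ = 2 * h + 4) (hle : s₂ ≤ s₁) (h3 : 3 ≤ s₂)
    (hodd : Odd s₂) (h2L : AtMostTwoLobes G) (hn : 2 * h + 4 ≤ Fintype.card V)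
    (hcut : ∃ v, ¬ NotCut G v) :
    HasTwoPaths G s₁ s₂ ∨ (s₁ = 5 ∧ s₂ = 3 ∧ (HasOneTriangle G ∨ HasTwoTriangles G)) ∨
      (s₂ = h + 2 ∧ HasCliqueTriangle G h) := by
  classical
  obtain ⟨v₀, hv₀⟩ := hcut
  obtain ⟨C₀, -, hC₀, -, -⟩ := not_notCut_iff.1 hv₀
  -- Minimality over the lobes of all cut vertices yields both size comparisons needed below, with
  -- `D` and with the end lobe `C₂`.
  obtain ⟨⟨v, C⟩, hvC, hmin⟩ := Finset.exists_min_image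
    ((Finset.univ : Finset (V × Finset V)).filter fun q => ¬ NotCut G q.1 ∧ IsLobe G q.1 q.2)
    (fun q => q.2.card) ⟨(v₀, C₀), by simp [hv₀, hC₀]⟩
  obtain ⟨-, hv, hC⟩ := Finset.mem_filter.1 hvC
  replace hC : IsLobe G v C := hC
  replace hv : ¬ NotCut G v := hv
  replace hmin : ∀ v' C', ¬ NotCut G v' → IsLobe G v' C' → C.card ≤ C'.card :=
    fun v' C' hv' hC' => hmin (v', C') (by simp [hv', hC'])
  obtain ⟨D, hD, hCD⟩ : ∃ D, IsLobe G v D ∧ C ≠ D := by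
    obtain ⟨C₁, C₂, hC₁, hC₂, hne⟩ := not_notCut_iff.1 hv
    by_cases h : C = C₁
    · exact ⟨C₂, hC₂, h ▸ hne⟩
    · exact ⟨C₁, hC₁, h⟩
  have hcov := h2L v C D hC hD hCD
  have hd := hC.disjoint hD hCD
  by_cases hnc : ∀ u ∈ D, NotCut G u
  · have := card_le_of_cover hcov
    have hle' := hmin v D hv hD
    rcases two_lobes_of_notCut hG hdeg h1 hs hle h3 hodd hC hD hCD hcov (by omega)
      hle' hnc with h | ⟨e1, e2, h⟩
    · exact Or.inl h
    · exact Or.inr (Or.inl ⟨e1, e2, Or.inl h⟩)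
  · push Not at hnc
    obtain ⟨z, hz, hzcut⟩ := hnc
    obtain ⟨C', hC', hvC'⟩ : ∃ C', IsLobe G z C' ∧ v ∉ C' := by
      obtain ⟨C₁, C₂, h₁, h₂, hne⟩ := not_notCut_iff.1 hzcut
      by_cases h : v ∈ C₁
      · exact ⟨C₂, h₂, Finset.disjoint_left.1 (h₁.disjoint h₂ hne) h⟩
      · exact ⟨C₁, h₁, h⟩
    have hC'D := (hD.ssubset_of_mem hG hz hC' hvC').1
    obtain ⟨u, C₂, hC₂, hC₂', hu, hnc⟩ := hC'.exists_end hG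
    have huD : u ∈ D := by
      rcases hu with rfl | hu
      · exact hz
      · exact hC'D hu
    have hvu : v ≠ u := fun h => hD.notMem (h ▸ huD)
    have hv2 : v ∉ C₂ := fun h => hvC' (hC₂' h)
    have hucut : ¬ NotCut G u := by
      obtain ⟨C₃, hC₃, hvC₃⟩ := exists_isLobe (G := G) hvu
      exact not_notCut_iff.2 ⟨C₂, C₃, hC₂, hC₃, by rintro rfl; exact hv2 hvC₃⟩
    exact two_lobes_of_two_centres hG hdeg h1 hs hle h3 hodd h2L hn hC hC₂ hvu hv2
      (fun h => Finset.disjoint_left.1 hd h huD)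
      (Finset.disjoint_left.2 fun x hx hx2 =>
        Finset.disjoint_left.1 hd hx (hC'D (hC₂' hx2))) (hmin u C₂ hucut hC₂) hnc

end Fintype

/-! ### Recognising the exceptional graphs. -/

/-- Any right inverse of `ψ` is an embedding, so a labelling of `G` by the vertices of `H` need not
be shown injective. -/
theorem isContained_of_surjective {W : Type*} {H : SimpleGraph W} {ψ : W → V}
    (hψ : Function.Surjective ψ) (hadj : ∀ p q, G.Adj (ψ p) (ψ q) → H.Adj p q) : G ⊑ H := by
  refine ⟨⟨⟨Function.surjInv hψ, fun {x y} hxy => hadj _ _ ?_⟩, Function.injective_surjInv hψ⟩⟩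
  rwa [Function.surjInv_eq hψ, Function.surjInv_eq hψ]

theorem nonempty_iso_of_bijective {W : Type*} {H : SimpleGraph W} {ψ : W → V}
    (hψ : Function.Bijective ψ) (hadj : ∀ p q, G.Adj (ψ p) (ψ q) ↔ H.Adj p q) :
    Nonempty (G ≃g H) :=
  ⟨RelIso.symm ⟨Equiv.ofBijective ψ hψ, fun {p q} => hadj p q⟩⟩

theorem exists_enum {α : Type*} {C : Finset α} {m : ℕ} (hC : C.card = m) :
    ∃ e : Fin m → α, Function.Injective e ∧ (∀ j, e j ∈ C) ∧ ∀ x ∈ C, ∃ j, e j = x := by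
  refine ⟨fun j => ((C.equivFinOfCardEq hC).symm j : α), ?_, fun j => Subtype.property _, ?_⟩
  · intro i j hij
    exact (C.equivFinOfCardEq hC).symm.injective (Subtype.ext hij)
  · intro x hx
    exact ⟨C.equivFinOfCardEq hC ⟨x, hx⟩, by simp⟩

section joinGraph
variable {V W : Type*} {G : SimpleGraph V} {H : SimpleGraph W}

@[simp] theorem joinGraph_inl_inl {a b : V} : (joinGraph G H).Adj (.inl a) (.inl b) ↔ G.Adj a b := by
  simp [joinGraph]

@[simp] theorem joinGraph_inr_inr {a b : W} : (joinGraph G H).Adj (.inr a) (.inr b) ↔ H.Adj a b := by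
  simp [joinGraph]

@[simp] theorem joinGraph_inl_inr {a : V} {b : W} : (joinGraph G H).Adj (.inl a) (.inr b) := by
  simp [joinGraph]

@[simp] theorem joinGraph_inr_inl {a : W} {b : V} : (joinGraph G H).Adj (.inr a) (.inl b) := by
  simp [joinGraph]

end joinGraph

section identify
variable {V W : Type*} {G : SimpleGraph V} {u : V} {H : SimpleGraph W} {v : W}

@[simp] theorem identify_inr_inr {a b : {w : W // w ≠ v}} :
    (identify G u H v).Adj (.inr a) (.inr b) ↔ H.Adj a b := Iff.rfl

end identify

/-- Surjecting a hub graph onto `G`: if the hubs are `x 0` and `x 1` and the other vertices `e j`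
are adjacent to hubs only, the adjacencies are those of `S_{n,2}`. -/
theorem graphS_adj_of_hubs {m : ℕ} {x : Fin 2 → V} {e : Fin (m - 2) → V}
    (hee : ∀ i j, ¬ G.Adj (e i) (e j)) (p q : Fin 2 ⊕ Fin (m - 2))
    (h : G.Adj (Sum.elim x e p) (Sum.elim x e q)) : (graphS m 2).Adj p q := by
  rcases p with i | i <;> rcases q with j | j
  · simp only [Sum.elim_inl, graphS, joinGraph_inl_inl, top_adj] at h ⊢
    rintro rfl
    exact h.ne rfl
  · simp [graphS]
  · simp [graphS]
  · exact absurd h (hee i j)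

/-- Attaching a triangle at `u`. -/
theorem identify_triangle_adj {W : Type*} {H : SimpleGraph W} {u : W} {f : W → V} {c : Fin 2 → V}
    (hf : ∀ p q, G.Adj (f p) (f q) → H.Adj p q)
    (hfc : ∀ p i, G.Adj (f p) (c i) → p = u) (p q : W ⊕ {w : Fin 3 // w ≠ 0})
    (h : G.Adj (Sum.elim f (fun i => c (i.1.pred i.2)) p)
      (Sum.elim f (fun i => c (i.1.pred i.2)) q)) :
    (identify H u (⊤ : SimpleGraph (Fin 3)) 0).Adj p q := by
  rcases p with p | p <;> rcases q with q | q
  · exact hf p q h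
  · exact ⟨hfc p _ h, q.2.symm⟩
  · exact ⟨hfc q _ h.symm, p.2.symm⟩
  · simp only [Sum.elim_inr, identify_inr_inr, top_adj] at h ⊢
    intro hpq
    obtain rfl : p = q := Subtype.ext hpq
    exact h.ne rfl

theorem surjective_sum_elim_triangle {W : Type*} {f : W → V} {c : Fin 2 → V}
    (hcov : ∀ z, (∃ p, f p = z) ∨ ∃ i, c i = z) : Function.Surjective
      (Sum.elim f (fun i : {w : Fin 3 // w ≠ 0} => c (i.1.pred i.2))) := by
  intro z
  rcases hcov z with ⟨p, rfl⟩ | ⟨i, rfl⟩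
  · exact ⟨.inl p, rfl⟩
  · exact ⟨.inr ⟨i.succ, Fin.succ_ne_zero i⟩, by simp⟩

/-- Containment is all that can be claimed, since `G` may lack the edge between the two hubs. -/
theorem HasOneTriangle.isContained [Fintype V] (hG : HasOneTriangle G) :
    G ⊑ graphH1 (Fintype.card V) := by
  classical
  obtain ⟨v, w, c, c', L, hnd, hL, hcov, -, -, -, hc, hc', hLN, h4⟩ := hG
  have hcard : L.card = Fintype.card V - 2 - 2 := by
    have h1 : (Finset.univ : Finset V) = [v, w, c, c'].toFinset ∪ L := by
      ext z
      simpa [or_assoc] using hcov z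
    have h2 : Disjoint [v, w, c, c'].toFinset L :=
      Finset.disjoint_right.2 fun y hy h => hL y hy (by simpa using h)
    have := congrArg Finset.card h1
    rw [Finset.card_union_of_disjoint h2, Finset.card_univ, List.toFinset_card_of_nodup hnd] at this
    simp only [List.length_cons, List.length_nil] at this
    omega
  obtain ⟨e, -, heL, hesurj⟩ := exists_enum hcard
  have hLc : ∀ j, e j ≠ v ∧ e j ≠ w ∧ e j ≠ c ∧ e j ≠ c' := fun j => by
    simpa using hL (e j) (heL j)
  simp only [List.nodup_cons, List.mem_cons, List.not_mem_nil, or_false, not_or] at hnd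
  refine isContained_of_surjective (ψ := Sum.elim (Sum.elim ![v, w] e)
    (fun i => ![c, c'] (i.1.pred i.2))) (surjective_sum_elim_triangle ?_)
    (identify_triangle_adj (graphS_adj_of_hubs ?_) ?_)
  · intro z
    rcases hcov z with h | h
    · simp only [List.mem_cons, List.not_mem_nil, or_false] at h
      rcases h with rfl | rfl | rfl | rfl
      · exact Or.inl ⟨.inl 0, rfl⟩
      · exact Or.inl ⟨.inl 1, rfl⟩
      · exact Or.inr ⟨0, rfl⟩
      · exact Or.inr ⟨1, rfl⟩
    · obtain ⟨j, rfl⟩ := hesurj z h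
      exact Or.inl ⟨.inr j, rfl⟩
  · intro i j h
    rcases (hLN (e i) (heL i)).2.2 _ h with h | h
    · exact (hLc j).1 h
    · exact (hLc j).2.1 h
  · intro p i h
    have hp : Sum.elim ![v, w] e p = v := by
      fin_cases i
      · rcases hc _ h.symm with h' | h'
        · exact h'
        · rcases p with p | j
          · fin_cases p
            · rfl
            · exact absurd h' hnd.2.1.2
          · exact absurd h' (hLc j).2.2.2
      · rcases hc' _ h.symm with h' | h'
        · exact h'
        · rcases p with p | j
          · fin_cases p
            · rfl
            · exact absurd h' hnd.2.1.1
          · exact absurd h' (hLc j).2.2.1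
    rcases p with p | j
    · fin_cases p
      · rfl
      · exact absurd hp.symm hnd.1.1
    · exact absurd hp (hLc j).1

theorem HasTwoTriangles.isContained [Fintype V] (hG : HasTwoTriangles G) :
    G ⊑ graphH2 (Fintype.card V) := by
  classical
  obtain ⟨v, w, c, c', d, d', L, hnd, hL, hcov, -, -, -, -, -, -, hc, hc', hd, hd', hLN, h2⟩ := hG
  have hcard : L.card = Fintype.card V - 2 - 2 - 2 := by
    have h1 : (Finset.univ : Finset V) = [v, w, c, c', d, d'].toFinset ∪ L := by
      ext z
      simpa [or_assoc] using hcov z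
    have h2 : Disjoint [v, w, c, c', d, d'].toFinset L :=
      Finset.disjoint_right.2 fun y hy h => hL y hy (by simpa using h)
    have := congrArg Finset.card h1
    rw [Finset.card_union_of_disjoint h2, Finset.card_univ, List.toFinset_card_of_nodup hnd] at this
    simp only [List.length_cons, List.length_nil] at this
    omega
  obtain ⟨e, -, heL, hesurj⟩ := exists_enum hcard
  have hLc : ∀ j, e j ≠ v ∧ e j ≠ w ∧ e j ≠ c ∧ e j ≠ c' ∧ e j ≠ d ∧ e j ≠ d' := fun j => by
    simpa using hL (e j) (heL j)
  simp only [List.nodup_cons, List.mem_cons, List.not_mem_nil, or_false, not_or] at hnd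
  obtain ⟨⟨hvw, hvc, hvc', hvd, hvd'⟩, ⟨hwc, hwc', hwd, hwd'⟩, ⟨hcc', hcd, hcd'⟩, ⟨hc'd, hc'd'⟩,
    hdd', -⟩ := hnd
  refine isContained_of_surjective (ψ := Sum.elim (Sum.elim (Sum.elim ![v, w] e)
    (fun i => ![c, c'] (i.1.pred i.2))) (fun i => ![d, d'] (i.1.pred i.2)))
    (surjective_sum_elim_triangle ?_)
    (identify_triangle_adj (identify_triangle_adj (graphS_adj_of_hubs ?_) ?_) ?_)
  · intro z
    rcases hcov z with h | h
    · simp only [List.mem_cons, List.not_mem_nil, or_false] at h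
      rcases h with rfl | rfl | rfl | rfl | rfl | rfl
      · exact Or.inl ⟨.inl (.inl 0), rfl⟩
      · exact Or.inl ⟨.inl (.inl 1), rfl⟩
      · exact Or.inl ⟨.inr ⟨1, by decide⟩, rfl⟩
      · exact Or.inl ⟨.inr ⟨2, by decide⟩, rfl⟩
      · exact Or.inr ⟨0, rfl⟩
      · exact Or.inr ⟨1, rfl⟩
    · obtain ⟨j, rfl⟩ := hesurj z h
      exact Or.inl ⟨.inl (.inr j), rfl⟩
  · intro i j h
    rcases (hLN (e i) (heL i)).2.2 _ h with h | h
    · exact (hLc j).1 h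
    · exact (hLc j).2.1 h
  · intro p i h
    rcases p with p | j
    · fin_cases p
      · rfl
      · exfalso
        fin_cases i
        · rcases hc _ h.symm with h' | h'
          · exact hvw h'.symm
          · exact hwc' h'
        · rcases hc' _ h.symm with h' | h'
          · exact hvw h'.symm
          · exact hwc h'
    · exfalso
      fin_cases i
      · rcases hc _ h.symm with h' | h'
        · exact (hLc j).1 h'
        · exact (hLc j).2.2.2.1 h'
      · rcases hc' _ h.symm with h' | h'
        · exact (hLc j).1 h'
        · exact (hLc j).2.2.1 h'
  · intro p i h
    have hp : Sum.elim (Sum.elim ![v, w] e)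
        (fun i : {w : Fin 3 // w ≠ 0} => ![c, c'] (i.1.pred i.2)) p ∈ [w, d, d'] := by
      fin_cases i
      · rcases hd _ h.symm with h' | h'
        · simp [h']
        · simp [h']
      · rcases hd' _ h.symm with h' | h'
        · simp [h']
        · simp [h']
    simp only [List.mem_cons, List.not_mem_nil, or_false] at hp
    rcases p with (p | j) | ⟨j, hj⟩
    · fin_cases p
      · exfalso
        rcases hp with h' | h' | h'
        · exact hvw h'
        · exact hvd h'
        · exact hvd' h'
      · rfl
    · exfalso
      rcases hp with h' | h' | h'
      · exact (hLc j).2.1 h'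
      · exact (hLc j).2.2.2.2.1 h'
      · exact (hLc j).2.2.2.2.2 h'
    · exfalso
      fin_cases j
      · exact hj rfl
      · rcases hp with h' | h' | h'
        · exact hwc h'.symm
        · exact hcd h'
        · exact hcd' h'
      · rcases hp with h' | h' | h'
        · exact hwc' h'.symm
        · exact hc'd h'
        · exact hc'd' h'

theorem HasCliqueTriangle.nonempty_iso [Fintype V] {h : ℕ} (hG : HasCliqueTriangle G h) :
    Fintype.card V = 3 * h + 3 ∧ Nonempty (G ≃g graphU3 h) := by
  classical
  obtain ⟨x, C, hC, hcard, hcl, hx, hxC, hd, hcov⟩ := hG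
  choose e hinj heC hesurj using fun i => exists_enum (hcard i)
  -- In each clique the number `0` goes to the triangle vertex, the others to the lobe.
  let ψ : Fin 3 × Fin (h + 1) → V := fun p => Fin.cases (x p.1) (e p.1) p.2
  have hψ : Function.Bijective ψ := by
    constructor
    · rintro ⟨i, a⟩ ⟨j, b⟩ hab
      induction a using Fin.cases with
      | zero =>
        induction b using Fin.cases with
        | zero =>
          have hab' : x i = x j := hab
          by_contra hne
          exact (hx i j fun h => hne (by rw [h])).ne hab'
        | succ b =>
          have hab' : x i = e j b := hab
          exact absurd (hab' ▸ heC j b) (hxC i j)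
      | succ a =>
        induction b using Fin.cases with
        | zero =>
          have hab' : e i a = x j := hab
          exact absurd (hab' ▸ heC i a) (hxC j i)
        | succ b =>
          have hab' : e i a = e j b := hab
          have hij : i = j := by
            by_contra hne
            exact Finset.disjoint_left.1 (hd i j hne) (heC i a) (hab' ▸ heC j b)
          subst hij
          rw [hinj i hab']
    · intro z
      obtain ⟨i, rfl | hz⟩ := hcov z
      · exact ⟨(i, 0), rfl⟩
      · obtain ⟨j, rfl⟩ := hesurj i z hz
        exact ⟨(i, j.succ), rfl⟩
  constructor
  · have := Fintype.card_of_bijective hψ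
    simp at this
    omega
  · refine nonempty_iso_of_bijective hψ ?_
    rintro ⟨i, a⟩ ⟨j, b⟩
    have hmem : ∀ i a, ψ (i, a) = x i ∨ ψ (i, a) ∈ C i := by
      intro i a
      induction a using Fin.cases with
      | zero => exact Or.inl rfl
      | succ a => exact Or.inr (heC i a)
    have hcl' : ∀ i a b, ψ (i, a) ≠ ψ (i, b) → G.Adj (ψ (i, a)) (ψ (i, b)) := by
      intro i a b hne
      rcases hmem i a with h1 | h1
      · rcases hmem i b with h2 | h2
        · exact absurd (h1.trans h2.symm) hne
        · exact (hcl i _ h2 _ (Or.inl h1) hne.symm).symm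
      · exact hcl i _ h1 _ (hmem i b) hne
    have hsep : ∀ i j (a : Fin h) b, i ≠ j → ¬ G.Adj (e i a) (ψ (j, b)) := by
      intro i j a b hij hadj
      rcases (hC i).closed _ (heC i a) _ hadj with h1 | h1
      · rcases hmem j b with h2 | h2
        · exact (hx i j hij).ne (h1.symm.trans h2)
        · exact hxC i j (h1 ▸ h2)
      · rcases hmem j b with h2 | h2
        · exact hxC j i (h2 ▸ h1)
        · exact Finset.disjoint_left.1 (hd i j hij) h1 h2
    constructor
    · intro hadj
      refine ⟨fun h => hadj.ne (by rw [h]), ?_⟩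
      by_cases hij : i = j
      · exact Or.inl hij
      · refine Or.inr ⟨?_, ?_⟩
        · induction a using Fin.cases with
          | zero => rfl
          | succ a => exact absurd hadj (hsep i j a b hij)
        · induction b using Fin.cases with
          | zero => rfl
          | succ b => exact absurd hadj.symm (hsep j i b a (Ne.symm hij))
    · rintro ⟨hne, hij | ⟨ha, hb⟩⟩
      · obtain rfl : i = j := hij
        exact hcl' i a b (hψ.1.ne hne)
      · obtain rfl : a = 0 := ha
        obtain rfl : b = 0 := hb
        exact hx i j fun h => hne (by rw [h])

/-! ### Translation of the hypotheses, and graphs of type `L`. -/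

section Fintype
variable [Fintype V]

theorem connSet_univ (hG : G.Connected) : ConnSet G Finset.univ := by
  rintro A - ⟨a, ha⟩ hA y -
  obtain ⟨p⟩ := hG.preconnected a y
  induction p with
  | nil => exact ha
  | cons h _ ih => exact ih (hA _ ha _ (Finset.mem_univ _) h)

theorem minDegGE_of_le_minDegree [DecidableRel G.Adj] {h : ℕ} (hG : h ≤ G.minDegree) :
    MinDegGE G h := by
  intro x S hS
  refine hG.trans ((G.minDegree_le_degree x).trans ?_)
  rw [← card_neighborFinset_eq_degree]
  exact Finset.card_le_card fun y hy => hS y ((mem_neighborFinset G x y).1 hy)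

/-- Since `G` has a component, `G - v` has at least two. The vertices reachable from one of them in
`G - v` form a closed set, which `NotCut` would force to be everything. -/
theorem not_notCut_of_isCutVertex [Nonempty V] {v : V} (hv : IsCutVertex G v) : ¬ NotCut G v := by
  classical
  intro hN
  have h1 : 0 < Nat.card G.ConnectedComponent := Nat.card_pos
  have h2 : 1 < Nat.card (G.induce ({v}ᶜ : Set V)).ConnectedComponent := lt_of_le_of_lt h1 hv
  obtain ⟨C, D, hCD⟩ := (Finite.one_lt_card_iff_nontrivial.1 h2).exists_pair_ne
  induction C using ConnectedComponent.ind with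
  | h x =>
  induction D using ConnectedComponent.ind with
  | h y =>
  apply hCD
  rw [ConnectedComponent.eq]
  have := hN (Finset.univ.filter fun z => ∃ hz : z ∈ ({v}ᶜ : Set V),
    (G.induce ({v}ᶜ : Set V)).Reachable x ⟨z, hz⟩) ⟨x, Finset.mem_filter.2 ⟨Finset.mem_univ _, x.2, .rfl⟩⟩ (by simp) ?_ y y.2
  · exact (Finset.mem_filter.1 this).2.2
  · intro z hz w hzw
    obtain ⟨hz', hr⟩ := (Finset.mem_filter.1 hz).2
    by_cases hw : w = v
    · exact Or.inl hw
    · refine Or.inr (Finset.mem_filter.2 ⟨Finset.mem_univ _, hw, hr.trans ?_⟩)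
      exact Adj.reachable (G := G.induce ({v}ᶜ : Set V)) (u := ⟨z, hz'⟩) (v := ⟨w, hw⟩) hzw

end Fintype

theorem copies_adj {m : ℕ} {W : Type*} {H : SimpleGraph W} {i j : Fin m} {x y : W} :
    (copies m H).Adj ⟨i, x⟩ ⟨j, y⟩ ↔ i = j ∧ H.Adj x y := by
  constructor
  · rintro ⟨k, u, w, h1, h2, h⟩
    cases h1
    cases h2
    exact ⟨rfl, h⟩
  · rintro ⟨rfl, h⟩
    exact ⟨i, x, y, rfl, rfl, h⟩

theorem disjUnion_adj_same {ι : Type*} {W : ι → Type*} {H : ∀ i, SimpleGraph (W i)} {i : ι}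
    {x y : W i} : (disjUnion H).Adj ⟨i, x⟩ ⟨i, y⟩ ↔ (H i).Adj x y := by
  constructor
  · rintro ⟨k, u, w, h1, h2, h⟩
    cases h1
    cases h2
    exact h
  · exact fun h => ⟨i, x, y, rfl, rfl, h⟩

/-- A graph whose lobes at `v` have `h` or `h + 1` vertices, laid out over the vertices of
`L_{t₁,t₂,h,h+1}`. -/
theorem exists_layout [Fintype V] {v : V} {h : ℕ}
    (hall : ∀ C, IsLobe G v C → C.card = h ∨ C.card = h + 1) :
    ∃ (t₁ t₂ : ℕ) (ψ : Fin 1 ⊕ ((Σ _ : Fin t₁, Fin h) ⊕ (Σ _ : Fin t₂, Fin (h + 1))) → V),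
      Function.Bijective ψ ∧ (∀ i, ψ (.inl i) = v) ∧
      (∀ p q, G.Adj (ψ p) (ψ q) → (graphL2 t₁ t₂ h).Adj p q) ∧
      (∀ p q, (graphL2 t₁ t₂ h).Adj (.inr p) (.inr q) →
        ∃ C, IsLobe G v C ∧ ψ (.inr p) ∈ C ∧ ψ (.inr q) ∈ C) ∧
      (t₂ = 0 ∨ ∃ C, IsLobe G v C ∧ C.card = h + 1) := by
  classical
  obtain ⟨e₁, he₁, hm₁, hs₁⟩ := exists_enum
    (C := Finset.univ.filter fun C => IsLobe G v C ∧ C.card = h) rfl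
  obtain ⟨e₂, he₂, hm₂, hs₂⟩ := exists_enum
    (C := Finset.univ.filter fun C => IsLobe G v C ∧ C.card = h + 1) rfl
  simp only [Finset.mem_filter, Finset.mem_univ, true_and] at hm₁ hm₂ hs₁ hs₂
  choose f₁ hf₁ hfm₁ hfs₁ using fun i => exists_enum (hm₁ i).2
  choose f₂ hf₂ hfm₂ hfs₂ using fun i => exists_enum (hm₂ i).2
  have hne₁ : ∀ i j, f₁ i j ≠ v := fun i j he => (hm₁ i).1.notMem (he ▸ hfm₁ i j)
  have hne₂ : ∀ i j, f₂ i j ≠ v := fun i j he => (hm₂ i).1.notMem (he ▸ hfm₂ i j)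
  have hsame : ∀ {C C' : Finset V} {x y : V}, IsLobe G v C → IsLobe G v C' → x ∈ C → y ∈ C' →
      G.Adj x y → C = C' := by
    intro C C' x y hC hC' hx hy hxy
    rcases hC.closed x hx y hxy with rfl | hyC
    · exact absurd hy hC'.notMem
    · exact hC.eq_of_mem hC' hyC hy
  refine ⟨_, _, Sum.elim (fun _ => v) (Sum.elim (fun p => f₁ p.1 p.2) (fun p => f₂ p.1 p.2)),
    ⟨?_, ?_⟩, fun _ => rfl, ?_, ?_, ?_⟩
  · rintro (i | ⟨i, a⟩ | ⟨i, a⟩) (j | ⟨j, b⟩ | ⟨j, b⟩) hpq <;>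
      simp only [Sum.elim_inl, Sum.elim_inr] at hpq
    · rw [Subsingleton.elim i j]
    · exact absurd hpq.symm (hne₁ _ _)
    · exact absurd hpq.symm (hne₂ _ _)
    · exact absurd hpq (hne₁ _ _)
    · obtain rfl := he₁ ((hm₁ i).1.eq_of_mem (hm₁ j).1 (hfm₁ i a) (hpq ▸ hfm₁ j b))
      rw [hf₁ i hpq]
    · have := (hm₁ i).1.eq_of_mem (hm₂ j).1 (hfm₁ i a) (hpq ▸ hfm₂ j b)
      have h1 := (hm₁ i).2
      rw [this, (hm₂ j).2] at h1
      omega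
    · exact absurd hpq (hne₂ _ _)
    · have := (hm₂ i).1.eq_of_mem (hm₁ j).1 (hfm₂ i a) (hpq ▸ hfm₁ j b)
      have h1 := (hm₂ i).2
      rw [this, (hm₁ j).2] at h1
      omega
    · obtain rfl := he₂ ((hm₂ i).1.eq_of_mem (hm₂ j).1 (hfm₂ i a) (hpq ▸ hfm₂ j b))
      rw [hf₂ i hpq]
  · intro z
    by_cases hz : z = v
    · exact ⟨.inl 0, hz.symm⟩
    obtain ⟨C, hC, hzC⟩ := exists_isLobe (G := G) hz
    rcases hall C hC with hcard | hcard
    · obtain ⟨i, rfl⟩ := hs₁ C ⟨hC, hcard⟩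
      obtain ⟨j, rfl⟩ := hfs₁ i z hzC
      exact ⟨.inr (.inl ⟨i, j⟩), rfl⟩
    · obtain ⟨i, rfl⟩ := hs₂ C ⟨hC, hcard⟩
      obtain ⟨j, rfl⟩ := hfs₂ i z hzC
      exact ⟨.inr (.inr ⟨i, j⟩), rfl⟩
  · rintro (i | ⟨i, a⟩ | ⟨i, a⟩) (j | ⟨j, b⟩ | ⟨j, b⟩) hpq <;>
      simp only [Sum.elim_inl, Sum.elim_inr] at hpq
    · exact absurd rfl hpq.ne
    · simp [graphL2]
    · simp [graphL2]
    · simp [graphL2]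
    · obtain rfl := he₁ (hsame (hm₁ i).1 (hm₁ j).1 (hfm₁ i a) (hfm₁ j b) hpq)
      simp only [graphL2, joinGraph_inr_inr, sum_adj, copies_adj, top_adj, true_and]
      rintro rfl
      exact hpq.ne rfl
    · have := hsame (hm₁ i).1 (hm₂ j).1 (hfm₁ i a) (hfm₂ j b) hpq
      have h1 := (hm₁ i).2
      rw [this, (hm₂ j).2] at h1
      omega
    · simp [graphL2]
    · have := hsame (hm₂ i).1 (hm₁ j).1 (hfm₂ i a) (hfm₁ j b) hpq
      have h1 := (hm₂ i).2
      rw [this, (hm₁ j).2] at h1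
      omega
    · obtain rfl := he₂ (hsame (hm₂ i).1 (hm₂ j).1 (hfm₂ i a) (hfm₂ j b) hpq)
      simp only [graphL2, joinGraph_inr_inr, sum_adj, copies_adj, top_adj, true_and]
      rintro rfl
      exact hpq.ne rfl
  · rintro (⟨i, a⟩ | ⟨i, a⟩) (⟨j, b⟩ | ⟨j, b⟩) hpq <;>
      simp only [graphL2, joinGraph_inr_inr, sum_adj, copies_adj] at hpq
    · obtain ⟨rfl, -⟩ := hpq
      exact ⟨_, (hm₁ i).1, hfm₁ i a, hfm₁ i b⟩
    · obtain ⟨rfl, -⟩ := hpq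
      exact ⟨_, (hm₂ i).1, hfm₂ i a, hfm₂ i b⟩
  · by_cases ht : (Finset.univ.filter fun C => IsLobe G v C ∧ C.card = h + 1).card = 0
    · exact Or.inl ht
    · exact Or.inr ⟨_, hm₂ ⟨0, Nat.pos_of_ne_zero ht⟩⟩

theorem isContained_graphL2 [Fintype V] {v : V} {h : ℕ}
    (hall : ∀ C, IsLobe G v C → C.card = h ∨ C.card = h + 1) :
    ∃ t₁ t₂, Fintype.card V = t₁ * h + t₂ * (h + 1) + 1 ∧ G ⊑ graphL2 t₁ t₂ h := by
  obtain ⟨t₁, t₂, ψ, hψ, -, hadj, -⟩ := exists_layout hall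
  refine ⟨t₁, t₂, ?_, isContained_of_surjective hψ.2 hadj⟩
  have := Fintype.card_of_bijective hψ
  simp at this
  omega

theorem nonempty_iso_graphL [Fintype V] {v : V} {h : ℕ}
    (hall : ∀ C, IsLobe G v C → C.card = h ∧ ∀ x ∈ C, ∀ y, y = v ∨ y ∈ C → x ≠ y → G.Adj x y) :
    ∃ t, Fintype.card V = t * h + 1 ∧ Nonempty (G ≃g graphL t h) := by
  obtain ⟨t₁, t₂, ψ, hψ, hv, hadj, hlobe, ht⟩ := exists_layout fun C hC => Or.inl (hall C hC).1
  have ht₂ : t₂ = 0 := by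
    rcases ht with ht | ⟨C, hC, hcard⟩
    · exact ht
    · have := (hall C hC).1
      omega
  subst ht₂
  refine ⟨t₁, ?_, nonempty_iso_of_bijective hψ fun p q => ⟨hadj p q, fun hpq => ?_⟩⟩
  · have := Fintype.card_of_bijective hψ
    simp at this
    omega
  have hcen : ∀ q, G.Adj (ψ (.inr q)) v := by
    intro q
    have hne : ψ (.inr q) ≠ v := by
      rw [← hv 0]
      exact hψ.1.ne (by simp)
    obtain ⟨C, hC, hqC⟩ := exists_isLobe (G := G) hne
    exact (hall C hC).2 _ hqC v (Or.inl rfl) hne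
  rcases p with i | p <;> rcases q with j | q
  · exact absurd (Subsingleton.elim i j) (by simpa [graphL2] using hpq)
  · rw [hv]
    exact (hcen q).symm
  · rw [hv]
    exact hcen p
  · obtain ⟨C, hC, hp, hq⟩ := hlobe p q hpq
    exact (hall C hC).2 _ hp _ (Or.inr hq) (hψ.1.ne hpq.ne)

/-- The graph-theoretic content common to both parts; these differ only in which values of `s₁` and
`s₂` can occur and in what the exceptions mean for the forest. -/
theorem two_paths_or_exception [Fintype V] (hG : ConnSet G Finset.univ) {h : ℕ}
    (hdeg : MinDegGE G h) (h1 : 1 ≤ h) {s₁ s₂ : ℕ} (hs : s₁ + s₂ = 2 * h + 4) (hle : s₂ ≤ s₁)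
    (h3 : 3 ≤ s₂) (hodd : Odd s₂) (hn : 2 * h + 4 ≤ Fintype.card V) (hcut : ∃ v, ¬ NotCut G v) :
    HasTwoPaths G s₁ s₂ ∨
      (s₂ = h + 1 ∧ ∃ t, Fintype.card V = t * h + 1 ∧ Nonempty (G ≃g graphL t h)) ∨
      (s₁ = 5 ∧ s₂ = 3 ∧ (HasOneTriangle G ∨ HasTwoTriangles G)) ∨
      (s₂ = h + 2 ∧ (Fintype.card V = 3 * h + 3 ∧ Nonempty (G ≃g graphU3 h) ∨
        ∃ t₁ t₂, Fintype.card V = t₁ * h + t₂ * (h + 1) + 1 ∧ G ⊑ graphL2 t₁ t₂ h)) := by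
  by_cases h2L : AtMostTwoLobes G
  · rcases two_lobes hG hdeg h1 hs hle h3 hodd h2L hn hcut with hP | hP | ⟨hs₂, hP⟩
    · exact Or.inl hP
    · exact Or.inr (Or.inr (Or.inl hP))
    · exact Or.inr (Or.inr (Or.inr ⟨hs₂, Or.inl hP.nonempty_iso⟩))
  · unfold AtMostTwoLobes at h2L
    push Not at h2L
    obtain ⟨v, C, C', hC, hC', hne, x, hxv, hxC, hxC'⟩ := h2L
    obtain ⟨D, hD, hxD⟩ := exists_isLobe (G := G) hxv
    have hCD : C ≠ D := fun he => hxC (he ▸ hxD)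
    have hCD' : C' ≠ D := fun he => hxC' (he ▸ hxD)
    rcases three_lobes hG hdeg h1 hs hle h3 hodd hC hC' hD hne hCD hCD' with
      hP | ⟨hs₂, hP⟩ | ⟨hs₂, hP⟩
    · exact Or.inl hP
    · exact Or.inr (Or.inl ⟨hs₂, nonempty_iso_graphL hP⟩)
    · exact Or.inr (Or.inr (Or.inr ⟨hs₂, Or.inr (isContained_graphL2 hP)⟩))

/-! ### From two paths to the linear forest. -/

/-- A graph whose vertices are numbered in such a way that adjacent vertices have consecutive
numbers, mapped onto an initial part of a path. -/
theorem IsPathList.exists_hom {W : Type*} {H : SimpleGraph W} {l : List V} (hl : IsPathList G l)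
    {f : W → ℕ} (hf : Function.Injective f) (hlt : ∀ w, f w < l.length)
    (hadj : ∀ p q, H.Adj p q → f p + 1 = f q ∨ f q + 1 = f p) :
    ∃ g : W → V, Function.Injective g ∧ (∀ w, g w ∈ l) ∧ ∀ p q, H.Adj p q → G.Adj (g p) (g q) := by
  have key : ∀ p q, f p + 1 = f q → G.Adj (l[f p]'(hlt p)) (l[f q]'(hlt q)) := by
    intro p q hpq
    have := List.isChain_iff_getElem.1 hl.1 (f p) (hpq ▸ hlt q)
    simpa only [hpq] using this
  refine ⟨fun w => l[f w]'(hlt w), fun p q hpq => ?_, fun w => List.getElem_mem _, ?_⟩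
  · exact hf ((hl.2.getElem_inj_iff).1 hpq)
  · intro p q hpq
    rcases hadj p q hpq with h | h
    · exact key p q h
    · exact (key q p h).symm

theorem IsPathList.exists_hom_pathGraph {l : List V} (hl : IsPathList G l) {m : ℕ}
    (hm : m ≤ l.length) : ∃ g : Fin m → V, Function.Injective g ∧ (∀ w, g w ∈ l) ∧
      ∀ p q, (pathGraph m).Adj p q → G.Adj (g p) (g q) :=
  hl.exists_hom Fin.val_injective (fun w => w.2.trans_le hm) fun _ _ => pathGraph_adj.1

theorem IsPathList.exists_hom_disjUnion {l : List V} (hl : IsPathList G l) {k : ℕ} {m : Fin k → ℕ}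
    (hm : ∑ i, m i ≤ l.length) : ∃ g : (Σ i, Fin (m i)) → V, Function.Injective g ∧
      (∀ w, g w ∈ l) ∧ ∀ p q, (disjUnion fun i => pathGraph (m i)).Adj p q → G.Adj (g p) (g q) := by
  -- The paths are laid one after another along `l`; `finSigmaFinEquiv` numbers each block
  -- consecutively.
  refine hl.exists_hom (f := fun w => (finSigmaFinEquiv w : ℕ))
    (Fin.val_injective.comp finSigmaFinEquiv.injective)
    (fun w => (finSigmaFinEquiv w).2.trans_le hm) ?_
  rintro _ _ ⟨i, u, w, rfl, rfl, h⟩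
  rw [pathGraph_adj] at h
  simp only [finSigmaFinEquiv_apply]
  omega

theorem linForest_isContained {k : ℕ} {a : Fin k → ℕ} {b₁ b₂ : ℕ} {l₀ l₁ l₂ : List V}
    (h₀ : IsPathList G l₀) (h₁ : IsPathList G l₁) (h₂ : IsPathList G l₂)
    (h01 : l₀.Disjoint l₁) (h02 : l₀.Disjoint l₂) (h12 : l₁.Disjoint l₂)
    (hn₀ : 2 * ∑ i, a i ≤ l₀.length) (hn₁ : 2 * b₁ + 1 ≤ l₁.length)
    (hn₂ : 2 * b₂ + 1 ≤ l₂.length) : linForest a b₁ b₂ ⊑ G := by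
  rw [Finset.mul_sum] at hn₀
  obtain ⟨g₀, hi₀, hm₀, ha₀⟩ := h₀.exists_hom_disjUnion hn₀
  obtain ⟨g₁, hi₁, hm₁, ha₁⟩ := h₁.exists_hom_pathGraph hn₁
  obtain ⟨g₂, hi₂, hm₂, ha₂⟩ := h₂.exists_hom_pathGraph hn₂
  refine ⟨⟨⟨Sum.elim g₀ (Sum.elim g₁ g₂), ?_⟩, ?_⟩⟩
  · rintro (p | p | p) (q | q | q) h <;> simp only [linForest, sum_adj] at h
    · exact ha₀ p q h
    · exact ha₁ p q h
    · exact ha₂ p q h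
  · refine hi₀.sumElim (hi₁.sumElim hi₂ fun p q h => h12 (hm₁ p) (h ▸ hm₂ q)) ?_
    rintro p (q | q) h
    · exact h01 (hm₀ p) (h ▸ hm₁ q)
    · exact h02 (hm₀ p) (h ▸ hm₂ q)

theorem HasTwoPaths.linForest_isContained {k : ℕ} {a : Fin k → ℕ} {b₁ b₂ : ℕ}
    (hP : HasTwoPaths G (2 * (∑ i, a i + b₁) + 1) (2 * b₂ + 1)) : linForest a b₁ b₂ ⊑ G := by
  obtain ⟨l₁, l₂, h₁, h₂, hd, hn₁, hn₂⟩ := hP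
  refine LinForest.linForest_isContained (h₁.take (2 * ∑ i, a i)) (h₁.drop (2 * ∑ i, a i)) h₂
    (List.disjoint_take_drop h₁.2 le_rfl) (fun x hx => hd (List.mem_of_mem_take hx))
    (fun x hx => hd (List.mem_of_mem_drop hx)) ?_ ?_ hn₂
  · simp
    omega
  · simp
    omega

theorem exists_two_of_card {α : Type*} {L : Finset α} (hL : 2 ≤ L.card) :
    ∃ y ∈ L, ∃ z ∈ L, y ≠ z := by
  obtain ⟨y, hy, z, hz, hyz⟩ := Finset.one_lt_card.1 hL
  exact ⟨y, hy, z, hz, hyz⟩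

/-- Two paths of orders five and three are not necessary for `P₂ ∪ 2P₃`. The edge `c c'` serves as
`P₂`, and a `P₃` is centred at each of `v` and `w`. -/
theorem linForest_isContained_of_triangle (hG : HasOneTriangle G ∨ HasTwoTriangles G) {k : ℕ}
    {a : Fin k → ℕ} (ha : ∑ i, a i = 1) : linForest a 1 1 ⊑ G := by
  classical
  rcases hG with ⟨v, w, c, c', L, hnd, hL, -, -, -, hcc, -, -, hLN, h4⟩ |
    ⟨v, w, c, c', d, d', L, hnd, hL, -, -, -, hcc, hwd, hwd', -, -, -, -, -, hLN, h2⟩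
  · obtain ⟨y₁, h₁, y₂, h₂, hy⟩ := exists_two_of_card (L := L) (by omega)
    obtain ⟨y₃, h₃, y₄, h₄, hy'⟩ := exists_two_of_card (L := L \ {y₁, y₂}) (by
      have := Finset.le_card_sdiff {y₁, y₂} L
      rw [Finset.card_pair hy] at this
      omega)
    simp only [Finset.mem_sdiff, Finset.mem_insert, Finset.mem_singleton, not_or] at h₃ h₄
    have n₁ := hL _ h₁
    have n₂ := hL _ h₂
    have n₃ := hL _ h₃.1
    have n₄ := hL _ h₄.1
    refine linForest_isContained (l₀ := [c, c']) (l₁ := [y₁, v, y₂]) (l₂ := [y₃, w, y₄])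
      ⟨by simpa using hcc, by simpa using hcc.ne⟩
      (isPathList_three hy (hLN _ h₁).1 (hLN _ h₂).1.symm)
      (isPathList_three hy' (hLN _ h₃.1).2.1 (hLN _ h₄.1).2.1.symm) ?_ ?_ ?_ (by simp [ha])
      (by simp) (by simp)
    all_goals
      simp only [List.nodup_cons, List.mem_cons, List.not_mem_nil, or_false, not_or,
        List.disjoint_cons_left, List.disjoint_nil_left, and_true] at *
      grind
  · obtain ⟨y₁, h₁, y₂, h₂, hy⟩ := exists_two_of_card h2
    have n₁ := hL _ h₁
    have n₂ := hL _ h₂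
    refine linForest_isContained (l₀ := [c, c']) (l₁ := [y₁, v, y₂]) (l₂ := [d, w, d'])
      ⟨by simpa using hcc, by simpa using hcc.ne⟩
      (isPathList_three hy (hLN _ h₁).1 (hLN _ h₂).1.symm)
      (isPathList_three ?_ hwd.symm hwd') ?_ ?_ ?_ (by simp [ha]) (by simp) (by simp)
    all_goals
      simp only [List.nodup_cons, List.mem_cons, List.not_mem_nil, or_false, not_or,
        List.disjoint_cons_left, List.disjoint_nil_left, and_true] at *
      grind

theorem nonempty_linForest_iso_sum (a : Fin 0 → ℕ) (b₁ b₂ : ℕ) :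
    Nonempty (linForest a b₁ b₂ ≃g pathGraph (2 * b₁ + 1) ⊕g pathGraph (2 * b₂ + 1)) := by
  refine nonempty_iso_of_bijective (ψ := Sum.inr) ⟨Sum.inr_injective, ?_⟩ fun p q => ?_
  · rintro (⟨i, -⟩ | p)
    · exact i.elim0
    · exact ⟨p, rfl⟩
  · simp [linForest]

theorem nonempty_sum_iso_copies {W : Type*} (H : SimpleGraph W) :
    Nonempty (H ⊕g H ≃g copies 2 H) := by
  have : Nonempty (copies 2 H ≃g H ⊕g H) := by
    refine nonempty_iso_of_bijective (ψ := Sum.elim (fun p => (⟨0, p⟩ : Σ _ : Fin 2, W)) fun p => ⟨1, p⟩) ⟨?_, ?_⟩ ?_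
    · rintro (p | p) (q | q) h
      all_goals
        simp only [Sum.elim_inl, Sum.elim_inr] at h
        cases h
        try rfl
    · rintro ⟨i, p⟩
      fin_cases i
      · exact ⟨.inl p, rfl⟩
      · exact ⟨.inr p, rfl⟩
    · rintro (p | p) (q | q) <;> simp [copies_adj]
  exact this.map RelIso.symm

theorem nonempty_disjUnion_fin_one_iso (m : Fin 1 → ℕ) :
    Nonempty (disjUnion (fun i => pathGraph (m i)) ≃g pathGraph (m 0)) := by
  refine nonempty_iso_of_bijective (ψ := Sigma.mk (β := fun i => Fin (m i)) 0) ⟨sigma_mk_injective, ?_⟩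
    fun p q => disjUnion_adj_same
  rintro ⟨i, p⟩
  obtain rfl := Subsingleton.elim i 0
  exact ⟨p, rfl⟩

theorem nonempty_linForest_iso_sum_copies (a : Fin 1 → ℕ) (ha : a 0 = 1) (b : ℕ) :
    Nonempty (linForest a b b ≃g pathGraph 2 ⊕g copies 2 (pathGraph (2 * b + 1))) := by
  obtain ⟨e₁⟩ := nonempty_disjUnion_fin_one_iso fun i => 2 * a i
  obtain ⟨e₂⟩ := nonempty_sum_iso_copies (pathGraph (2 * b + 1))
  rw [ha] at e₁
  exact ⟨Iso.sumCongr e₁ e₂⟩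

end LinForest

/-! ### The theorem. -/

theorem theorem4 {V : Type*} [Fintype V] (G : SimpleGraph V) [DecidableRel G.Adj]
    (k : ℕ) (a : Fin k → ℕ) (b₁ b₂ h n : ℕ)
    (ha : Antitone a) (ha1 : ∀ i, 1 ≤ a i)
    (hb : b₂ ≤ b₁) (hb₂ : 1 ≤ b₂)
    (hh : h = ∑ i, a i + (b₁ + b₂) - 1)
    (hV : Fintype.card V = n) (hn : 2 * h + 4 ≤ n)
    (hG : G.Connected) (hcut : ∃ v, IsCutVertex G v) :
    (h ≤ G.minDegree → 1 ≤ h → k = 0 →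
      linForest a b₁ b₂ ⊑ G ∨
      (Nonempty (linForest a b₁ b₂ ≃g pathGraph 5 ⊕g pathGraph 3) ∧
        (G ⊑ graphH1 n ∨ G ⊑ graphH2 n)) ∨
      (Nonempty (linForest a b₁ b₂ ≃g pathGraph (2 * b₁ + 1) ⊕g pathGraph (2 * b₁ - 1)) ∧
        ∃ t, n = t * h + 1 ∧ Nonempty (G ≃g graphL t h)) ∨
      (Nonempty (linForest a b₁ b₂ ≃g copies 2 (pathGraph (2 * b₁ + 1))) ∧
        ((n = 3 * h + 3 ∧ Nonempty (G ≃g graphU3 h)) ∨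
          (∃ t₁ t₂, n = t₁ * h + t₂ * (h + 1) + 1 ∧ G ⊑ graphL2 t₁ t₂ h) ∨
          (2 ≤ h ∧ ∃ t₁ t₂, n = t₁ * h + (t₂ + 1) * (h + 1) + 1 ∧ G ⊑ graphF t₁ t₂ h) ∨
          (2 ≤ h ∧ ∃ t₁ t₂, n = t₁ * h + (t₂ + 2) * (h + 1) + 1 ∧ G ⊑ graphT t₁ t₂ h)))) ∧
    (h ≤ G.minDegree → 2 ≤ h → 1 ≤ k →
      linForest a b₁ b₂ ⊑ G ∨
      (Nonempty (linForest a b₁ b₂ ≃g pathGraph 2 ⊕g copies 2 (pathGraph (2 * b₁ + 1))) ∧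
        ∃ t, n = t * h + 1 ∧ Nonempty (G ≃g graphL t h))) := by
  subst hV
  have hconn := LinForest.connSet_univ hG
  have hcut' : ∃ v, ¬ LinForest.NotCut G v := by
    obtain ⟨v, hv⟩ := hcut
    have : Nonempty V := ⟨v⟩
    exact ⟨v, LinForest.not_notCut_of_isCutVertex hv⟩
  constructor
  · rintro hdeg h1 rfl
    obtain ⟨e⟩ := LinForest.nonempty_linForest_iso_sum a b₁ b₂
    have hsum : ∑ i, a i = 0 := by simp
    rw [hsum] at hh
    rcases LinForest.two_paths_or_exception hconn (LinForest.minDegGE_of_le_minDegree hdeg) h1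
      (s₁ := 2 * (∑ i, a i + b₁) + 1) (s₂ := 2 * b₂ + 1) (by omega) (by omega) (by omega) ⟨b₂, rfl⟩
      hn hcut' with hP | ⟨hs, hP⟩ | ⟨hs₁, hs₂, hP⟩ | ⟨hs, hP⟩
    · exact Or.inl hP.linForest_isContained
    · refine Or.inr (Or.inr (Or.inl ⟨?_, hP⟩))
      rw [show 2 * b₁ - 1 = 2 * b₂ + 1 by omega]
      exact ⟨e⟩
    · refine Or.inr (Or.inl ⟨?_, hP.imp (·.isContained) (·.isContained)⟩)
      obtain rfl : b₁ = 2 := by omega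
      obtain rfl : b₂ = 1 := by omega
      exact ⟨e⟩
    · obtain rfl : b₁ = b₂ := by omega
      obtain ⟨e'⟩ := LinForest.nonempty_sum_iso_copies (pathGraph (2 * b₁ + 1))
      -- The families `F` and `T` are not needed as separate outcomes: a `K_{h+1}` attached to the
      -- centre by one edge is part of one completely joined to it, so they lie in graphs
      -- `L_{t₁,t₂,h,h+1}` with larger `t₂`.
      exact Or.inr (Or.inr (Or.inr ⟨⟨e.trans e'⟩, hP.imp_right Or.inl⟩))
  · intro hdeg h2 hk
    have hka : k ≤ ∑ i, a i := by
      simpa using Finset.card_nsmul_le_sum Finset.univ a 1 fun i _ => ha1 i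
    rcases LinForest.two_paths_or_exception hconn (LinForest.minDegGE_of_le_minDegree hdeg)
      (by omega) (s₁ := 2 * (∑ i, a i + b₁) + 1) (s₂ := 2 * b₂ + 1) (by omega) (by omega) (by omega)
      ⟨b₂, rfl⟩ hn hcut' with hP | ⟨hs, hP⟩ | ⟨hs₁, hs₂, hP⟩ | ⟨hs, hP⟩
    · exact Or.inl hP.linForest_isContained
    · refine Or.inr ⟨?_, hP⟩
      -- From `s₂ = h + 1` and `s₁ = h + 3` follows `∑ aᵢ + b₁ = b₂ + 1`. As `∑ aᵢ ≥ 1` and `b₂ ≤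
      -- b₁`, the even part is a single `P₂`.
      obtain rfl : b₁ = b₂ := by omega
      obtain rfl : k = 1 := by omega
      have ha0 : a 0 = 1 := by
        rw [Fin.sum_univ_one] at *
        omega
      exact LinForest.nonempty_linForest_iso_sum_copies a ha0 b₁
    · obtain rfl : b₂ = 1 := by omega
      obtain rfl : b₁ = 1 := by omega
      exact Or.inl (LinForest.linForest_isContained_of_triangle hP (by omega))
    -- Here `s₁ = s₂`, that is `∑ aᵢ + b₁ = b₂`, which `∑ aᵢ ≥ 1` rules out.
    · omega
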